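/- Let $n\ge 2$ and let $(M,c)$ be a smooth conformal manifold (Hausdorff, second countable, without boundary) of dimension $d=n+1$ and of any signature. Write $\mathcal E[w]$ for the (complex) bundle of conformal densities of weight $w$: a section is a function $f_g$ for each $g\in c$, with $f_{e^{2\Upsilon}g}=e^{w\Upsilon}f_g$. Let $\mathcal T$ be the standard tractor bundle with the tractor metric $h$ and the normal tractor connection $\nabla$: each $g\in c$ splits $\mathcal T\cong\mathcal E[1]\oplus T^*M[1]\oplus\mathcal E[-1]$, with $h(T,T)=\boldsymbol g^{-1}(\mu,\mu)+2\sigma\rho$ and $$\nabla_a(\sigma,\mu_b,\rho)=(\nabla_a\sigma-\mu_a,\ \nabla_a\mu_b+\boldsymbol g_{ab}\rho+P_{ab}\sigma,\ \nabla_a\rho-P_{ac}\mu^c),$$ where $\boldsymbol g$ is the conformal metric and $P_{ab}$ the Schouten tensor; under $\hat g=e^{2\Upsilon}g$ the splitting changes by $(\sigma,\mu_b,\rho)\mapsto(\sigma,\mu_b+\sigma\Upsilon_b,\rho-\boldsymbol g^{cd}\Upsilon_c\mu_d-\frac12\sigma\boldsymbol g^{cd}\Upsilon_c\Upsilon_d)$,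 $\Upsilon_a=\nabla_a\Upsilon$. Let $\mathcal E^\Phi$ be any tractor bundle, that is, a tensor power of $\mathcal T$ or a tensor part of one (the image of a projection built from permutations of the tensor factors and contractions and insertions of $h$), and $\mathcal E^\Phi[w]=\mathcal E^\Phi\otimes\mathcal E[w]$. The Thomas $D$-operator $D_A:\Gamma\mathcal E^\Phi[w]\to\Gamma(\mathcal T\otimes\mathcal E^\Phi[w-1])$ is given in a scale $g$ by $$D_AV=\big((d+2w-2)wV,\ (d+2w-2)\nabla_aV,\ -(\Delta+wJ)V\big),\qquad J=P_a{}^a,\quad \Delta=\boldsymbol g^{ab}\nabla_a\nabla_b .$$ Let $\sigma$ be a real section of $\mathcal E[1]$ such that the scale tractor $I_A=\frac1d D_A\sigma$ satisfies $I^2=h(I,I)\ne0$ everywhere on $M$, and let $\Sigma$ be the zero locus of $\sigma$. Put $I\cdot D=I^AD_A:\Gamma\mathcal E^\Phi[w]\to\Gamma\mathcal E^\Phi[w-1]$. Then for every integer $k\ge1$ $$P_k:=\Big(-\frac1{I^2}\,I\cdot D\Big)^k$$ is a well-defined linear differential operator $\Gamma\mathcal E^\Phi[\frac{k-n}2]\to\Gamma\mathcal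 E^\Phi[\frac{-k-n}2]$ (independent of the choice of $g\in c$), and it acts tangentially along $\Sigma$: there is a linear operator $\widetilde P:\Gamma\mathcal E^\Phi[\frac{k-n}2-1]\to\Gamma\mathcal E^\Phi[\frac{-k-n}2-1]$ with $P_k\circ\sigma=\sigma\circ\widetilde P$. Consequently there is exactly one linear operator $$P_k^\Sigma:\Gamma\big(\mathcal E^\Phi[\tfrac{k-n}2]|_\Sigma\big)\to\Gamma\big(\mathcal E^\Phi[\tfrac{-k-n}2]|_\Sigma\big)$$ with $P_k^\Sigma(f|_\Sigma)=(P_kf)|_\Sigma$ for all $f\in\Gamma\mathcal E^\Phi[\frac{k-n}2]$, and it is a differential operator. -/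

import Mathlib

open scoped Manifold ContDiff Topology

noncomputable section

namespace Tractor

/-! ## Tensor calculus over a commutative `ℝ`-algebra `A`

Everything in this part is used for `A = C^∞(M)` only: vector fields are the derivations of
`C^∞(M)`, tensor fields are `C^∞(M)`-multilinear maps. -/

section Calculus

variable {A : Type*} [CommRing A] [Algebra ℝ A]

/-- Vector fields: derivations of the algebra of functions. -/
abbrev VectorField (A : Type*) [CommRing A] [Algebra ℝ A] : Type _ := Derivation ℝ A A

/-- One-forms: `A`-linear functionals on vector fields. -/
abbrev OneForm (A : Type*) [CommRing A] [Algebra ℝ A] : Type _ := VectorField A →ₗ[A] A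

/-- The differential of a function. -/
def differential (f : A) : OneForm A where
  toFun X := X f
  map_add' _ _ := rfl
  map_smul' _ _ := rfl

theorem lie_smul_right (f : A) (X Y : VectorField A) : ⁅X, f • Y⁆ = X f • Y + f • ⁅X, Y⁆ := by
  ext a
  simp only [Derivation.commutator_apply, Derivation.smul_apply, Derivation.add_apply, smul_eq_mul,
    Derivation.leibniz]
  ring

theorem lie_smul_left (f : A) (X Y : VectorField A) : ⁅f • X, Y⁆ = f • ⁅X, Y⁆ - Y f • X := by
  ext a
  simp only [Derivation.commutator_apply, Derivation.smul_apply, Derivation.sub_apply, smul_eq_mul,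
    Derivation.leibniz]
  ring

/-- A pseudo-Riemannian metric (of any signature): a symmetric `A`-bilinear form on vector fields
which identifies vector fields with one-forms. -/
structure PseudoRiemMetric (A : Type*) [CommRing A] [Algebra ℝ A] where
  form : VectorField A →ₗ[A] VectorField A →ₗ[A] A
  symm : ∀ X Y, form X Y = form Y X
  perfect : Function.Bijective form

namespace PseudoRiemMetric

/-- Lowering an index. -/
def flat (g : PseudoRiemMetric A) : VectorField A ≃ₗ[A] OneForm A :=
  LinearEquiv.ofBijective g.form g.perfect

/-- Raising an index. -/
def sharp (g : PseudoRiemMetric A) : OneForm A ≃ₗ[A] VectorField A := g.flat.symm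

/-- The inverse metric on one-forms. -/
def inv (g : PseudoRiemMetric A) : OneForm A →ₗ[A] OneForm A →ₗ[A] A :=
  g.form.compl₁₂ g.sharp.toLinearMap g.sharp.toLinearMap

end PseudoRiemMetric

/-- A linear connection on the module `S` (of sections of a vector bundle). -/
structure Connection (S : Type*) [AddCommGroup S] [Module A S] where
  cov : VectorField A → S → S
  add_left : ∀ X Y s, cov (X + Y) s = cov X s + cov Y s
  smul_left : ∀ (f : A) X s, cov (f • X) s = f • cov X s
  add_right : ∀ X s t, cov X (s + t) = cov X s + cov X t
  leibniz : ∀ X (f : A) s, cov X (f • s) = X f • s + f • cov X s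

/-- The connection `X f` on functions; also the connection that a metric `g` induces on
densities, when these are trivialised by `g`. -/
def trivialConnection : Connection (A := A) A where
  cov X f := X f
  add_left _ _ _ := rfl
  smul_left _ _ _ := rfl
  add_right X s t := map_add X s t
  leibniz X f s := by simp [Derivation.leibniz, mul_comm, add_comm]

/-- The metric trace `b^{AB} B_{AB}`: for a nondegenerate form `b` on `V`, this is the unique
`A`-linear map that sends the bilinear map `(x, y) ↦ b(v, x) b(v', y) s` to `b(v, v') s`. -/
def formTrace {V S : Type*} [AddCommGroup V] [Module A V] [AddCommGroup S] [Module A S]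
    (b : V →ₗ[A] V →ₗ[A] A) : (V →ₗ[A] V →ₗ[A] S) →ₗ[A] S :=
  Classical.epsilon fun t : (V →ₗ[A] V →ₗ[A] S) →ₗ[A] S =>
    ∀ (v v' : V) (s : S) (B : V →ₗ[A] V →ₗ[A] S),
      (∀ x y, B x y = (b v x * b v' y) • s) → t B = b v v' • s

namespace PseudoRiemMetric

variable (g : PseudoRiemMetric A)

/-- The right-hand side of the Koszul formula for `2 g(∇_X Y, Z)`, as a one-form in `Z`. -/
def koszul (X Y : VectorField A) : OneForm A where
  toFun Z := X (g.form Y Z) + Y (g.form X Z) - Z (g.form X Y)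
    + g.form ⁅X, Y⁆ Z - g.form ⁅X, Z⁆ Y - g.form ⁅Y, Z⁆ X
  map_add' Z W := by
    simp only [map_add, lie_add, LinearMap.add_apply, Derivation.add_apply]
    ring
  map_smul' f Z := by
    simp only [map_smul, map_add, lie_smul_right, LinearMap.add_apply, LinearMap.smul_apply,
      Derivation.smul_apply, smul_eq_mul, Derivation.leibniz, RingHom.id_apply, g.symm Z Y,
      g.symm Z X]
    ring

/-- The Levi-Civita connection: `2 g(∇_X Y, Z)` is given by the Koszul formula. -/
def leviCivita : Connection (A := A) (VectorField A) where
  cov X Y := algebraMap ℝ A (1 / 2) • g.sharp (g.koszul X Y)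
  add_left X Y s := by
    rw [← smul_add, ← map_add]
    congr 2
    ext Z
    simp only [koszul, LinearMap.coe_mk, AddHom.coe_mk, map_add, add_lie, LinearMap.add_apply,
      Derivation.add_apply]
    ring
  smul_left f X s := by
    have h : g.koszul (f • X) s = f • g.koszul X s := by
      refine LinearMap.ext fun Z => ?_
      simp only [koszul, LinearMap.coe_mk, AddHom.coe_mk, map_smul, map_sub, lie_smul_left,
        LinearMap.sub_apply, LinearMap.smul_apply, Derivation.smul_apply, smul_eq_mul,
        Derivation.leibniz, g.symm X s, g.symm X Z]
      ring
    rw [h, map_smul, smul_comm]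
  add_right X s t := by
    rw [← smul_add, ← map_add]
    congr 2
    ext Z
    simp only [koszul, LinearMap.coe_mk, AddHom.coe_mk, map_add, add_lie, lie_add,
      LinearMap.add_apply, Derivation.add_apply]
    ring
  leibniz X f s := by
    have h : g.koszul X (f • s) = (algebraMap ℝ A 2 * X f) • g.flat s + f • g.koszul X s := by
      have hf : ∀ Z, g.flat s Z = g.form s Z := fun _ => rfl
      ext Z
      simp only [koszul, LinearMap.coe_mk, AddHom.coe_mk, map_smul, map_sub, lie_smul_left,
        lie_smul_right, map_add, LinearMap.add_apply, LinearMap.sub_apply, LinearMap.smul_apply,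
        Derivation.smul_apply, smul_eq_mul, Derivation.leibniz, hf, map_ofNat, g.symm s X]
      ring
    rw [h, map_add, map_smul, map_smul, smul_add, smul_smul, smul_comm f, ← mul_assoc, ← map_mul]
    simp [sharp]

/-- The second covariant derivative `(X, Y) ↦ ∇_X ∇_Y s - ∇_{∇_X Y} s` of a section `s`, for the
connection `D` coupled to the Levi-Civita connection. -/
def hessian {S : Type*} [AddCommGroup S] [Module A S] (D : Connection (A := A) S) (s : S) :
    VectorField A →ₗ[A] VectorField A →ₗ[A] S :=
  LinearMap.mk₂ A (fun X Y => D.cov X (D.cov Y s) - D.cov (g.leviCivita.cov X Y) s)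
    (fun X X' Y => by rw [D.add_left, g.leviCivita.add_left, D.add_left]; abel)
    (fun f X Y => by rw [D.smul_left, g.leviCivita.smul_left, D.smul_left, smul_sub])
    (fun X Y Y' => by
      rw [D.add_left, g.leviCivita.add_right, D.add_left, D.add_right]; abel)
    (fun f X Y => by
      rw [D.smul_left, g.leviCivita.leibniz, D.add_left, D.smul_left, D.smul_left, D.leibniz,
        smul_sub]
      abel)

/-- The Laplacian `Δ = g^{ab} ∇_a ∇_b`. -/
def laplacian {S : Type*} [AddCommGroup S] [Module A S] (D : Connection (A := A) S) (s : S) : S :=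
  formTrace g.form (g.hessian D s)

/-- The Riemann curvature `R(X, Y) Z = ∇_X ∇_Y Z - ∇_Y ∇_X Z - ∇_{[X, Y]} Z`. -/
def curvature (X Y Z : VectorField A) : VectorField A :=
  g.leviCivita.cov X (g.leviCivita.cov Y Z) - g.leviCivita.cov Y (g.leviCivita.cov X Z)
    - g.leviCivita.cov ⁅X, Y⁆ Z

end PseudoRiemMetric

theorem Connection.sub_left {S : Type*} [AddCommGroup S] [Module A S] (D : Connection (A := A) S)
    (X Y : VectorField A) (s : S) : D.cov (X - Y) s = D.cov X s - D.cov Y s := by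
  have h := D.add_left (X - Y) Y s
  rw [sub_add_cancel] at h
  rw [h, add_sub_cancel_right]

namespace PseudoRiemMetric

variable (g : PseudoRiemMetric A)

/-- The bilinear form `(X, W) ↦ g(R(X, Y) Z, W)`. -/
def curvatureForm (Y Z : VectorField A) : VectorField A →ₗ[A] VectorField A →ₗ[A] A where
  toFun X := g.form (g.curvature X Y Z)
  map_add' X X' := by
    rw [← map_add]
    congr 1
    simp only [curvature, Connection.add_left, Connection.add_right, add_lie]
    abel
  map_smul' f X := by
    rw [RingHom.id_apply, ← map_smul]
    congr 1
    simp only [curvature, Connection.smul_left, Connection.leibniz, Connection.sub_left,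
      lie_smul_left, smul_sub]
    abel

/-- The Ricci tensor: `Ric(Y, Z)` is the trace of `X ↦ R(X, Y) Z`. -/
def ricci : VectorField A →ₗ[A] VectorField A →ₗ[A] A :=
  LinearMap.mk₂ A (fun Y Z => formTrace g.form (g.curvatureForm Y Z))
    (fun Y Y' Z => by
      rw [← map_add]
      congr 1
      ext X W
      simp only [curvatureForm, curvature, LinearMap.coe_mk, AddHom.coe_mk, LinearMap.add_apply,
        Connection.add_left, Connection.add_right, lie_add, map_sub, map_add, LinearMap.sub_apply]
      ring)
    (fun f Y Z => by
      rw [← map_smul]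
      congr 1
      ext X W
      simp only [curvatureForm, curvature, LinearMap.coe_mk, AddHom.coe_mk, LinearMap.add_apply,
        LinearMap.smul_apply, Connection.smul_left, Connection.add_left, Connection.leibniz,
        lie_smul_right, map_sub, map_add, map_smul, LinearMap.sub_apply, smul_eq_mul]
      ring)
    (fun Y Z Z' => by
      rw [← map_add]
      congr 1
      ext X W
      simp only [curvatureForm, curvature, LinearMap.coe_mk, AddHom.coe_mk, LinearMap.add_apply,
        Connection.add_right, map_sub, map_add, LinearMap.sub_apply]
      ring)
    (fun f Y Z => by
      rw [← map_smul]
      congr 1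
      ext X W
      simp only [curvatureForm, curvature, LinearMap.coe_mk, AddHom.coe_mk, LinearMap.add_apply,
        LinearMap.smul_apply, Connection.add_right, Connection.leibniz,
        Derivation.commutator_apply, map_sub, map_add, map_smul, LinearMap.sub_apply, smul_eq_mul]
      ring)

/-- The scalar curvature. -/
def scalarCurvature : A := formTrace g.form g.ricci

/-- The Schouten tensor in dimension `d`, determined by `Ric = (d - 2) P + (tr P) g`. -/
def schouten (d : ℕ) : VectorField A →ₗ[A] VectorField A →ₗ[A] A :=
  algebraMap ℝ A (1 / ((d : ℝ) - 2)) •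
    (g.ricci - (algebraMap ℝ A (1 / (2 * ((d : ℝ) - 1))) * g.scalarCurvature) • g.form)

/-- The trace `J` of the Schouten tensor. -/
def schoutenTrace (d : ℕ) : A := formTrace g.form (g.schouten d)

end PseudoRiemMetric

/-! ### The standard tractor bundle in a scale -/

/-- Sections of the standard tractor bundle in the splitting
`E[1] ⊕ T^*M[1] ⊕ E[-1]` given by a metric of the conformal class, all densities being trivialised
by the same metric. -/
abbrev TractorField (A : Type*) [CommRing A] [Algebra ℝ A] : Type _ := A × OneForm A × A

namespace PseudoRiemMetric

variable (g : PseudoRiemMetric A)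

/-- The tractor metric `g⁻¹(μ, μ') + σ ρ' + ρ σ'`. -/
def tractorMetric : TractorField A →ₗ[A] TractorField A →ₗ[A] A :=
  LinearMap.mk₂ A (fun T T' => g.inv T.2.1 T'.2.1 + T.1 * T'.2.2 + T.2.2 * T'.1)
    (fun T T' U => by simp; ring)
    (fun f T U => by simp; ring)
    (fun T U U' => by simp; ring)
    (fun f T U => by simp; ring)

/-- The Levi-Civita connection on one-forms. -/
def covOneForm (X : VectorField A) (μ : OneForm A) : OneForm A where
  toFun Y := X (μ Y) - μ (g.leviCivita.cov X Y)
  map_add' Y Z := by simp only [map_add, Connection.add_right]; ring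
  map_smul' f Y := by
    simp only [map_add, map_smul, Connection.leibniz, smul_eq_mul, Derivation.leibniz,
      RingHom.id_apply]
    ring

/-- The normal tractor connection
`∇_a (σ, μ_b, ρ) = (∇_a σ - μ_a, ∇_a μ_b + g_{ab} ρ + P_{ab} σ, ∇_a ρ - P_{ac} μ^c)`. -/
def tractorConnection (d : ℕ) : Connection (A := A) (TractorField A) where
  cov X T :=
    (X T.1 - T.2.1 X,
      g.covOneForm X T.2.1 + T.2.2 • g.form X + T.1 • g.schouten d X,
      X T.2.2 - g.schouten d X (g.sharp T.2.1))
  add_left X Y T := by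
    refine Prod.ext ?_ (Prod.ext (LinearMap.ext fun Z => ?_) ?_)
    · simp; ring
    · simp [covOneForm, Connection.add_left]; ring
    · simp; ring
  smul_left f X T := by
    refine Prod.ext ?_ (Prod.ext (LinearMap.ext fun Z => ?_) ?_)
    · simp; ring
    · simp [covOneForm, Connection.smul_left]; ring
    · simp; ring
  add_right X T U := by
    refine Prod.ext ?_ (Prod.ext (LinearMap.ext fun Z => ?_) ?_)
    · simp; ring
    · simp [covOneForm]; ring
    · simp; ring
  leibniz X f T := by
    refine Prod.ext ?_ (Prod.ext (LinearMap.ext fun Z => ?_) ?_)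
    · simp; ring
    · simp [covOneForm]; ring
    · simp; ring

end PseudoRiemMetric

/-! ### Tractor tensors -/

/-- Real tractor tensors of rank `r` in a scale: sections of the `r`-th tensor power of the standard
tractor bundle, which is identified with its dual by the tractor metric. -/
abbrev TractorTensor (A : Type*) [CommRing A] [Algebra ℝ A] (r : ℕ) : Type _ :=
  MultilinearMap A (fun _ : Fin r => TractorField A) A

namespace PseudoRiemMetric

variable (g : PseudoRiemMetric A)

/-- The covariant derivative of a tractor tensor:
`(∇_X F)(T₁, …, T_r) = X (F(T₁, …, T_r)) - ∑ i, F(T₁, …, ∇_X T_i, …, T_r)`. -/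
def covTensor (d : ℕ) {r : ℕ} (X : VectorField A) (F : TractorTensor A r) : TractorTensor A r :=
  MultilinearMap.mk' (fun T => X (F T) -
      ∑ i, F (Function.update T i ((g.tractorConnection d).cov X (T i))))
    (fun T j a b => by
      have key : ∀ i, F (Function.update (Function.update T j (a + b)) i
            ((g.tractorConnection d).cov X (Function.update T j (a + b) i)))
          = F (Function.update (Function.update T j a) i
            ((g.tractorConnection d).cov X (Function.update T j a i)))
          + F (Function.update (Function.update T j b) i
            ((g.tractorConnection d).cov X (Function.update T j b i))) := by
        intro i
        by_cases h : i = j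
        · subst h
          simp [Connection.add_right]
        · simp only [Function.update_of_ne h]
          rw [Function.update_comm (Ne.symm h), Function.update_comm (Ne.symm h),
            Function.update_comm (Ne.symm h), F.map_update_add]
      simp only [key, Finset.sum_add_distrib, F.map_update_add, map_add]
      ring)
    (fun T j f a => by
      have key : ∀ i, F (Function.update (Function.update T j (f • a)) i
            ((g.tractorConnection d).cov X (Function.update T j (f • a) i)))
          = f * F (Function.update (Function.update T j a) i
            ((g.tractorConnection d).cov X (Function.update T j a i)))
          + if i = j then X f * F (Function.update T j a) else 0 := by
        intro i
        by_cases h : i = j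
        · subst h
          simp only [Function.update_self, Function.update_idem, Connection.leibniz,
            F.map_update_add, F.map_update_smul, smul_eq_mul, if_true]
          ring
        · simp only [Function.update_of_ne h, if_neg h, add_zero]
          rw [Function.update_comm (Ne.symm h), Function.update_comm (Ne.symm h),
            F.map_update_smul, smul_eq_mul]
      simp only [key, Finset.sum_add_distrib, F.map_update_smul, smul_eq_mul, Derivation.leibniz,
        ← Finset.mul_sum, Finset.sum_ite_eq', Finset.mem_univ, if_true]
      ring)

/-- The tractor connection on tractor tensors. -/
def tensorConnection (d r : ℕ) : Connection (A := A) (TractorTensor A r) where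
  cov := g.covTensor d
  add_left X Y F := by
    ext T
    simp only [covTensor, MultilinearMap.mk'_apply, _root_.add_apply, Derivation.add_apply,
      Connection.add_left, F.map_update_add, Finset.sum_add_distrib]
    ring
  smul_left f X F := by
    ext T
    simp only [covTensor, MultilinearMap.mk'_apply, _root_.smul_apply,
      Derivation.smul_apply, Connection.smul_left, F.map_update_smul, smul_eq_mul,
      ← Finset.mul_sum]
    ring
  add_right X F G := by
    ext T
    simp only [covTensor, MultilinearMap.mk'_apply, _root_.add_apply, map_add,
      Finset.sum_add_distrib]
    ring
  leibniz X f F := by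
    ext T
    simp only [covTensor, MultilinearMap.mk'_apply, _root_.add_apply,
      _root_.smul_apply, smul_eq_mul, Derivation.leibniz, ← Finset.mul_sum]
    ring

/-! ### The Thomas D-operator and the degenerate Laplacian -/

/-- The Thomas D-operator on sections of weight `w`, for the connection `D`:
`((d + 2w - 2) w V, (d + 2w - 2) ∇_a V, -(Δ + J w) V)`. -/
def thomasD (d : ℕ) {S : Type*} [AddCommGroup S] [Module A S] (D : Connection (A := A) S) (w : ℝ)
    (V : S) : S × (VectorField A →ₗ[A] S) × S :=
  (algebraMap ℝ A (((d : ℝ) + 2 * w - 2) * w) • V,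
    algebraMap ℝ A ((d : ℝ) + 2 * w - 2) •
      { toFun := fun X => D.cov X V
        map_add' := fun X Y => D.add_left X Y V
        map_smul' := fun f X => D.smul_left f X V },
    -(g.laplacian D V + (algebraMap ℝ A w * g.schoutenTrace d) • V))

/-- The contraction of a standard tractor `(σ, μ, ρ)` with a tractor with values in `S`, by the
tractor metric. -/
def contract {S : Type*} [AddCommGroup S] [Module A S] (T : TractorField A)
    (U : S × (VectorField A →ₗ[A] S) × S) : S :=
  U.2.1 (g.sharp T.2.1) + T.1 • U.2.2 + T.2.2 • U.1

/-- The scale tractor `I = (1/d) D σ` of a function `σ` that represents a density of weight `1`. -/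
def scaleTractor (d : ℕ) (σ : A) : TractorField A :=
  algebraMap ℝ A (1 / (d : ℝ)) • g.thomasD d trivialConnection 1 σ

/-- The squared length `I²` of the scale tractor. -/
def scaleSq (d : ℕ) (σ : A) : A :=
  g.tractorMetric (g.scaleTractor d σ) (g.scaleTractor d σ)

/-- The degenerate Laplacian `I·D` on tractor tensors of weight `w`. -/
def degenerateLaplacian (d : ℕ) (σ : A) {r : ℕ} (w : ℝ) (F : TractorTensor A r) :
    TractorTensor A r :=
  g.contract (g.scaleTractor d σ) (g.thomasD d (g.tensorConnection d r) w F)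

/-- The operator `-(1/I²) I·D` on tractor tensors of weight `w`. -/
def yOp (d : ℕ) (σ : A) {r : ℕ} (w : ℝ) (F : TractorTensor A r) : TractorTensor A r :=
  -(Ring.inverse (g.scaleSq d σ) • g.degenerateLaplacian d σ w F)

/-- The power `(-(1/I²) I·D)^k`, beginning at weight `w`; each factor lowers the weight by `1`. -/
def yPow (d : ℕ) (σ : A) {r : ℕ} : ℕ → ℝ → TractorTensor A r → TractorTensor A r
  | 0, _, F => F
  | k + 1, w, F => yPow d σ k (w - 1) (g.yOp d σ w F)

/-- The bilinear form that `F` gives in the slots `i` and `j`, the other arguments being those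
of `T`. -/
def slotForm {r : ℕ} (F : TractorTensor A r) (T : Fin r → TractorField A) (i j : Fin r)
    (hij : i ≠ j) : TractorField A →ₗ[A] TractorField A →ₗ[A] A :=
  LinearMap.mk₂ A (fun a b => F (Function.update (Function.update T i a) j b))
    (fun a a' b => by
      rw [Function.update_comm hij, Function.update_comm hij, Function.update_comm hij,
        F.map_update_add])
    (fun f a b => by
      rw [Function.update_comm hij, Function.update_comm hij, F.map_update_smul])
    (fun a b b' => by rw [F.map_update_add])
    (fun f a b => by rw [F.map_update_smul])

end PseudoRiemMetric

end Calculus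

/-! ## Conformal manifolds -/

section Manifold

variable (d : ℕ) (M : Type*) [TopologicalSpace M] [ChartedSpace (EuclideanSpace ℝ (Fin d)) M]

/-- Smooth real functions on `M`. -/
abbrev Fn : Type _ := C^∞⟮𝓡 d, M; 𝓘(ℝ, ℝ), ℝ⟯

/-- Smooth complex functions on `M`. -/
abbrev CFn : Type _ := C^∞⟮𝓡 d, M; 𝓘(ℝ, ℂ), ℂ⟯

variable {d M}

/-- The function `exp (w Υ)`. -/
def expFn (w : ℝ) (Υ : Fn d M) : Fn d M :=
  ⟨fun x => Real.exp (w * Υ x),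
    Real.contDiff_exp.contMDiff.comp (contMDiff_const.mul Υ.contMDiff)⟩

/-- `g' = exp (2 Υ) g`. -/
def IsRescaling (g : PseudoRiemMetric (Fn d M)) (Υ : Fn d M) (g' : PseudoRiemMetric (Fn d M)) : Prop :=
  ∀ X Y, g'.form X Y = expFn 2 Υ * g.form X Y

variable (d M) in
/-- A conformal structure: an equivalence class of metrics, where `g` and `exp (2 Υ) g` are
equivalent. -/
structure ConformalStructure where
  metrics : Set (PseudoRiemMetric (Fn d M))
  nonempty : metrics.Nonempty
  mem_iff : ∀ g ∈ metrics, ∀ g', g' ∈ metrics ↔ ∃ Υ, IsRescaling g Υ g'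

/-- The change of the splitting of the standard tractor bundle from `g` to `exp (2 Υ) g`,
`(σ, μ, ρ) ↦ (σ, μ + σ dΥ, ρ - g⁻¹(dΥ, μ) - (1/2) σ g⁻¹(dΥ, dΥ))`, with the factors that come from
trivialising `E[1]`, `T^*M[1]`, `E[-1]` by the new metric. -/
def changeSplitting (g : PseudoRiemMetric (Fn d M)) (Υ : Fn d M) (T : TractorField (Fn d M)) :
    TractorField (Fn d M) :=
  (expFn 1 Υ * T.1,
    expFn 1 Υ • (T.2.1 + T.1 • differential Υ),
    expFn (-1) Υ * (T.2.2 - g.inv (differential Υ) T.2.1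
      - algebraMap ℝ (Fn d M) (1 / 2) * T.1 * g.inv (differential Υ) (differential Υ)))

/-- A real density of weight `w`: a function for each metric of the class, with
`f̂ = exp (w Υ) f` under `ĝ = exp (2 Υ) g`. -/
structure RealDensity (c : ConformalStructure d M) (w : ℝ) where
  val : c.metrics → Fn d M
  equivariant : ∀ (g g' : c.metrics) (Υ : Fn d M), IsRescaling g.1 Υ g'.1 →
    val g' = expFn w Υ * val g

/-- The zero locus of a density. -/
def RealDensity.zeroLocus {c : ConformalStructure d M} {w : ℝ} (σ : RealDensity c w) : Set M :=
  {x | ∀ g, σ.val g x = 0}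

/-- The natural endomorphisms of the `r`-th tensor power of the standard tractor bundle (given in
each scale): those generated, by real linear combinations and compositions, by the permutations of
the slots and by the maps that contract two slots with the tractor metric and then insert the
tractor metric there. -/
inductive IsNaturalEnd (c : ConformalStructure d M) (r : ℕ) :
    (c.metrics → Module.End (Fn d M) (TractorTensor (Fn d M) r)) → Prop
  | perm (e : Equiv.Perm (Fin r)) (K) (h : ∀ g F T, K g F T = F (T ∘ e)) : IsNaturalEnd c r K
  | contraction (i j : Fin r) (hij : i ≠ j) (K)
      (h : ∀ g F T, K g F T = g.1.tractorMetric (T i) (T j) *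
        formTrace g.1.tractorMetric (PseudoRiemMetric.slotForm F T i j hij)) : IsNaturalEnd c r K
  | add (K L) : IsNaturalEnd c r K → IsNaturalEnd c r L → IsNaturalEnd c r (K + L)
  | comp (K L) : IsNaturalEnd c r K → IsNaturalEnd c r L →
      IsNaturalEnd c r (fun g => (K g).comp (L g))
  | smul (t : ℝ) (K) : IsNaturalEnd c r K →
      IsNaturalEnd c r (fun g => algebraMap ℝ (Fn d M) t • K g)

/-- A tractor bundle `E^Φ`: a tensor power of the standard tractor bundle or a tensor part of one,
that is, the image of a natural projection. -/
structure TractorBundle (c : ConformalStructure d M) where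
  rank : ℕ
  proj : c.metrics → Module.End (Fn d M) (TractorTensor (Fn d M) rank)
  natural : IsNaturalEnd c rank proj
  idem : ∀ g F, proj g (proj g F) = proj g F

/-! ### Complex-valued tensors -/

/-- Complex multiples of complex functions. -/
instance : SMul ℂ (CFn d M) :=
  ⟨fun z f => ⟨fun x => z * f x, (contDiff_const.mul contDiff_id).contMDiff.comp f.contMDiff⟩⟩

instance : Module ℂ (CFn d M) where
  one_smul f := by ext x; exact one_mul (f x)
  mul_smul z w f := by ext x; exact mul_assoc z w (f x)
  smul_zero z := by ext x; exact mul_zero z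
  smul_add z f f' := by ext x; exact mul_add z (f x) (f' x)
  add_smul z w f := by ext x; exact add_mul z w (f x)
  zero_smul f := by ext x; exact zero_mul (f x)

instance : SMulCommClass (Fn d M) ℂ (CFn d M) :=
  ⟨fun a z f => by ext x; exact smul_comm (a x) z (f x)⟩

instance : SMulCommClass ℂ (Fn d M) (CFn d M) :=
  ⟨fun z a f => (smul_comm a z f).symm⟩

/-- The real part. -/
def reFn : CFn d M →ₗ[Fn d M] Fn d M where
  toFun f := ⟨fun x => (f x).re, Complex.reCLM.contMDiff.comp f.contMDiff⟩
  map_add' _ _ := rfl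
  map_smul' a f := by ext x; exact Complex.smul_re (a x) (f x)

/-- The imaginary part. -/
def imFn : CFn d M →ₗ[Fn d M] Fn d M where
  toFun f := ⟨fun x => (f x).im, Complex.imCLM.contMDiff.comp f.contMDiff⟩
  map_add' _ _ := rfl
  map_smul' a f := by ext x; exact Complex.smul_im (a x) (f x)

/-- The inclusion of the real functions in the complex functions. -/
def ofRealFn : Fn d M →ₗ[Fn d M] CFn d M where
  toFun f := ⟨fun x => (f x : ℂ), Complex.ofRealCLM.contMDiff.comp f.contMDiff⟩
  map_add' f g := by ext x; exact Complex.ofReal_add (f x) (g x)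
  map_smul' a f := by
    ext x
    exact (Complex.ofReal_mul (a x) (f x)).trans (Complex.real_smul (x := a x)).symm

variable (d M) in
/-- Complex tractor tensors of rank `r` in a scale. -/
abbrev CTractorTensor (r : ℕ) : Type _ :=
  MultilinearMap (Fn d M) (fun _ : Fin r => TractorField (Fn d M)) (CFn d M)

/-- The real part of a complex tractor tensor. -/
def reT {r : ℕ} (F : CTractorTensor d M r) : TractorTensor (Fn d M) r :=
  reFn.compMultilinearMap F

/-- The imaginary part of a complex tractor tensor. -/
def imT {r : ℕ} (F : CTractorTensor d M r) : TractorTensor (Fn d M) r :=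
  imFn.compMultilinearMap F

theorem reT_add {r : ℕ} (F G : CTractorTensor d M r) : reT (F + G) = reT F + reT G := rfl

theorem imT_add {r : ℕ} (F G : CTractorTensor d M r) : imT (F + G) = imT F + imT G := rfl

theorem reT_fnSMul {r : ℕ} (f : Fn d M) (F : CTractorTensor d M r) : reT (f • F) = f • reT F :=
  MultilinearMap.ext fun T => reFn.map_smul f (F T)

theorem imT_fnSMul {r : ℕ} (f : Fn d M) (F : CTractorTensor d M r) : imT (f • F) = f • imT F :=
  MultilinearMap.ext fun T => imFn.map_smul f (F T)

theorem reT_smul {r : ℕ} (z : ℂ) (F : CTractorTensor d M r) :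
    reT (z • F) = algebraMap ℝ (Fn d M) z.re • reT F - algebraMap ℝ (Fn d M) z.im • imT F :=
  MultilinearMap.ext fun T => by ext x; exact Complex.mul_re z (F T x)

theorem imT_smul {r : ℕ} (z : ℂ) (F : CTractorTensor d M r) :
    imT (z • F) = algebraMap ℝ (Fn d M) z.re • imT F + algebraMap ℝ (Fn d M) z.im • reT F :=
  MultilinearMap.ext fun T => by ext x; exact Complex.mul_im z (F T x)

/-- The complex extension of an operator on real tractor tensors. -/
def complexify {r : ℕ} (P : TractorTensor (Fn d M) r → TractorTensor (Fn d M) r)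
    (F : CTractorTensor d M r) : CTractorTensor d M r :=
  ofRealFn.compMultilinearMap (P (reT F)) +
    Complex.I • ofRealFn.compMultilinearMap (P (imT F))

/-! ### Sections of weighted tractor bundles -/

variable {c : ConformalStructure d M}

/-- The smooth sections of `E^Φ[w]`: a complex tractor tensor for each metric of the class, with
the transformation law of a tensor of weight `w` under a change of the metric, and with values in
`E^Φ`. -/
def sections (Φ : TractorBundle c) (w : ℝ) :
    Submodule ℂ (c.metrics → CTractorTensor d M Φ.rank) where
  carrier := {F | (∀ (g g' : c.metrics) (Υ : Fn d M), IsRescaling g.1 Υ g'.1 →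
      ∀ T, F g' (fun i => changeSplitting g.1 Υ (T i)) = expFn w Υ • F g T) ∧
    ∀ g, Φ.proj g (reT (F g)) = reT (F g) ∧ Φ.proj g (imT (F g)) = imT (F g)}
  add_mem' := by
    rintro F G ⟨hF, hF'⟩ ⟨hG, hG'⟩
    refine ⟨fun g g' Υ h T => ?_, fun g => ⟨?_, ?_⟩⟩
    · simp only [Pi.add_apply, add_apply, hF g g' Υ h, hG g g' Υ h, smul_add]
    · rw [Pi.add_apply, reT_add, map_add, (hF' g).1, (hG' g).1]
    · rw [Pi.add_apply, imT_add, map_add, (hF' g).2, (hG' g).2]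
  zero_mem' := by
    have h₁ : reT (0 : CTractorTensor d M Φ.rank) = 0 := rfl
    have h₂ : imT (0 : CTractorTensor d M Φ.rank) = 0 := rfl
    refine ⟨fun g g' Υ h T => ?_, fun g => ⟨?_, ?_⟩⟩
    · simp
    · rw [Pi.zero_apply, h₁, map_zero]
    · rw [Pi.zero_apply, h₂, map_zero]
  smul_mem' := by
    rintro z F ⟨hF, hF'⟩
    refine ⟨fun g g' Υ h T => ?_, fun g => ⟨?_, ?_⟩⟩
    · simp only [Pi.smul_apply, smul_apply, hF g g' Υ h]
      rw [smul_comm]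
    · rw [Pi.smul_apply, reT_smul, map_sub, map_smul, map_smul, (hF' g).1, (hF' g).2]
    · rw [Pi.smul_apply, imT_smul, map_add, map_smul, map_smul, (hF' g).1, (hF' g).2]

/-- Multiplication of sections by a smooth function. -/
def mulFn (Φ : TractorBundle c) (w : ℝ) (f : Fn d M) : sections Φ w →ₗ[ℂ] sections Φ w where
  toFun F := ⟨fun g => f • F.1 g, by
    refine ⟨fun g g' Υ h T => ?_, fun g => ⟨?_, ?_⟩⟩
    · simp only [smul_apply, F.2.1 g g' Υ h]
      rw [smul_comm]
    · rw [reT_fnSMul, map_smul, (F.2.2 g).1]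
    · rw [imT_fnSMul, map_smul, (F.2.2 g).2]⟩
  map_add' F G := Subtype.ext (funext fun _ => smul_add f _ _)
  map_smul' z F := Subtype.ext (funext fun g => MultilinearMap.ext fun T => smul_comm f z (F.1 g T))

/-- Multiplication of sections by a density of weight `1`. -/
def mulDensity (Φ : TractorBundle c) (σ : RealDensity c 1) (w : ℝ) :
    sections Φ (w - 1) →ₗ[ℂ] sections Φ w where
  toFun F := ⟨fun g => σ.val g • F.1 g, by
    refine ⟨fun g g' Υ h T => ?_, fun g => ⟨?_, ?_⟩⟩
    · have he : expFn 1 Υ * expFn (w - 1) Υ = expFn w Υ := by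
        ext x
        change Real.exp (1 * Υ x) * Real.exp ((w - 1) * Υ x) = Real.exp (w * Υ x)
        rw [← Real.exp_add]
        ring_nf
      simp only [smul_apply, F.2.1 g g' Υ h, σ.equivariant g g' Υ h, smul_smul, ← he]
      ring_nf
    · rw [reT_fnSMul, map_smul, (F.2.2 g).1]
    · rw [imT_fnSMul, map_smul, (F.2.2 g).2]⟩
  map_add' F G := Subtype.ext (funext fun g => smul_add (σ.val g) _ _)
  map_smul' z F := Subtype.ext (funext fun g =>
    MultilinearMap.ext fun T => smul_comm (σ.val g) z (F.1 g T))

/-- The smooth sections of the restriction of `E^Φ[w]` to a subset `Z` of `M`: near each point of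
`Z` they are the restriction of a smooth section of `E^Φ[w]`. (A tensor at a point is given by its
values on tractor fields.) -/
def sectionsOn (Φ : TractorBundle c) (w : ℝ) (Z : Set M) :
    Submodule ℂ (c.metrics → (Fin Φ.rank → TractorField (Fn d M)) → Z → ℂ) where
  carrier := {s | ∀ p : Z, ∃ U ∈ 𝓝 (p : M), ∃ F : sections Φ w,
    ∀ g T (x : Z), (x : M) ∈ U → s g T x = F.1 g T x}
  add_mem' := by
    intro s t hs ht p
    obtain ⟨U, hU, F, hF⟩ := hs p
    obtain ⟨V, hV, G, hG⟩ := ht p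
    refine ⟨U ∩ V, Filter.inter_mem hU hV, F + G, fun g T x hx => ?_⟩
    exact congrArg₂ (· + ·) (hF g T x hx.1) (hG g T x hx.2)
  zero_mem' := fun _ => ⟨Set.univ, Filter.univ_mem, 0, fun _ _ _ _ => rfl⟩
  smul_mem' := by
    intro z s hs p
    obtain ⟨U, hU, F, hF⟩ := hs p
    exact ⟨U, hU, z • F, fun g T x hx => congrArg (z * ·) (hF g T x hx)⟩

/-- The restriction of sections to a subset. -/
def restrict (Φ : TractorBundle c) (w : ℝ) (Z : Set M) :
    sections Φ w →ₗ[ℂ] sectionsOn Φ w Z where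
  toFun F := ⟨fun g T x => F.1 g T x,
    fun _ => ⟨Set.univ, Filter.univ_mem, F, fun _ _ _ _ => rfl⟩⟩
  map_add' _ _ := rfl
  map_smul' _ _ := rfl

/-- A smooth function on a subset `Z` of `M`: near each point of `Z` it is the restriction of a
smooth function on `M`. -/
structure FnOn (d : ℕ) {M : Type*} [TopologicalSpace M]
    [ChartedSpace (EuclideanSpace ℝ (Fin d)) M] (Z : Set M) where
  val : Z → ℝ
  smooth : ∀ p : Z, ∃ U ∈ 𝓝 (p : M), ∃ F : Fn d M, ∀ x : Z, (x : M) ∈ U → val x = F x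

/-- Multiplication of sections over `Z` by a smooth function on `Z`. -/
def mulFnOn (Φ : TractorBundle c) (w : ℝ) (Z : Set M) (f : FnOn d Z) :
    sectionsOn Φ w Z →ₗ[ℂ] sectionsOn Φ w Z where
  toFun s := ⟨fun g T x => f.val x • s.1 g T x, fun p => by
    obtain ⟨U, hU, F, hF⟩ := f.smooth p
    obtain ⟨V, hV, G, hG⟩ := s.2 p
    refine ⟨U ∩ V, Filter.inter_mem hU hV, mulFn Φ w F G, fun g T x hx => ?_⟩
    exact congrArg₂ (· • ·) (hF x hx.1) (hG g T x hx.2)⟩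
  map_add' s t := Subtype.ext (funext fun g => funext fun T => funext fun x =>
    smul_add (f.val x) (s.1 g T x) (t.1 g T x))
  map_smul' z s := Subtype.ext (funext fun g => funext fun T => funext fun x =>
    smul_comm (f.val x) z (s.1 g T x))

end Manifold

/-! ### Differential and tangential operators -/

/-- Linear differential operators of order at most `m` between two modules over an algebra of
functions: the operators that commute with multiplication by functions when `m = 0`, and those whose
commutator with every function is a differential operator of order at most `m` for `m + 1`.
The multiplications by the functions `f : R` are given by `μ` and `ν`. -/
def IsDiffOp {R V W : Type*} [AddCommGroup V] [Module ℂ V] [AddCommGroup W] [Module ℂ W]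
    (μ : R → V →ₗ[ℂ] V) (ν : R → W →ₗ[ℂ] W) : ℕ → (V →ₗ[ℂ] W) → Prop
  | 0, P => ∀ f, P ∘ₗ μ f = ν f ∘ₗ P
  | m + 1, P => ∀ f, IsDiffOp μ ν m (P ∘ₗ μ f - ν f ∘ₗ P)

section Operators

variable {d : ℕ} {M : Type*} [TopologicalSpace M] [ChartedSpace (EuclideanSpace ℝ (Fin d)) M]
  {c : ConformalStructure d M}

/-- `P` is a linear differential operator from sections of `E^Φ[w₁]` to sections of `E^Φ[w₂]`. -/
def IsDifferentialOperator (Φ : TractorBundle c) {w₁ w₂ : ℝ}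
    (P : sections Φ w₁ →ₗ[ℂ] sections Φ w₂) : Prop :=
  ∃ m, IsDiffOp (V := sections Φ w₁) (W := sections Φ w₂) (mulFn Φ w₁) (mulFn Φ w₂) m P

/-- `P` is a linear differential operator between sections of the restrictions of `E^Φ[w₁]` and
`E^Φ[w₂]` to `Z`. -/
def IsDifferentialOperatorOn (Φ : TractorBundle c) {w₁ w₂ : ℝ} (Z : Set M)
    (P : sectionsOn Φ w₁ Z →ₗ[ℂ] sectionsOn Φ w₂ Z) : Prop :=
  ∃ m, IsDiffOp (mulFnOn Φ w₁ Z) (mulFnOn Φ w₂ Z) m P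

/-- `P` acts tangentially along the zero locus of `σ`: `P ∘ σ = σ ∘ P'` for some linear operator
`P'`. -/
def ActsTangentially (Φ : TractorBundle c) (σ : RealDensity c 1) {w₁ w₂ : ℝ}
    (P : sections Φ w₁ →ₗ[ℂ] sections Φ w₂) : Prop :=
  ∃ P' : sections Φ (w₁ - 1) →ₗ[ℂ] sections Φ (w₂ - 1),
    P ∘ₗ mulDensity Φ σ w₁ = mulDensity Φ σ w₂ ∘ₗ P'

end Operators

end Tractor

end

open Tractor

/-!
In a fixed scale `g` every operator involved is an algebraic expression in a connection, its
trace Laplacian and the Schouten tensor, and three computations carry the theorem.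

* Under `g ↦ Ω² g` the tractor connection is intertwined by the change of splitting, and the
  anomalies in the transformation of `∇` and of `Δ + w J` cancel in `I·D`; hence the operators
  defined scale by scale fit together to an operator on sections.
* From `I·D (σ F) - σ I·D F = (d + 2 w) I² F` for `F` of weight `w`, the operator
  `y = -(1/I²) I·D` satisfies an `sl₂`-type relation with multiplication by `σ`:
  `yᵏ (σ F) = σ yᵏ F - k (d + 2 w - k + 1) yᵏ⁻¹ F`. The last coefficient vanishes when `σ F` has
  weight `(k - n) / 2`, and this is tangentiality.
* Where `σ = 0` one has `I² = |dσ|²`, so `σ` is a defining function of its zero locus `Σ`. By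
  Hadamard's lemma a section vanishing on `Σ` is `σ` times a section, so a tangential operator
  preserves the kernel of restriction to `Σ`. As restriction is surjective (`Σ` is closed; use a
  partition of unity), the operator descends to `Σ` in exactly one way.
-/

noncomputable section

namespace Tractor

section Hadamard

variable {E F : Type*} [NormedAddCommGroup E] [NormedSpace ℝ E] [FiniteDimensional ℝ E]
  [NormedAddCommGroup F] [NormedSpace ℝ F]

theorem hasFDerivAt_intervalIntegral {f : E → ℝ → F} (hf : ContDiff ℝ 1 (Function.uncurry f))
    (a b : ℝ) (x : E) :
    HasFDerivAt (fun x => ∫ t in a..b, f x t)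
      (∫ t in a..b, (fderiv ℝ (Function.uncurry f) (x, t)).comp
        (ContinuousLinearMap.inl ℝ E ℝ)) x := by
  have hcont : Continuous fun p : E × ℝ =>
      (fderiv ℝ (Function.uncurry f) p).comp (ContinuousLinearMap.inl ℝ E ℝ) :=
    (hf.continuous_fderiv one_ne_zero).clm_comp continuous_const
  obtain ⟨C, hC⟩ := ((isCompact_closedBall x 1).prod (isCompact_uIcc (a := a) (b := b)))
    |>.exists_bound_of_continuousOn hcont.continuousOn
  refine intervalIntegral.hasFDerivAt_integral_of_dominated_of_fderiv_le (𝕜 := ℝ)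
    (bound := fun _ => C) (Metric.closedBall_mem_nhds x one_pos)
    (.of_forall fun y => (hf.continuous.comp (.prodMk_right y)).aestronglyMeasurable)
    ((hf.continuous.comp (.prodMk_right x)).intervalIntegrable a b)
    (hcont.comp (.prodMk_right x)).aestronglyMeasurable
    (.of_forall fun t ht y hy => hC (y, t) ⟨hy, Set.uIoc_subset_uIcc ht⟩)
    intervalIntegrable_const (.of_forall fun t _ y _ => ?_)
  exact ((hf.differentiable one_ne_zero (y, t)).hasFDerivAt).comp
    (f := fun e => (e, t)) y (hasFDerivAt_prodMk_left y t)

theorem contDiff_intervalIntegral {f : E → ℝ → F} (hf : ContDiff ℝ ∞ (Function.uncurry f))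
    (a b : ℝ) : ContDiff ℝ ∞ fun x => ∫ t in a..b, f x t := by
  refine contDiff_infty.2 fun m => ?_
  induction m generalizing f with
  | zero =>
    exact contDiff_zero.2
      (intervalIntegral.continuous_parametric_intervalIntegral_of_continuous' hf.continuous a b)
  | succ m ih =>
    have hderiv := hasFDerivAt_intervalIntegral (hf.of_le (by simp)) a b
    rw [Nat.cast_add, Nat.cast_one, contDiff_succ_iff_fderiv_apply]
    refine ⟨fun x => (hderiv x).differentiableAt, by simp, fun v => ?_⟩
    have hpartial : ContDiff ℝ ∞ fun p : E × ℝ => fderiv ℝ (Function.uncurry f) p (v, 0) :=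
      (hf.fderiv_right (by simp)).clm_apply contDiff_const
    convert ih (f := fun x t => fderiv ℝ (Function.uncurry f) (x, t) (v, 0)) hpartial using 2 with x
    rw [(hderiv x).fderiv, ContinuousLinearMap.intervalIntegral_apply]
    · rfl
    · exact (((hf.continuous_fderiv (by simp)).comp (.prodMk_right x)).clm_comp
        continuous_const).intervalIntegrable a b

/-- Hadamard's lemma, with `K (a, b) = ∫₀¹ u' (a + t (b - a)) dt`. -/
theorem exists_contDiff_sub_eq_apply [CompleteSpace F] {u : E → F} (hu : ContDiff ℝ ∞ u) :
    ∃ K : E × E → E →L[ℝ] F, ContDiff ℝ ∞ K ∧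
      (∀ a b, u b - u a = K (a, b) (b - a)) ∧ ∀ a, K (a, a) = fderiv ℝ u a := by
  have hcont : Continuous (fderiv ℝ u) := hu.continuous_fderiv (by simp)
  refine ⟨fun p => ∫ t in (0 : ℝ)..1, fderiv ℝ u (p.1 + t • (p.2 - p.1)),
    contDiff_intervalIntegral ?_ 0 1, fun a b => ?_, fun a => by simp⟩
  · exact (hu.fderiv_right (m := ∞) (by simp)).comp
      (f := fun q : (E × E) × ℝ => q.1.1 + q.2 • (q.1.2 - q.1.1)) (by fun_prop)
  · have hderiv : ∀ t ∈ Set.uIcc (0 : ℝ) 1, HasDerivAt (fun t : ℝ => u (a + t • (b - a)))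
        (fderiv ℝ u (a + t • (b - a)) (b - a)) t := fun t _ =>
      (hu.differentiable (by simp) _).hasFDerivAt.comp_hasDerivAt t
        (by simpa using ((hasDerivAt_id t).smul_const (b - a)).const_add a)
    have hint : Continuous fun t : ℝ => fderiv ℝ u (a + t • (b - a)) := hcont.comp (by fun_prop)
    rw [ContinuousLinearMap.intervalIntegral_apply (hint.intervalIntegrable 0 1),
      intervalIntegral.integral_eq_sub_of_hasDerivAt hderiv
        ((hint.clm_apply continuous_const).intervalIntegrable 0 1)]
    simp

theorem exists_contDiff_eq_linear_mul {f : E → ℝ} (hf : ContDiff ℝ ∞ f) {l : E →L[ℝ] ℝ}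
    (hl : l ≠ 0) (h0 : ∀ z, l z = 0 → f z = 0) :
    ∃ h : E → ℝ, ContDiff ℝ ∞ h ∧ ∀ z, f z = l z * h z := by
  obtain ⟨v, hv⟩ := l.toLinearMap.surjective (by exact_mod_cast hl) 1
  obtain ⟨K, hK, hfK, -⟩ := exists_contDiff_sub_eq_apply hf
  refine ⟨fun z => K (z - l z • v, z) v, ?_, fun z => ?_⟩
  · exact (hK.comp (f := fun z => (z - l z • v, z)) (by fun_prop)).clm_apply contDiff_const
  · have hproj : l (z - l z • v) = 0 := by simp [show l v = 1 from hv]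
    simpa [h0 _ hproj] using hfK (z - l z • v) z

end Hadamard

section CutOff

variable {E : Type*} [NormedAddCommGroup E] [NormedSpace ℝ E] {H : Type*} [TopologicalSpace H]
  {I : ModelWithCorners ℝ E H} {M : Type*} [TopologicalSpace M] [ChartedSpace H M]

theorem contMDiff_smul_of_tsupport_subset {F : Type*} [NormedAddCommGroup F] [NormedSpace ℝ F]
    {χ : C^∞⟮I, M; 𝓘(ℝ, ℝ), ℝ⟯} {h : M → F}
    (hχ : tsupport χ ⊆ {y | ContMDiffAt I 𝓘(ℝ, F) ∞ h y}) :
    ContMDiff I 𝓘(ℝ, F) ∞ fun y => χ y • h y :=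
  contMDiff_of_tsupport fun _ hy => χ.contMDiff.contMDiffAt.smul
    (hχ (tsupport_smul_subset_left (χ : M → ℝ) h hy))

variable [FiniteDimensional ℝ E] [T2Space M] [IsManifold I ∞ M]

variable (I) in
theorem exists_cutoff {x : M} {U : Set M} (hU : U ∈ 𝓝 x) :
    ∃ χ : C^∞⟮I, M; 𝓘(ℝ, ℝ), ℝ⟯, (∀ᶠ y in 𝓝 x, χ y = 1) ∧ tsupport χ ⊆ U := by
  obtain ⟨χ, -, hχ⟩ := (SmoothBumpFunction.nhds_basis_tsupport (I := I) x).mem_iff.1 hU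
  exact ⟨⟨χ, χ.contMDiff⟩, χ.eventuallyEq_one, hχ⟩

theorem exists_contMDiffMap_eventuallyEq {F : Type*} [NormedAddCommGroup F] [NormedSpace ℝ F]
    {h : M → F} {x : M} (hh : ∀ᶠ y in 𝓝 x, ContMDiffAt I 𝓘(ℝ, F) ∞ h y) :
    ∃ f : C^∞⟮I, M; 𝓘(ℝ, F), F⟯, f =ᶠ[𝓝 x] h := by
  obtain ⟨χ, hone, hχ⟩ := exists_cutoff I hh
  exact ⟨⟨_, contMDiff_smul_of_tsupport_subset hχ⟩, hone.mono fun y hy => by simp [hy]⟩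

end CutOff

section LocalDivision

variable {E : Type*} [NormedAddCommGroup E] [NormedSpace ℝ E] [FiniteDimensional ℝ E]

/-- A function with nonzero differential `l` at `q` is a linear function in suitable coordinates:
if `l v = 1`, then `s = l ∘ e` for the local diffeomorphism `e y = y + (s y - l y) v`. -/
theorem exists_straightening {s : E → ℝ} (hs : ContDiff ℝ ∞ s) {q : E} (hq : fderiv ℝ s q ≠ 0) :
    ∃ e : OpenPartialHomeomorph E E, q ∈ e.source ∧ ContDiff ℝ ∞ e ∧
      (∀ᶠ z in 𝓝 (e q), ContDiffAt ℝ ∞ e.symm z) ∧ ∀ y, fderiv ℝ s q (e y) = s y := by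
  set l := fderiv ℝ s q
  obtain ⟨v, hv : l v = 1⟩ := l.toLinearMap.surjective (by exact_mod_cast hq) 1
  set Φ : E → E := fun y => y + (s y - l y) • v
  have hΦ : ContDiff ℝ ∞ Φ := contDiff_id.add ((hs.sub l.contDiff).smul contDiff_const)
  have hΦq : HasFDerivAt Φ (ContinuousLinearEquiv.refl ℝ E : E →L[ℝ] E) q := by
    have hderiv : HasFDerivAt Φ (ContinuousLinearMap.id ℝ E + (l - l).smulRight v) q :=
      (hasFDerivAt_id q).add
        (((hs.differentiable (by simp) q).hasFDerivAt.sub l.hasFDerivAt).smul_const v)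
    simpa using hderiv
  let e := hΦ.contDiffAt.toOpenPartialHomeomorph Φ hΦq (by simp)
  have hqe : q ∈ e.source := hΦ.contDiffAt.mem_toOpenPartialHomeomorph_source hΦq (by simp)
  refine ⟨e, hqe, hΦ, ?_, fun y => by simp [e, Φ, hv]⟩
  have hequiv : ∀ᶠ y in 𝓝 q, ∃ L : E ≃L[ℝ] E, (L : E →L[ℝ] E) = fderiv ℝ Φ y := by
    have hrange : Set.range ((↑) : (E ≃L[ℝ] E) → E →L[ℝ] E) ∈ 𝓝 (fderiv ℝ Φ q) :=
      hΦq.fderiv ▸ ContinuousLinearEquiv.nhds _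
    exact (hΦ.continuous_fderiv (by simp)).continuousAt hrange
  filter_upwards [e.open_target.mem_nhds (e.map_source hqe),
    (e.tendsto_symm hqe).eventually hequiv] with z hz ⟨L, hL⟩
  exact e.contDiffAt_symm hz (hL ▸ (hΦ.differentiable (by simp) _).hasFDerivAt) hΦ.contDiffAt

theorem exists_contDiff_eventually_eq_mul {f s : E → ℝ} (hf : ContDiff ℝ ∞ f)
    (hs : ContDiff ℝ ∞ s) {q : E} (hq : fderiv ℝ s q ≠ 0) (h0 : ∀ᶠ z in 𝓝 q, s z = 0 → f z = 0) :
    ∃ h : E → ℝ, ContDiff ℝ ∞ h ∧ ∀ᶠ z in 𝓝 q, f z = s z * h z := by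
  obtain ⟨e, hqe, he, hsymm, hes⟩ := exists_straightening hs hq
  have hnear : ∀ᶠ z in 𝓝 (e q), ContMDiffAt 𝓘(ℝ, E) 𝓘(ℝ, ℝ) ∞ (f ∘ e.symm) z ∧
      (fderiv ℝ s q z = 0 → f (e.symm z) = 0) := by
    filter_upwards [hsymm, e.open_target.mem_nhds (e.map_source hqe),
      (e.tendsto_symm hqe).eventually h0] with z hz hzt hz0
    refine ⟨(hf.contDiffAt.comp z hz).contMDiffAt, fun hlz => hz0 ?_⟩
    rw [← hes, e.right_inv hzt, hlz]
  obtain ⟨χ, hone, hχ⟩ := exists_cutoff 𝓘(ℝ, E) hnear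
  obtain ⟨h, hh, hfh⟩ := exists_contDiff_eq_linear_mul
    (contMDiff_smul_of_tsupport_subset fun z hz => (hχ hz).1).contDiff hq fun z hz => by
      by_cases hzχ : z ∈ tsupport χ
      · simp [(hχ hzχ).2 hz]
      · simp [image_eq_zero_of_notMem_tsupport hzχ]
  refine ⟨h ∘ e, hh.comp he, ?_⟩
  filter_upwards [(e.continuousAt hqe).eventually hone, e.open_source.mem_nhds hqe] with y hy hys
  simpa [hy, e.left_inv hys, hes] using hfh (e y)

end LocalDivision

section SmoothFunctions

variable {d : ℕ} {M : Type*} [TopologicalSpace M] [ChartedSpace (EuclideanSpace ℝ (Fin d)) M]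

theorem Fn.algebraMap_apply (r : ℝ) (x : M) : algebraMap ℝ (Fn d M) r x = r := rfl

theorem Fn.sum_apply {ι : Type*} (s : Finset ι) (f : ι → Fn d M) (x : M) :
    (∑ i ∈ s, f i) x = ∑ i ∈ s, f i x :=
  map_sum (ContMDiffMap.evalRingHom x) f s

theorem exists_fn_of_local (h : M → Fn d M) (hh : ∀ x, ∀ᶠ y in 𝓝 x, h x y = h y y) :
    ∃ H : Fn d M, ∀ x, H x = h x x :=
  ⟨⟨fun x => h x x, fun x => (h x).contMDiff.contMDiffAt.congr_of_eventuallyEq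
    ((hh x).mono fun _ hy => hy.symm)⟩, fun _ => rfl⟩

theorem isUnit_of_forall_ne_zero {f : Fn d M} (hf : ∀ x, f x ≠ 0) : IsUnit f :=
  .of_mul_eq_one
    ⟨fun x => (f x)⁻¹, fun x =>
      (contDiffAt_inv ℝ (hf x)).contMDiffAt.comp x f.contMDiff.contMDiffAt⟩
    (ContMDiffMap.ext fun x => mul_inv_cancel₀ (hf x))

section Derivation

variable [T2Space M] [IsManifold (𝓡 d) ∞ M]

theorem derivation_congr (X : VectorField (Fn d M)) {f f' : Fn d M} {x : M} (h : f =ᶠ[𝓝 x] f') :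
    X f x = X f' x := by
  obtain ⟨χ, hone, hχ⟩ := exists_cutoff (𝓡 d) h
  have hcut : χ * (f - f') = 0 := by
    ext y
    by_cases hy : y ∈ tsupport χ
    · exact mul_eq_zero_of_right _ (sub_eq_zero.2 (hχ hy))
    · exact mul_eq_zero_of_left (image_eq_zero_of_notMem_tsupport hy) _
  have hleibniz : X (χ * (f - f')) x = χ x * (X f x - X f' x) + (f x - f' x) * X χ x := by
    rw [Derivation.leibniz, map_sub]; rfl
  rw [hcut, map_zero, hone.self_of_nhds, h.self_of_nhds, sub_self, zero_mul, one_mul,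
    add_zero] at hleibniz
  exact (sub_eq_zero.1 hleibniz.symm)

section ChainRule

variable {E : Type*} [NormedAddCommGroup E] [NormedSpace ℝ E] [FiniteDimensional ℝ E]

/-- Chain rule: the derivation `X` at `y` is pushed forward by `φ` to a vector `v`. By Hadamard's
lemma `u ∘ φ = u (φ y) + ∑ (φᵢ - φᵢ y) kᵢ` with smooth `kᵢ`, so that `vᵢ = X φᵢ y`. -/
theorem exists_pushforward (X : VectorField (Fn d M)) (φ : C^∞⟮𝓡 d, M; 𝓘(ℝ, E), E⟯) (y : M) :
    ∃ v : E, ∀ u : E → ℝ, ContDiff ℝ ∞ u → ∀ f : Fn d M, f =ᶠ[𝓝 y] u ∘ φ →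
      X f y = fderiv ℝ u (φ y) v := by
  let b := Module.finBasis ℝ E
  let coord (i) : E →L[ℝ] ℝ := (b.coord i).toContinuousLinearMap
  let ξ (i) : Fn d M := ⟨fun z => coord i (φ z), (coord i).contMDiff.comp φ.contMDiff⟩
  refine ⟨∑ i, X (ξ i) y • b i, fun u hu f hfu => ?_⟩
  obtain ⟨K, hK, huK, hKu⟩ := exists_contDiff_sub_eq_apply hu
  let k (i) : Fn d M := ⟨fun z => K (φ y, φ z) (b i),
    ContDiff.contMDiff (f := fun e => K (φ y, e) (b i))
      ((hK.comp (f := fun e => (φ y, e)) (by fun_prop)).clm_apply contDiff_const)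
      |>.comp φ.contMDiff⟩
  have hexpand : f =ᶠ[𝓝 y] (algebraMap ℝ (Fn d M) (u (φ y)) +
      ∑ i, (ξ i - algebraMap ℝ (Fn d M) (ξ i y)) * k i : Fn d M) := by
    filter_upwards [hfu] with z hz
    rw [ContMDiffMap.coe_add, Pi.add_apply, Fn.sum_apply, hz, Function.comp_apply,
      Fn.algebraMap_apply, ← sub_eq_iff_eq_add', huK]
    conv_lhs => rw [← b.sum_repr (φ z - φ y), map_sum]
    refine Finset.sum_congr rfl fun i _ => ?_
    rw [map_smul, smul_eq_mul, map_sub]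
    rfl
  rw [derivation_congr X hexpand, map_add, Derivation.map_algebraMap, zero_add, map_sum,
    Fn.sum_apply, map_sum]
  refine Finset.sum_congr rfl fun i _ => ?_
  rw [Derivation.leibniz, map_sub, Derivation.map_algebraMap, sub_zero, map_smul, ← hKu]
  change (ξ i y - ξ i y) * X (k i) y + k i y * X (ξ i) y = X (ξ i) y * K (φ y, φ y) (b i)
  rw [sub_self, zero_mul, zero_add, mul_comm]
  rfl

end ChainRule

theorem derivation_expFn (X : VectorField (Fn d M)) (w : ℝ) (Υ : Fn d M) :
    X (expFn w Υ) = algebraMap ℝ (Fn d M) w * expFn w Υ * X Υ := by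
  ext y
  obtain ⟨v, hv⟩ := exists_pushforward X Υ y
  have hderiv : HasDerivAt (fun t => Real.exp (w * t)) (w * Real.exp (w * Υ y)) (Υ y) := by
    simpa [mul_comm] using ((hasDerivAt_id (Υ y)).const_mul w).exp
  have hexp : X (expFn w Υ) y = v * (w * Real.exp (w * Υ y)) := by
    rw [hv (fun t => Real.exp (w * t)) (by fun_prop) _ .rfl, hderiv.hasFDerivAt.fderiv]
    simp
  have hid : X Υ y = v := by simpa using hv _ contDiff_id Υ .rfl
  change X (expFn w Υ) y = w * Real.exp (w * Υ y) * X Υ y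
  rw [hexp, hid, mul_comm]

end Derivation

section LocalCoordinates

theorem fderiv_comp_extChartAt_symm {x y : M} (hy : y ∈ (extChartAt (𝓡 d) x).source)
    {f : Fn d M} {u : EuclideanSpace ℝ (Fin d) → ℝ} (hfu : f =ᶠ[𝓝 y] u ∘ extChartAt (𝓡 d) x) :
    fderiv ℝ (f ∘ (extChartAt (𝓡 d) x).symm) (extChartAt (𝓡 d) x y) =
      fderiv ℝ u (extChartAt (𝓡 d) x y) := by
  have hsymm := continuousAt_extChartAt_symm' (I := 𝓡 d) hy
  rw [ContinuousAt, (extChartAt (𝓡 d) x).left_inv hy] at hsymm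
  refine Filter.EventuallyEq.fderiv_eq ?_
  filter_upwards [hsymm.eventually hfu,
    (isOpen_extChartAt_target x).mem_nhds ((extChartAt (𝓡 d) x).map_source hy)] with z hz hzt
  rw [Function.comp_apply, hz, Function.comp_apply, (extChartAt (𝓡 d) x).right_inv hzt]

variable [IsManifold (𝓡 d) ∞ M]

theorem contDiffAt_comp_extChartAt_symm {x y : M} (hy : y ∈ (extChartAt (𝓡 d) x).source)
    (f : Fn d M) :
    ContDiffAt ℝ ∞ (f ∘ (extChartAt (𝓡 d) x).symm) (extChartAt (𝓡 d) x y) :=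
  (contMDiffOn_iff_contDiffOn.1 (f.contMDiff.comp_contMDiffOn (contMDiffOn_extChartAt_symm x)))
    |>.contDiffAt ((isOpen_extChartAt_target x).mem_nhds ((extChartAt (𝓡 d) x).map_source hy))

theorem exists_eventuallyEq_comp_extChartAt {x y : M} (hy : y ∈ (extChartAt (𝓡 d) x).source)
    (f : Fn d M) : ∃ u : EuclideanSpace ℝ (Fin d) → ℝ, ContDiff ℝ ∞ u ∧
      f =ᶠ[𝓝 y] u ∘ extChartAt (𝓡 d) x := by
  have hsmooth : ∀ᶠ z in 𝓝 (extChartAt (𝓡 d) x y),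
      ContMDiffAt 𝓘(ℝ, EuclideanSpace ℝ (Fin d)) 𝓘(ℝ, ℝ) ∞ (f ∘ (extChartAt (𝓡 d) x).symm) z := by
    filter_upwards [(isOpen_extChartAt_target x).mem_nhds ((extChartAt (𝓡 d) x).map_source hy)]
      with z hz
    have hf := contDiffAt_comp_extChartAt_symm ((extChartAt (𝓡 d) x).map_target hz) f
    rw [(extChartAt (𝓡 d) x).right_inv hz] at hf
    exact hf.contMDiffAt
  obtain ⟨u, hu⟩ := exists_contMDiffMap_eventuallyEq hsmooth
  refine ⟨u, u.contMDiff.contDiff, ?_⟩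
  filter_upwards [(continuousAt_extChartAt' hy).eventually hu,
    (isOpen_extChartAt_source x).mem_nhds hy] with z hz hzs
  rw [Function.comp_apply, hz, Function.comp_apply, (extChartAt (𝓡 d) x).left_inv hzs]

/-- The vector field that is `χ v` in the chart at `x`, where the function `χ` is supported in the
domain of this chart. -/
def coordinateField {x : M} (χ : Fn d M) (hχ : tsupport χ ⊆ (extChartAt (𝓡 d) x).source)
    (v : EuclideanSpace ℝ (Fin d)) : VectorField (Fn d M) :=
  have hdichotomy : ∀ y, χ y = 0 ∨ ∀ f : Fn d M, DifferentiableAt ℝ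
      (f ∘ (extChartAt (𝓡 d) x).symm) (extChartAt (𝓡 d) x y) ∧
      f ((extChartAt (𝓡 d) x).symm (extChartAt (𝓡 d) x y)) = f y := fun y => by
    by_cases hy : y ∈ tsupport χ
    · exact .inr fun f => ⟨(contDiffAt_comp_extChartAt_symm (hχ hy) f).differentiableAt (by simp),
        by rw [(extChartAt (𝓡 d) x).left_inv (hχ hy)]⟩
    · exact .inl (image_eq_zero_of_notMem_tsupport hy)
  Derivation.mk'
    { toFun f := ⟨fun y => χ y • fderiv ℝ (f ∘ (extChartAt (𝓡 d) x).symm)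
          (extChartAt (𝓡 d) x y) v, contMDiff_smul_of_tsupport_subset fun y hy => by
        have hchart : ContMDiffAt (𝓡 d) 𝓘(ℝ, EuclideanSpace ℝ (Fin d)) ∞
            (extChartAt (𝓡 d) x) y :=
          contMDiffAt_extChartAt' (by simpa only [extChartAt_source] using hχ hy)
        exact (((contDiffAt_comp_extChartAt_symm (hχ hy) f).fderiv_right (by simp)).clm_apply
          contDiffAt_const).contMDiffAt.comp y hchart⟩
      map_add' f g := by
        ext y
        change χ y * fderiv ℝ (f ∘ _ + g ∘ _) _ v = χ y * _ + χ y * _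
        obtain hy | hy := hdichotomy y
        · simp only [hy, zero_mul, add_zero]
        · rw [fderiv_add (hy f).1 (hy g).1, _root_.add_apply, mul_add]
      map_smul' r f := by
        ext y
        change χ y * fderiv ℝ (r • (f ∘ _)) _ v = r * (χ y * _)
        obtain hy | hy := hdichotomy y
        · simp only [hy, zero_mul, mul_zero]
        · rw [fderiv_const_smul (hy f).1, _root_.smul_apply, smul_eq_mul, mul_left_comm] }
    fun f g => by
      ext y
      change χ y * fderiv ℝ ((f ∘ _) * (g ∘ _)) _ v = f y * (χ y * _) + g y * (χ y * _)
      obtain hy | hy := hdichotomy y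
      · simp only [hy, zero_mul, mul_zero, add_zero]
      · rw [fderiv_mul (hy f).1 (hy g).1]
        simp only [_root_.add_apply, _root_.smul_apply, smul_eq_mul, Function.comp_apply, (hy f).2,
          (hy g).2, mul_add, mul_left_comm]

theorem coordinateField_apply {x : M} {χ : Fn d M} (hχ : tsupport χ ⊆ (extChartAt (𝓡 d) x).source)
    (v : EuclideanSpace ℝ (Fin d)) {f : Fn d M} {y : M} (hy : y ∈ (extChartAt (𝓡 d) x).source)
    {u : EuclideanSpace ℝ (Fin d) → ℝ} (hfu : f =ᶠ[𝓝 y] u ∘ extChartAt (𝓡 d) x) :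
    coordinateField χ hχ v f y = χ y * fderiv ℝ u (extChartAt (𝓡 d) x y) v := by
  rw [← fderiv_comp_extChartAt_symm hy hfu]
  rfl

variable [T2Space M]

variable (d) in
theorem exists_contMDiffMap_eventuallyEq_extChartAt (x : M) :
    ∃ φ : C^∞⟮𝓡 d, M; 𝓘(ℝ, EuclideanSpace ℝ (Fin d)), EuclideanSpace ℝ (Fin d)⟯,
      φ =ᶠ[𝓝 x] extChartAt (𝓡 d) x := by
  refine exists_contMDiffMap_eventuallyEq ?_
  filter_upwards [extChartAt_source_mem_nhds (I := 𝓡 d) x] with y hy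
  exact contMDiffAt_extChartAt' (by simpa using hy)

variable (d) in
theorem exists_local_frame (x : M) :
    ∃ (χ : Fn d M) (e : Fin d → VectorField (Fn d M)) (θ : Fin d → OneForm (Fn d M)),
      (∀ᶠ y in 𝓝 x, χ y = 1) ∧ (∀ X, χ • X = ∑ i, θ i X • e i) ∧ ∀ i, θ i (e i) x = 1 := by
  obtain ⟨φ, hφ⟩ := exists_contMDiffMap_eventuallyEq_extChartAt d x
  have hcoord : ∀ᶠ y in 𝓝 x, y ∈ (extChartAt (𝓡 d) x).source ∧
      φ =ᶠ[𝓝 y] extChartAt (𝓡 d) x :=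
    Filter.Eventually.and (extChartAt_source_mem_nhds x) hφ.eventuallyEq_nhds
  obtain ⟨χ, hone, hχ⟩ := exists_cutoff (𝓡 d) hcoord
  let coord (i : Fin d) : EuclideanSpace ℝ (Fin d) →L[ℝ] ℝ := EuclideanSpace.proj i
  let ξ (i : Fin d) : Fn d M := ⟨coord i ∘ φ, (coord i).contMDiff.comp φ.contMDiff⟩
  let e (i : Fin d) : VectorField (Fn d M) :=
    coordinateField χ (fun y hy => (hχ hy).1) (EuclideanSpace.single i 1)
  have he (i : Fin d) {f : Fn d M} {y : M} (hy : y ∈ (extChartAt (𝓡 d) x).source)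
      {u : EuclideanSpace ℝ (Fin d) → ℝ} (hfu : f =ᶠ[𝓝 y] u ∘ extChartAt (𝓡 d) x) :
      e i f y = χ y * fderiv ℝ u (extChartAt (𝓡 d) x y) (EuclideanSpace.single i 1) :=
    coordinateField_apply _ _ hy hfu
  refine ⟨χ, e, fun i => differential (ξ i), hone, fun X => ?_, fun i => ?_⟩
  · ext f y
    rw [← Derivation.coeFnAddMonoidHom_apply (∑ i, _), map_sum, Finset.sum_apply, Fn.sum_apply]
    change χ y * X f y = ∑ i, X (ξ i) y * e i f y
    by_cases hy : y ∈ tsupport χ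
    · obtain ⟨hys, hyφ⟩ := hχ hy
      obtain ⟨u, hu, hfu⟩ := exists_eventuallyEq_comp_extChartAt hys f
      obtain ⟨v, hv⟩ := exists_pushforward X φ y
      have hξ (i : Fin d) : X (ξ i) y = v i := by
        rw [hv (coord i) (coord i).contDiff _ .rfl, (coord i).fderiv]; rfl
      rw [hv u hu f (hfu.trans (hyφ.symm.fun_comp u)), hyφ.self_of_nhds]
      conv_lhs => rw [← (EuclideanSpace.basisFun (Fin d) ℝ).sum_repr v]
      simp only [map_sum, map_smul, EuclideanSpace.basisFun_apply, EuclideanSpace.basisFun_repr,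
        Finset.mul_sum, hξ, he _ hys hfu, smul_eq_mul, mul_left_comm]
    · have hzero (i : Fin d) : e i f y = 0 :=
        mul_eq_zero_of_left (image_eq_zero_of_notMem_tsupport hy) _
      simp [image_eq_zero_of_notMem_tsupport hy, hzero]
  · change e i (ξ i) x = 1
    rw [he i (f := ξ i) (mem_extChartAt_source x) (hφ.fun_comp (coord i)),
      hone.self_of_nhds, (coord i).fderiv]
    simp [coord]

end LocalCoordinates

section Division

variable [T2Space M] [IsManifold (𝓡 d) ∞ M]

/-- The function `s` has nonzero differential at each of its zeros, as a defining function of a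
hypersurface has. -/
def IsDefining (s : Fn d M) : Prop := ∀ x, s x = 0 → ∃ X : VectorField (Fn d M), X s x ≠ 0

theorem IsDefining.eq_zero_of_eventually_mul_eq_zero {s : Fn d M} (hs : IsDefining s) {h : Fn d M}
    {x : M} (hh : ∀ᶠ y in 𝓝 x, s y * h y = 0) : h x = 0 := by
  by_cases hx : s x = 0
  · obtain ⟨X, hX⟩ := hs x hx
    have hleibniz : X (s * h) x = s x * X h x + h x * X s x := by rw [Derivation.leibniz]; rfl
    rw [derivation_congr X (f := s * h) (f' := 0) hh, map_zero, hx, zero_mul, zero_add] at hleibniz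
    exact (mul_eq_zero.1 hleibniz.symm).resolve_right hX
  · exact (mul_eq_zero.1 hh.self_of_nhds).resolve_left hx

theorem IsDefining.eq_zero_of_mul_eq_zero {s : Fn d M} (hs : IsDefining s) {h : Fn d M}
    (hh : s * h = 0) : h = 0 :=
  ContMDiffMap.ext fun _ => hs.eq_zero_of_eventually_mul_eq_zero
    (.of_forall fun y => DFunLike.congr_fun hh y)

theorem IsDefining.exists_local_quotient {s : Fn d M} (hs : IsDefining s) {f : Fn d M}
    (hf : ∀ x, s x = 0 → f x = 0) (x : M) : ∃ h : Fn d M, ∀ᶠ y in 𝓝 x, f y = s y * h y := by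
  by_cases hx : s x = 0
  · obtain ⟨X, hX⟩ := hs x hx
    obtain ⟨φ, hφ⟩ := exists_contMDiffMap_eventuallyEq_extChartAt d x
    obtain ⟨u, hu, hsu⟩ := exists_eventuallyEq_comp_extChartAt (mem_extChartAt_source x) s
    obtain ⟨v, hv, hfv⟩ := exists_eventuallyEq_comp_extChartAt (mem_extChartAt_source x) f
    obtain ⟨ν, hν⟩ := exists_pushforward X φ x
    have hu' : fderiv ℝ u (extChartAt (𝓡 d) x x) ≠ 0 := fun h => hX <| by
      rw [hν u hu s (hsu.trans (hφ.symm.fun_comp u)), hφ.self_of_nhds, h, zero_apply]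
    have hsymm := continuousAt_extChartAt_symm (I := 𝓡 d) x
    rw [ContinuousAt, extChartAt_to_inv] at hsymm
    have hzeros : ∀ᶠ z in 𝓝 (extChartAt (𝓡 d) x x), u z = 0 → v z = 0 := by
      filter_upwards [hsymm.eventually hsu, hsymm.eventually hfv, extChartAt_target_mem_nhds x]
        with z hsz hfz hz huz
      rw [Function.comp_apply, (extChartAt (𝓡 d) x).right_inv hz] at hsz hfz
      rw [← hfz, hf _ (hsz.trans huz)]
    obtain ⟨k, hk, huvk⟩ := exists_contDiff_eventually_eq_mul hv hu hu' hzeros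
    refine ⟨⟨k ∘ φ, hk.contMDiff.comp φ.contMDiff⟩, ?_⟩
    filter_upwards [hsu, hfv, hφ, (continuousAt_extChartAt x).eventually huvk] with y hsy hfy hφy hy
    change f y = s y * k (φ y)
    rw [hsy, hfy, hφy, Function.comp_apply, hy, Function.comp_apply]
  · have hne : ∀ᶠ y in 𝓝 x, s y ≠ 0 := s.contMDiff.continuous.continuousAt.eventually_ne hx
    obtain ⟨h, hh⟩ := exists_contMDiffMap_eventuallyEq (I := 𝓡 d) (h := fun y => f y * (s y)⁻¹)
      (hne.mono fun y hy => f.contMDiff.contMDiffAt.mul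
        ((contDiffAt_inv ℝ hy).contMDiffAt.comp y s.contMDiff.contMDiffAt))
    refine ⟨h, ?_⟩
    filter_upwards [hh, hne] with y hy hsy
    rw [hy, mul_left_comm, mul_inv_cancel₀ hsy, mul_one]

theorem IsDefining.exists_quotient {s : Fn d M} (hs : IsDefining s) {f : Fn d M}
    (hf : ∀ x, s x = 0 → f x = 0) : ∃ h : Fn d M, f = s * h := by
  choose h hh using hs.exists_local_quotient hf
  obtain ⟨H, hH⟩ := exists_fn_of_local h fun x => by
    filter_upwards [(hh x).eventually_nhds] with y hy
    refine sub_eq_zero.1 (hs.eq_zero_of_eventually_mul_eq_zero (h := h x - h y) ?_)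
    filter_upwards [hy, hh y] with z hxz hyz
    rw [ContMDiffMap.coe_sub, Pi.sub_apply, mul_sub, ← hxz, ← hyz, sub_self]
  refine ⟨H, ContMDiffMap.ext fun x => ?_⟩
  rw [ContMDiffMap.coe_mul, Pi.mul_apply, hH, (hh x).self_of_nhds]

end Division

end SmoothFunctions

section BilinearMaps

variable {A V S S' : Type*} [CommRing A] [AddCommGroup V] [Module A V] [AddCommGroup S] [Module A S]

/-- The rank-one bilinear map `b(v, ·) ⊗ b(v', ·) ⊗ s`. Metric traces are determined by their values
on these. -/
def rankOne (b : V →ₗ[A] V →ₗ[A] A) (v v' : V) (s : S) : V →ₗ[A] V →ₗ[A] S :=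
  LinearMap.mk₂ A (fun x y => (b v x * b v' y) • s)
    (fun x x' y => by rw [map_add, add_mul, add_smul])
    (fun f x y => by rw [map_smul, smul_eq_mul, mul_assoc, mul_smul])
    (fun x y y' => by rw [map_add, mul_add, add_smul])
    (fun f x y => by rw [map_smul, smul_eq_mul, mul_left_comm, mul_smul])

theorem rankOne_apply (b : V →ₗ[A] V →ₗ[A] A) (v v' : V) (s : S) (x y : V) :
    rankOne b v v' s x y = (b v x * b v' y) • s := rfl

theorem compr₂_rankOne [AddCommGroup S'] [Module A S'] (b : V →ₗ[A] V →ₗ[A] A) (v v' : V) (s : S)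
    (L : S →ₗ[A] S') : (rankOne b v v' s).compr₂ L = rankOne b v v' (L s) :=
  LinearMap.ext₂ fun _ _ => map_smul L _ s

theorem formTrace_sub (b : V →ₗ[A] V →ₗ[A] A) (B C : V →ₗ[A] V →ₗ[A] S) :
    formTrace b (B - C) = formTrace b B - formTrace b C :=
  map_sub _ _ _

/-- The form `b` has a well-behaved trace on `S`-valued bilinear maps: `formTrace b`, which is
defined by choice, takes the expected values. This isolates what the tensor calculus needs to know
about `A`. -/
class IsTraceForm (b : V →ₗ[A] V →ₗ[A] A) (S : Type*) [AddCommGroup S] [Module A S] : Prop where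
  formTrace_rankOne : ∀ v v' (s : S), formTrace b (rankOne b v v' s) = b v v' • s
  ext_rankOne : ∀ u u' : (V →ₗ[A] V →ₗ[A] S) →ₗ[A] S,
    (∀ v v' s, u (rankOne b v v' s) = u' (rankOne b v v' s)) → u = u'
  formTrace_left : ∀ (v : V) (l : V →ₗ[A] S) (B : V →ₗ[A] V →ₗ[A] S),
    (∀ x y, B x y = b v x • l y) → formTrace b B = l v
  formTrace_right : ∀ (v : V) (l : V →ₗ[A] S) (B : V →ₗ[A] V →ₗ[A] S),
    (∀ x y, B x y = b v y • l x) → formTrace b B = l v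
  formTrace_compr : ∀ (B : V →ₗ[A] V →ₗ[A] A) (s : S),
    formTrace b (B.compr₂ (LinearMap.toSpanSingleton A S s)) = formTrace b B • s

/-- The vector fields over `A` have rank `d`, expressed through the metric traces. -/
class HasDimension (A : Type*) [CommRing A] [Algebra ℝ A] (d : ℕ) : Prop where
  formTrace_form : ∀ g : PseudoRiemMetric A, formTrace g.form g.form = algebraMap ℝ A d

theorem map_formTrace (b : V →ₗ[A] V →ₗ[A] A) [IsTraceForm b S] (L : S →ₗ[A] S)
    (B : V →ₗ[A] V →ₗ[A] S) : L (formTrace b B) = formTrace b (B.compr₂ L) := by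
  have hcomm : L ∘ₗ formTrace b =
      formTrace b ∘ₗ LinearMap.llcomp A V _ _ (LinearMap.llcomp A V _ _ L) := by
    refine IsTraceForm.ext_rankOne (b := b) _ _ fun v v' s => ?_
    change L (formTrace b (rankOne b v v' s)) = formTrace b ((rankOne b v v' s).compr₂ L)
    rw [compr₂_rankOne, IsTraceForm.formTrace_rankOne, IsTraceForm.formTrace_rankOne, map_smul]
  exact congrArg (fun u => u B) hcomm

section Frame

variable {ι κ : Type*} [Fintype ι] [Fintype κ] {b : V →ₗ[A] V →ₗ[A] A} {χ χ' : A} {e v : ι → V}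
  {e' v' : κ → V}

/-- Where the cut-off function `χ` is `1`, the `e i` span, and `b(v i, ·)` are coordinates with
respect to them. -/
def IsFrame (b : V →ₗ[A] V →ₗ[A] A) (χ : A) (e v : ι → V) : Prop :=
  ∀ x, χ • x = ∑ i, b (v i) x • e i

/-- The metric trace `b^{ij} B(e i, e j)` computed in a frame `e` with coframe `b(v i, ·)`. -/
def frameTrace (b : V →ₗ[A] V →ₗ[A] A) (e v : ι → V) : (V →ₗ[A] V →ₗ[A] S) →ₗ[A] S where
  toFun B := ∑ i, ∑ j, b (v i) (v j) • B (e i) (e j)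
  map_add' B C := by simp only [LinearMap.add_apply, smul_add, Finset.sum_add_distrib]
  map_smul' f B := by
    simp only [LinearMap.smul_apply, Finset.smul_sum, RingHom.id_apply]
    exact Finset.sum_congr rfl fun i _ => Finset.sum_congr rfl fun j _ => smul_comm _ _ _

theorem frameTrace_apply (B : V →ₗ[A] V →ₗ[A] S) :
    frameTrace b e v B = ∑ i, ∑ j, b (v i) (v j) • B (e i) (e j) := rfl

theorem IsFrame.sum_mul (h : IsFrame b χ e v) (x y : V) :
    ∑ i, b (v i) x * b y (e i) = χ * b y x := by
  simpa using (congrArg (b y) (h x)).symm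

theorem IsFrame.frameTrace_rankOne (hs : ∀ x y, b x y = b y x) (h : IsFrame b χ e v) (a a' : V)
    (s : S) : frameTrace b e v (rankOne b a a' s) = (χ * χ * b a a') • s := by
  have hinner (j : ι) :
      ∑ i, b (v i) (v j) * (b a (e i) * b a' (e j)) = χ * (b (v j) a * b a' (e j)) := by
    simp only [← mul_assoc]
    rw [← Finset.sum_mul, h.sum_mul, hs a]
  calc frameTrace b e v (rankOne b a a' s)
      = (∑ j, ∑ i, b (v i) (v j) * (b a (e i) * b a' (e j))) • s := by
        rw [Finset.sum_comm]
        simp only [frameTrace_apply, Finset.sum_smul, rankOne_apply, smul_smul]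
    _ = (χ * χ * b a a') • s := by
        simp only [hinner]
        rw [← Finset.mul_sum, h.sum_mul, hs a', mul_assoc]

theorem IsFrame.smul_eq_sum_rankOne (h : IsFrame b χ e v) (B : V →ₗ[A] V →ₗ[A] S) :
    (χ * χ) • B = ∑ i, ∑ j, rankOne b (v i) (v j) (B (e i) (e j)) := by
  refine LinearMap.ext₂ fun x y => ?_
  have hcut : ((χ * χ) • B) x y = B (χ • x) (χ • y) := by
    simp only [map_smul, LinearMap.smul_apply, smul_smul]
  rw [hcut, h x, h y]
  simp only [map_sum, LinearMap.sum_apply, map_smul, LinearMap.smul_apply, rankOne_apply,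
    Finset.smul_sum, smul_smul]
  rw [Finset.sum_comm]
  simp only [mul_comm]

theorem IsFrame.smul_frameTrace (hs : ∀ x y, b x y = b y x) (h : IsFrame b χ e v)
    (h' : IsFrame b χ' e' v') (B : V →ₗ[A] V →ₗ[A] S) :
    (χ' * χ') • frameTrace b e v B = (χ * χ) • frameTrace b e' v' B := by
  rw [← map_smul, h'.smul_eq_sum_rankOne]
  simp only [map_sum, h.frameTrace_rankOne hs, frameTrace_apply, Finset.smul_sum, smul_smul]

end Frame

end BilinearMaps

section Locality

variable {d : ℕ} {M : Type*} [TopologicalSpace M] [ChartedSpace (EuclideanSpace ℝ (Fin d)) M]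
  {S S' : Type*} [AddCommGroup S] [Module (Fn d M) S] [AddCommGroup S'] [Module (Fn d M) S']

variable (d) in
/-- Equality of sections near a point `x`, expressed algebraically through cut-off functions so
that it makes sense in every module over the smooth functions. -/
def EqNear (x : M) (s t : S) : Prop := ∃ χ : Fn d M, χ x = 1 ∧ χ • s = χ • t

namespace EqNear

variable {x : M} {s s' t t' u : S}

theorem symm : EqNear d x s t → EqNear d x t s := fun ⟨χ, hone, h⟩ => ⟨χ, hone, h.symm⟩

theorem trans : EqNear d x s t → EqNear d x t u → EqNear d x s u :=
  fun ⟨χ, hone, h⟩ ⟨ψ, hone', h'⟩ => ⟨ψ * χ, by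
    rw [ContMDiffMap.coe_mul, Pi.mul_apply, hone, hone', one_mul], by
    rw [mul_smul, h, smul_comm, h', mul_comm, mul_smul]⟩

theorem map (L : S →ₗ[Fn d M] S') : EqNear d x s t → EqNear d x (L s) (L t) :=
  fun ⟨χ, hone, h⟩ => ⟨χ, hone, by rw [← map_smul, h, map_smul]⟩

theorem smul (f : Fn d M) : EqNear d x s t → EqNear d x (f • s) (f • t) :=
  map (LinearMap.lsmul (Fn d M) S f)

theorem add (h : EqNear d x s s') (h' : EqNear d x t t') : EqNear d x (s + t) (s' + t') :=
  have add_const {p q r : S} : EqNear d x p q → EqNear d x (p + r) (q + r) :=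
    fun ⟨χ, hone, h⟩ => ⟨χ, hone, by rw [smul_add, h, smul_add]⟩
  (add_const h).trans (by rw [add_comm s', add_comm s']; exact add_const h')

theorem apply_eq {f f' : Fn d M} : EqNear d x f f' → f x = f' x := fun ⟨χ, hone, h⟩ => by
  have hx : χ x * f x = χ x * f' x := congrArg (fun f : Fn d M => f x) h
  rwa [hone, one_mul, one_mul] at hx

theorem multilinearMap_apply {ι : Type*} {W : ι → Type*} [∀ i, AddCommGroup (W i)]
    [∀ i, Module (Fn d M) (W i)] {F F' : MultilinearMap (Fn d M) W (Fn d M)} (T : ∀ i, W i) :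
    EqNear d x F F' → EqNear d x (F T) (F' T) :=
  fun ⟨χ, hone, h⟩ => ⟨χ, hone, congrArg (fun F => F T) h⟩

end EqNear

variable (d M S) in
/-- A module whose elements are determined locally and can be glued, like the sections of a vector
bundle. -/
class IsLocalModule : Prop where
  eq_of_eqNear : ∀ {s t : S}, (∀ x, EqNear d (M := M) x s t) → s = t
  glue : ∀ h : M → S, (∀ x, ∀ᶠ y in 𝓝 x, EqNear d y (h x) (h y)) →
    ∃ H : S, ∀ x, EqNear d x H (h x)

variable (d M) in
/-- A module with local frames, each given with its dual coframe and up to a cut-off function. -/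
class LocallyFramed (V : Type*) [AddCommGroup V] [Module (Fn d M) V] : Prop where
  exists_frame : ∀ x : M, ∃ (m : ℕ) (χ : Fn d M) (e : Fin m → V) (θ : Fin m → V →ₗ[Fn d M] Fn d M),
    (∀ᶠ y in 𝓝 x, χ y = 1) ∧ ∀ v, χ • v = ∑ i, θ i v • e i

theorem exists_linearMap_of_local [IsLocalModule d M S'] (u : M → S →ₗ[Fn d M] S')
    (hu : ∀ s x, ∀ᶠ y in 𝓝 x, EqNear d y (u x s) (u y s)) :
    ∃ t : S →ₗ[Fn d M] S', ∀ s x, EqNear d x (t s) (u x s) := by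
  choose t ht using fun s => IsLocalModule.glue (d := d) (fun x => u x s) (hu s)
  refine ⟨⟨⟨t, fun s s' => ?_⟩, fun f s => ?_⟩, ht⟩ <;>
    refine IsLocalModule.eq_of_eqNear (d := d) (M := M) fun x => ?_
  · refine (ht _ x).trans ?_
    rw [map_add]
    exact ((ht s x).add (ht s' x)).symm
  · refine (ht _ x).trans ?_
    rw [map_smul]
    exact ((ht s x).smul f).symm

section LocalModule

variable [T2Space M] [IsManifold (𝓡 d) ∞ M]

variable (d) in
theorem exists_fn_eq_zero_or {x : M} {P : M → Prop} (hP : ∀ᶠ y in 𝓝 x, P y) :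
    ∃ χ : Fn d M, χ x = 1 ∧ ∀ y, χ y = 0 ∨ P y := by
  obtain ⟨χ, hone, hsupp⟩ := exists_cutoff (𝓡 d) hP
  refine ⟨χ, hone.self_of_nhds, fun y => or_iff_not_imp_right.2 fun hy => ?_⟩
  exact image_eq_zero_of_notMem_tsupport fun hmem => hy (hsupp hmem)

theorem eqNear_of_eventuallyEq {x : M} {f f' : Fn d M} (h : f =ᶠ[𝓝 x] f') : EqNear d x f f' := by
  obtain ⟨χ, hone, hχ⟩ := exists_fn_eq_zero_or d h
  exact ⟨χ, hone, ContMDiffMap.ext fun y => mul_eq_mul_left_iff.2 (hχ y).symm⟩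

theorem eqNear_smul_self {x : M} {χ : Fn d M} (hχ : ∀ᶠ y in 𝓝 x, χ y = 1) (s : S) :
    EqNear d x (χ • s) s := by
  simpa using (eqNear_of_eventuallyEq (f' := 1) hχ).map (LinearMap.toSpanSingleton (Fn d M) S s)

instance : IsLocalModule d M (Fn d M) where
  eq_of_eqNear h := ContMDiffMap.ext fun x => (h x).apply_eq
  glue h hh := by
    have hlocal (x : M) : ∀ᶠ y in 𝓝 x, h x y = h y y := (hh x).mono fun _ hy => hy.apply_eq
    obtain ⟨H, hH⟩ := exists_fn_of_local h hlocal
    exact ⟨H, fun x => eqNear_of_eventuallyEq <|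
      (hlocal x).mono fun y hy => (hH y).trans hy.symm⟩

instance {r : ℕ} {W : Type*} [AddCommGroup W] [Module (Fn d M) W] :
    IsLocalModule d M (MultilinearMap (Fn d M) (fun _ : Fin r => W) (Fn d M)) where
  eq_of_eqNear h := MultilinearMap.ext fun T => ContMDiffMap.ext fun x =>
    ((h x).multilinearMap_apply T).apply_eq
  glue h hh := by
    have hlocal (x : M) : ∀ᶠ y in 𝓝 x, ∀ T, h x T y = h y T y :=
      (hh x).mono fun _ hy T => (hy.multilinearMap_apply T).apply_eq
    choose H hH using fun T =>
      exists_fn_of_local (fun x => h x T) fun x => (hlocal x).mono fun _ hy => hy T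
    refine ⟨MultilinearMap.mk' H (fun T i a b => ?_) (fun T i f a => ?_), fun x => ?_⟩
    · ext x
      rw [ContMDiffMap.coe_add, Pi.add_apply, hH, hH, hH, MultilinearMap.map_update_add]
      rfl
    · ext x
      change H _ x = f x * H _ x
      rw [hH, hH, MultilinearMap.map_update_smul]
      rfl
    · obtain ⟨χ, hone, hχ⟩ := exists_fn_eq_zero_or d (hlocal x)
      refine ⟨χ, hone, MultilinearMap.ext fun T => ContMDiffMap.ext fun y => ?_⟩
      exact mul_eq_mul_left_iff.2 ((hχ y).symm.imp_left fun hy => (hH T y).trans (hy T).symm)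

end LocalModule

end Locality

section Trace

variable {d : ℕ} {M : Type*} [TopologicalSpace M] [ChartedSpace (EuclideanSpace ℝ (Fin d)) M]
  {V S S' : Type*} [AddCommGroup V] [Module (Fn d M) V] [AddCommGroup S] [Module (Fn d M) S]
  [AddCommGroup S'] [Module (Fn d M) S'] {b : V →ₗ[Fn d M] V →ₗ[Fn d M] Fn d M}

theorem exists_isFrame [LocallyFramed d M V] (hb : Function.Surjective b) (x : M) :
    ∃ (m : ℕ) (χ : Fn d M) (e v : Fin m → V), (∀ᶠ y in 𝓝 x, χ y = 1) ∧ IsFrame b χ e v := by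
  obtain ⟨m, χ, e, θ, hone, hframe⟩ := LocallyFramed.exists_frame (d := d) (V := V) x
  choose v hv using fun i => hb (θ i)
  exact ⟨m, χ, e, v, hone, fun y => by simp only [hframe, hv]⟩

variable [LocallyFramed d M V]

theorem ext_rankOne (hb : Function.Surjective b) [IsLocalModule d M S']
    {u u' : (V →ₗ[Fn d M] V →ₗ[Fn d M] S) →ₗ[Fn d M] S'}
    (h : ∀ v v' s, u (rankOne b v v' s) = u' (rankOne b v v' s)) : u = u' := by
  refine LinearMap.ext fun B => IsLocalModule.eq_of_eqNear (d := d) (M := M) fun x => ?_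
  obtain ⟨m, χ, e, v, hone, hframe⟩ := exists_isFrame hb x
  refine ⟨χ * χ, by rw [ContMDiffMap.coe_mul, Pi.mul_apply, hone.self_of_nhds, one_mul], ?_⟩
  rw [← map_smul, ← map_smul, hframe.smul_eq_sum_rankOne]
  simp only [map_sum, h]

variable [T2Space M] [IsManifold (𝓡 d) ∞ M]

theorem exists_trace (hs : ∀ x y, b x y = b y x) (hb : Function.Surjective b)
    [IsLocalModule d M S] :
    ∃ t : (V →ₗ[Fn d M] V →ₗ[Fn d M] S) →ₗ[Fn d M] S,
      ∀ v v' s, t (rankOne b v v' s) = b v v' • s := by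
  choose m χ e v hone hframe using exists_isFrame (d := d) (M := M) hb
  have hsq {x y : M} (h : ∀ᶠ z in 𝓝 x, χ y z = 1) : ∀ᶠ z in 𝓝 x, (χ y * χ y) z = 1 :=
    h.mono fun z hz => by rw [ContMDiffMap.coe_mul, Pi.mul_apply, hz, one_mul]
  obtain ⟨t, ht⟩ := exists_linearMap_of_local (fun x => frameTrace (S := S) b (e x) (v x))
    fun B x => (eventually_eventually_nhds.2 (hone x)).mono fun y hy => by
      refine (eqNear_smul_self (hsq (hone y)) _).symm.trans ?_
      rw [(hframe x).smul_frameTrace hs (hframe y)]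
      exact eqNear_smul_self (hsq hy) _
  refine ⟨t, fun a a' s => IsLocalModule.eq_of_eqNear (d := d) (M := M) fun x => ?_⟩
  refine (ht _ x).trans ?_
  rw [(hframe x).frameTrace_rankOne hs, mul_smul]
  exact eqNear_smul_self (hsq (hone x)) _

theorem formTrace_rankOne (hs : ∀ x y, b x y = b y x) (hb : Function.Surjective b)
    [IsLocalModule d M S] (v v' : V) (s : S) : formTrace b (rankOne b v v' s) = b v v' • s := by
  obtain ⟨t, ht⟩ := exists_trace (S := S) hs hb
  refine Classical.epsilon_spec (p := fun t : (V →ₗ[Fn d M] V →ₗ[Fn d M] S) →ₗ[Fn d M] S =>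
    ∀ (v v' : V) (s : S) (B : V →ₗ[Fn d M] V →ₗ[Fn d M] S),
      (∀ x y, B x y = (b v x * b v' y) • s) → t B = b v v' • s)
    ⟨t, fun v v' s B hB => ?_⟩ v v' s _ fun x y => rfl
  rw [← ht, show B = rankOne b v v' s from LinearMap.ext₂ hB]

theorem formTrace_left (hs : ∀ x y, b x y = b y x) (hb : Function.Surjective b)
    [IsLocalModule d M S] (v : V) (l : V →ₗ[Fn d M] S) (B : V →ₗ[Fn d M] V →ₗ[Fn d M] S)
    (h : ∀ x y, B x y = b v x • l y) : formTrace b B = l v := by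
  refine IsLocalModule.eq_of_eqNear (d := d) (M := M) fun x => ?_
  obtain ⟨m, χ, e, a, hone, hframe⟩ := exists_isFrame hb x
  refine ⟨χ, hone.self_of_nhds, ?_⟩
  have hsum : χ • B = ∑ i, rankOne b v (a i) (l (e i)) := LinearMap.ext₂ fun x y => by
    rw [LinearMap.smul_apply, LinearMap.smul_apply, ← map_smul, h, hframe y]
    simp only [LinearMap.sum_apply, rankOne_apply, map_sum, map_smul, Finset.smul_sum, smul_smul]
  rw [← map_smul, hsum, map_sum, ← map_smul, hframe v, map_sum]
  simp only [formTrace_rankOne hs hb, map_smul, hs v]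

theorem formTrace_flip (hs : ∀ x y, b x y = b y x) (hb : Function.Surjective b)
    [IsLocalModule d M S] (B : V →ₗ[Fn d M] V →ₗ[Fn d M] S) :
    formTrace b B.flip = formTrace b B := by
  have hcomm : formTrace b ∘ₗ LinearMap.lflip.toLinearMap = formTrace (V := V) (S := S) b := by
    refine ext_rankOne hb fun v v' s => ?_
    have hflip : (rankOne b v v' s).flip = rankOne b v' v s :=
      LinearMap.ext₂ fun x y => by
        rw [LinearMap.flip_apply, rankOne_apply, rankOne_apply, mul_comm]
    change formTrace b (rankOne b v v' s).flip = _
    rw [hflip, formTrace_rankOne hs hb, formTrace_rankOne hs hb, hs]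
  exact congrArg (fun u => u B) hcomm

theorem formTrace_compr₂ (hs : ∀ x y, b x y = b y x) (hb : Function.Surjective b)
    [IsLocalModule d M S] [IsLocalModule d M S'] (L : S →ₗ[Fn d M] S')
    (B : V →ₗ[Fn d M] V →ₗ[Fn d M] S) : formTrace b (B.compr₂ L) = L (formTrace b B) := by
  have hcomm : formTrace b ∘ₗ LinearMap.llcomp _ V _ _ (LinearMap.llcomp _ V _ _ L) =
      L ∘ₗ formTrace b := by
    refine ext_rankOne hb fun v v' s => ?_
    change formTrace b ((rankOne b v v' s).compr₂ L) = L (formTrace b (rankOne b v v' s))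
    rw [compr₂_rankOne, formTrace_rankOne hs hb, formTrace_rankOne hs hb, map_smul]
  exact congrArg (fun u => u B) hcomm

theorem isTraceForm (hs : ∀ x y, b x y = b y x) (hb : Function.Surjective b)
    [IsLocalModule d M S] : IsTraceForm b S where
  formTrace_rankOne := formTrace_rankOne hs hb
  ext_rankOne _ _ := ext_rankOne hb
  formTrace_left := formTrace_left hs hb
  formTrace_right v l B h := by
    rw [← formTrace_flip hs hb]
    exact formTrace_left hs hb v l B.flip fun x y => h y x
  formTrace_compr B s := formTrace_compr₂ hs hb _ B

end Trace

section VectorFields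

variable {d : ℕ} {M : Type*} [TopologicalSpace M] [ChartedSpace (EuclideanSpace ℝ (Fin d)) M]
  [T2Space M] [IsManifold (𝓡 d) ∞ M]

instance : LocallyFramed d M (VectorField (Fn d M)) where
  exists_frame x := by
    obtain ⟨χ, e, θ, hone, hframe, -⟩ := exists_local_frame d x
    exact ⟨d, χ, e, θ, hone, hframe⟩

instance : LocallyFramed d M (TractorField (Fn d M)) where
  exists_frame x := by
    obtain ⟨χ, e, θ, hone, hframe, -⟩ := exists_local_frame d x
    let E : Fin (d + 2) → TractorField (Fn d M) :=
      Fin.cons (1, 0, 0) (Fin.cons (0, 0, 1) fun i => (0, θ i, 0))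
    let Θ : Fin (d + 2) → TractorField (Fn d M) →ₗ[Fn d M] Fn d M :=
      Fin.cons (χ • LinearMap.fst _ _ _)
        (Fin.cons (χ • (LinearMap.snd _ _ _ ∘ₗ LinearMap.snd _ _ _)) fun i =>
          LinearMap.applyₗ (e i) ∘ₗ LinearMap.fst _ _ _ ∘ₗ LinearMap.snd _ _ _)
    refine ⟨d + 2, χ, E, Θ, hone, fun T => ?_⟩
    have hcoframe : χ • T.2.1 = ∑ i, T.2.1 (e i) • θ i := LinearMap.ext fun X => by
      rw [LinearMap.smul_apply, ← map_smul, hframe X, map_sum, LinearMap.sum_apply]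
      simp only [map_smul, LinearMap.smul_apply, smul_eq_mul, mul_comm]
    have hsum : ∑ i, Θ i T • E i = (χ * T.1) • (1, 0, 0) + ((χ * T.2.2) • (0, 0, 1) +
        ∑ i, T.2.1 (e i) • ((0, θ i, 0) : TractorField (Fn d M))) := by
      rw [Fin.sum_univ_succ, Fin.sum_univ_succ]
      rfl
    rw [hsum]
    refine Prod.ext ?_ (Prod.ext ?_ ?_) <;> simp [Prod.fst_sum, Prod.snd_sum, hcoframe]

instance (g : PseudoRiemMetric (Fn d M)) {S : Type*} [AddCommGroup S] [Module (Fn d M) S]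
    [IsLocalModule d M S] : IsTraceForm g.form S :=
  isTraceForm g.symm g.perfect.2

instance : HasDimension (Fn d M) d where
  formTrace_form g := by
    ext x
    obtain ⟨χ, e, θ, hone, hframe, hdual⟩ := exists_local_frame d x
    have hsharp (i : Fin d) : g.form (g.sharp (θ i)) = θ i := g.flat.apply_symm_apply (θ i)
    have hsum : χ • g.form = ∑ i, rankOne g.form (g.sharp (θ i)) (e i) (1 : Fn d M) := by
      refine LinearMap.ext₂ fun X Y => ?_
      rw [LinearMap.smul_apply, ← map_smul, hframe X, map_sum]
      simp only [LinearMap.sum_apply, rankOne_apply, hsharp, map_smul, LinearMap.smul_apply,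
        smul_eq_mul, mul_one]
    have htrace : χ * formTrace g.form g.form = ∑ i, θ i (e i) := by
      rw [← smul_eq_mul, ← map_smul, hsum, map_sum]
      simp only [IsTraceForm.formTrace_rankOne, hsharp, smul_eq_mul, mul_one]
    have hx := congrArg (fun f : Fn d M => f x) htrace
    simp only [ContMDiffMap.coe_mul, Pi.mul_apply, Fn.sum_apply, hone.self_of_nhds, hdual,
      one_mul] at hx
    rw [hx, Fn.algebraMap_apply]
    simp

end VectorFields

section TraceFormulas

variable {A V S : Type*} [CommRing A] [AddCommGroup V] [Module A V] [AddCommGroup S] [Module A S]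
  (b : V →ₗ[A] V →ₗ[A] A)

theorem formTrace_smulRight [IsTraceForm b S] (v : V) (l : V →ₗ[A] S) :
    formTrace b ((b v).smulRight l) = l v :=
  IsTraceForm.formTrace_left v l _ fun _ _ => rfl

theorem formTrace_smulRight_form [IsTraceForm b A] (v : V) (l : V →ₗ[A] A) :
    formTrace b (l.smulRight (b v)) = l v :=
  IsTraceForm.formTrace_right v l _ fun x y => mul_comm (l x) (b v y)

end TraceFormulas

section LeviCivita

variable {A : Type*} [CommRing A] [Algebra ℝ A]

theorem two_mul_half : (2 : A) * algebraMap ℝ A (1 / 2) = 1 := by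
  rw [← map_ofNat (algebraMap ℝ A), ← map_mul]; norm_num

theorem differential_apply (f : A) (X : VectorField A) : differential f X = X f := rfl

theorem Connection.sub_right {S : Type*} [AddCommGroup S] [Module A S]
    (D : Connection (A := A) S) (X : VectorField A) (s t : S) :
    D.cov X (s - t) = D.cov X s - D.cov X t := by
  have h := D.add_right X (s - t) t
  rw [sub_add_cancel] at h
  rw [h, add_sub_cancel_right]

/-- The `S`-valued one-form `X ↦ ∇_X s`. -/
def Connection.derivative {S : Type*} [AddCommGroup S] [Module A S]
    (D : Connection (A := A) S) (s : S) : VectorField A →ₗ[A] S where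
  toFun X := D.cov X s
  map_add' X Y := D.add_left X Y s
  map_smul' f X := D.smul_left f X s

namespace PseudoRiemMetric

variable (g : PseudoRiemMetric A)

theorem form_sharp (α : OneForm A) (X : VectorField A) : g.form (g.sharp α) X = α X :=
  congrArg (fun f : OneForm A => f X) (g.flat.apply_symm_apply α)

theorem form_sharp_right (α : OneForm A) (X : VectorField A) : g.form X (g.sharp α) = α X := by
  rw [g.symm, form_sharp]

theorem inv_apply (α β : OneForm A) : g.inv α β = α (g.sharp β) := g.form_sharp α _

theorem inv_comm (α β : OneForm A) : g.inv α β = g.inv β α := g.symm _ _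

theorem ext_form {X Y : VectorField A} (h : ∀ Z, g.form X Z = g.form Y Z) : X = Y :=
  g.perfect.1 (LinearMap.ext h)

theorem form_leviCivita (X Y Z : VectorField A) :
    g.form (g.leviCivita.cov X Y) Z = algebraMap ℝ A (1 / 2) * g.koszul X Y Z := by
  change g.form (algebraMap ℝ A (1 / 2) • g.sharp (g.koszul X Y)) Z = _
  rw [map_smul, LinearMap.smul_apply, form_sharp, smul_eq_mul]

theorem koszul_apply (X Y Z : VectorField A) :
    g.koszul X Y Z = X (g.form Y Z) + Y (g.form X Z) - Z (g.form X Y)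
      + g.form ⁅X, Y⁆ Z - g.form ⁅X, Z⁆ Y - g.form ⁅Y, Z⁆ X := rfl

theorem leviCivita_torsion (X Y : VectorField A) :
    g.leviCivita.cov X Y = g.leviCivita.cov Y X + ⁅X, Y⁆ := by
  refine g.ext_form fun Z => ?_
  rw [map_add, LinearMap.add_apply, form_leviCivita, form_leviCivita, koszul_apply, koszul_apply,
    ← lie_skew X Y, map_neg, LinearMap.neg_apply, g.symm Y X]
  linear_combination (-g.form ⁅Y, X⁆ Z) * two_mul_half (A := A)

theorem leviCivita_metric (X Y Z : VectorField A) :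
    X (g.form Y Z) = g.form (g.leviCivita.cov X Y) Z + g.form Y (g.leviCivita.cov X Z) := by
  rw [g.symm Y (g.leviCivita.cov X Z), form_leviCivita, form_leviCivita, koszul_apply,
    koszul_apply, ← lie_skew Y Z, map_neg, LinearMap.neg_apply, g.symm Z Y]
  linear_combination (-X (g.form Y Z)) * two_mul_half (A := A)

/-- The gradient of a function. -/
def grad (f : A) : VectorField A := g.sharp (differential f)

theorem form_grad (f : A) (X : VectorField A) : g.form (g.grad f) X = X f := g.form_sharp _ X

theorem form_grad_right (f : A) (X : VectorField A) : g.form X (g.grad f) = X f :=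
  g.form_sharp_right _ X

/-- The Hessian of a function. -/
abbrev hess (f : A) : VectorField A →ₗ[A] VectorField A →ₗ[A] A := g.hessian trivialConnection f

theorem hess_apply (f : A) (X Y : VectorField A) :
    g.hess f X Y = X (Y f) - g.leviCivita.cov X Y f := rfl

theorem hess_eq_form (f : A) (X Y : VectorField A) :
    g.hess f X Y = g.form (g.leviCivita.cov X (g.grad f)) Y := by
  have h := g.leviCivita_metric X (g.grad f) Y
  rw [form_grad, form_grad] at h
  rw [hess_apply, h]
  ring

theorem differential_eq_form (f : A) : differential f = g.form (g.grad f) :=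
  LinearMap.ext fun X => (g.form_grad f X).symm

theorem formTrace_differential [IsTraceForm g.form A] (f : A) :
    formTrace g.form ((differential f).smulRight (differential f)) = g.grad f f := by
  rw [differential_eq_form, formTrace_smulRight, form_grad]

theorem formTrace_lsmul_differential {S : Type*} [AddCommGroup S] [Module A S]
    [IsTraceForm g.form S] (l : VectorField A →ₗ[A] S) (f : A) :
    formTrace g.form ((LinearMap.lsmul A S).flip.compl₁₂ l (differential f)) = l (g.grad f) :=
  IsTraceForm.formTrace_right (g.grad f) l _ fun X Y => by rw [form_grad]; rfl

theorem formTrace_hess (f : A) :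
    formTrace g.form (g.hess f) = g.laplacian trivialConnection f := rfl

end PseudoRiemMetric

/-- `g' = Ω² g` with `Ω = exp Υ` and `Ω' = exp (-Υ)`, the exponential being characterised by its
derivative so that it makes sense over any algebra. -/
structure IsConformalChange (g g' : PseudoRiemMetric A) (Υ Ω Ω' : A) : Prop where
  form : ∀ X Y, g'.form X Y = Ω * Ω * g.form X Y
  mul_inv : Ω * Ω' = 1
  deriv : ∀ X : VectorField A, X Ω = Ω * X Υ
  deriv_inv : ∀ X : VectorField A, X Ω' = -(Ω' * X Υ)

namespace IsConformalChange

open PseudoRiemMetric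

variable {g g' : PseudoRiemMetric A} {Υ Ω Ω' : A}

theorem inv_sq_mul_sq (H : IsConformalChange g g' Υ Ω Ω') : Ω' * Ω' * (Ω * Ω) = 1 := by
  linear_combination (Ω * Ω' + 1) * H.mul_inv

theorem sharp (H : IsConformalChange g g' Υ Ω Ω')
    (α : OneForm A) : g'.sharp α = (Ω' * Ω') • g.sharp α := by
  refine g'.ext_form fun Z => ?_
  rw [form_sharp, H.form, map_smul, LinearMap.smul_apply, form_sharp, smul_eq_mul]
  linear_combination (-α Z) * H.inv_sq_mul_sq

theorem leviCivita (H : IsConformalChange g g' Υ Ω Ω')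
    (X Y : VectorField A) : g'.leviCivita.cov X Y =
    g.leviCivita.cov X Y + X Υ • Y + Y Υ • X - g.form X Y • g.grad Υ := by
  refine g'.ext_form fun Z => ?_
  rw [form_leviCivita, koszul_apply, H.form (_ - _)]
  simp only [H.form, map_sub, map_add, map_smul, LinearMap.sub_apply, LinearMap.add_apply,
    LinearMap.smul_apply, form_leviCivita, koszul_apply, form_grad, smul_eq_mul,
    Derivation.leibniz, H.deriv]
  rw [g.symm X Z]
  linear_combination (Ω * Ω * (X Υ * g.form Y Z + Y Υ * g.form Z X - Z Υ * g.form X Y)) *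
    two_mul_half (A := A)

theorem curvature (H : IsConformalChange g g' Υ Ω Ω')
    (X Y Z W : VectorField A) :
    g.form (g'.curvature X Y Z) W = g.form (g.curvature X Y Z) W
      + g.hess Υ X Z * g.form Y W - g.hess Υ Y Z * g.form X W
      - g.form Y Z * g.hess Υ X W + g.form Z X * g.hess Υ Y W
      + Y Υ * Z Υ * g.form X W - X Υ * Z Υ * g.form Y W
      - Y Υ * g.form Z X * W Υ + X Υ * g.form Y Z * W Υ
      - g.grad Υ Υ * (g.form Y Z * g.form X W - g.form Z X * g.form Y W) := by
  have hmetric := g.leviCivita_metric X Y Z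
  have hmetric' := g.leviCivita_metric Y X Z
  have hlie : X (Y Υ) - Y (X Υ) = ⁅X, Y⁆ Υ := (Derivation.commutator_apply ..).symm
  have htorsion (V : VectorField A) : g.form (g.leviCivita.cov X Y) V =
      g.form (g.leviCivita.cov Y X) V + g.form ⁅X, Y⁆ V := by
    rw [g.leviCivita_torsion X Y, map_add, LinearMap.add_apply]
  simp only [PseudoRiemMetric.curvature, H.leviCivita, Connection.add_right, Connection.leibniz,
    Connection.sub_right, map_add, map_sub, map_smul, LinearMap.add_apply, LinearMap.sub_apply,
    LinearMap.smul_apply, smul_eq_mul, Derivation.add_apply, Derivation.sub_apply,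
    Derivation.smul_apply, form_grad, form_grad_right, ← hess_eq_form, hess_apply]
  rw [g.symm Z X, g.symm Y X]
  linear_combination g.form Z W * hlie + Z Υ * htorsion W - W Υ * hmetric + W Υ * hmetric'
    - W Υ * htorsion Z

theorem curvatureForm (H : IsConformalChange g g' Υ Ω Ω')
    (Y Z : VectorField A) : g'.curvatureForm Y Z = (Ω * Ω) •
    (g.curvatureForm Y Z + ((g.hess Υ).flip Z).smulRight (g.form Y)
      - (g.hess Υ Y Z - Y Υ * Z Υ + g.grad Υ Υ * g.form Y Z) • g.form
      - g.form Y Z • g.hess Υ + (g.form Z).smulRight (g.hess Υ Y)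
      - (Z Υ • differential Υ).smulRight (g.form Y)
      - (g.form Z).smulRight (Y Υ • differential Υ)
      + g.form Y Z • (g.form (g.grad Υ)).smulRight (differential Υ)
      + g.grad Υ Υ • (g.form Z).smulRight (g.form Y)) := by
  refine LinearMap.ext₂ fun X W => ?_
  change g'.form (g'.curvature X Y Z) W = _
  have hcurv : g.curvatureForm Y Z X W = g.form (g.curvature X Y Z) W := rfl
  rw [H.form, H.curvature]
  simp only [LinearMap.add_apply, LinearMap.sub_apply, LinearMap.smul_apply, smul_eq_mul,
    LinearMap.smulRight_apply, LinearMap.flip_apply, differential_apply, hcurv, form_grad]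
  ring

theorem formTrace (H : IsConformalChange g g' Υ Ω Ω')
    {S : Type*} [AddCommGroup S] [Module A S] [∀ g : PseudoRiemMetric A, IsTraceForm g.form S]
    (B : VectorField A →ₗ[A] VectorField A →ₗ[A] S) :
    formTrace g'.form B = (Ω' * Ω') • formTrace g.form B := by
  have hrankOne (v v' : VectorField A) (s : S) :
      rankOne g'.form v v' s = (Ω * Ω * (Ω * Ω)) • rankOne g.form v v' s :=
    LinearMap.ext₂ fun X Y => by
      rw [LinearMap.smul_apply, LinearMap.smul_apply, rankOne_apply, rankOne_apply, H.form,
        H.form, smul_smul]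
      congr 1
      ring
  have htrace : Tractor.formTrace (S := S) g'.form = (Ω' * Ω') • Tractor.formTrace g.form := by
    refine IsTraceForm.ext_rankOne (b := g'.form) _ _ fun v v' s => ?_
    rw [IsTraceForm.formTrace_rankOne, hrankOne, map_smul, LinearMap.smul_apply,
      IsTraceForm.formTrace_rankOne, H.form, smul_smul, smul_smul]
    congr 1
    linear_combination -(Ω * Ω * g.form v v') * H.inv_sq_mul_sq
  rw [htrace, LinearMap.smul_apply]

end IsConformalChange

end LeviCivita

section Schouten

variable {A : Type*} [CommRing A] [Algebra ℝ A] {d : ℕ}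

theorem algebraMap_one_div_mul_sub_two (hd : 3 ≤ d) :
    algebraMap ℝ A (1 / ((d : ℝ) - 2)) * (algebraMap ℝ A d - 2) = 1 := by
  have hd' : (3 : ℝ) ≤ d := mod_cast hd
  rw [← map_ofNat (algebraMap ℝ A) 2, ← map_sub, ← map_mul, one_div_mul_cancel (by linarith),
    map_one]

theorem algebraMap_one_div_two_mul_sub_one (hd : 3 ≤ d) :
    algebraMap ℝ A (1 / (2 * ((d : ℝ) - 1))) * (2 * (algebraMap ℝ A d - 1)) = 1 := by
  have hd' : (3 : ℝ) ≤ d := mod_cast hd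
  rw [← map_ofNat (algebraMap ℝ A) 2, ← map_one (algebraMap ℝ A), ← map_sub, ← map_mul, ← map_mul,
    one_div_mul_cancel (by linarith), map_one]

variable [HasDimension A d] {g g' : PseudoRiemMetric A} {Υ Ω Ω' : A}

namespace IsConformalChange

open PseudoRiemMetric

theorem laplacian (H : IsConformalChange g g' Υ Ω Ω')
    {S : Type*} [AddCommGroup S] [Module A S] [∀ g : PseudoRiemMetric A, IsTraceForm g.form S]
    (D : Connection (A := A) S) (s : S) : g'.laplacian D s = (Ω' * Ω') •
      (g.laplacian D s + (algebraMap ℝ A d - 2) • D.cov (g.grad Υ) s) := by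
  have hhessian : g'.hessian D s = g.hessian D s - (g.form (g.grad Υ)).smulRight (D.derivative s)
      - (LinearMap.lsmul A S).flip.compl₁₂ (D.derivative s) (differential Υ)
      + g.form.compr₂ (LinearMap.toSpanSingleton A S (D.cov (g.grad Υ) s)) := by
    refine LinearMap.ext₂ fun X Y => ?_
    change D.cov X (D.cov Y s) - D.cov (g'.leviCivita.cov X Y) s =
      D.cov X (D.cov Y s) - D.cov (g.leviCivita.cov X Y) s - g.form (g.grad Υ) X • D.cov Y s
        - Y Υ • D.cov X s + g.form X Y • D.cov (g.grad Υ) s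
    rw [H.leviCivita, form_grad, Connection.sub_left, D.add_left, D.add_left, D.smul_left,
      D.smul_left, D.smul_left]
    abel
  change Tractor.formTrace g'.form (g'.hessian D s) = _
  rw [H.formTrace, hhessian, map_add, formTrace_sub, formTrace_sub, formTrace_smulRight,
    formTrace_lsmul_differential, IsTraceForm.formTrace_compr, HasDimension.formTrace_form (d := d)]
  change (Ω' * Ω') • (g.laplacian D s - D.cov (g.grad Υ) s - D.cov (g.grad Υ) s
    + algebraMap ℝ A d • D.cov (g.grad Υ) s) = _
  module

variable [∀ g : PseudoRiemMetric A, IsTraceForm g.form A]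

theorem ricci (H : IsConformalChange g g' Υ Ω Ω') : g'.ricci = g.ricci
    - (algebraMap ℝ A d - 2) • (g.hess Υ - (differential Υ).smulRight (differential Υ))
    - (g.laplacian trivialConnection Υ + (algebraMap ℝ A d - 2) * g.grad Υ Υ) • g.form := by
  refine LinearMap.ext₂ fun Y Z => ?_
  change Tractor.formTrace g'.form (g'.curvatureForm Y Z) =
    Tractor.formTrace g.form (g.curvatureForm Y Z)
      - (algebraMap ℝ A d - 2) * (g.hess Υ Y Z - Y Υ * Z Υ)
      - (g.laplacian trivialConnection Υ + (algebraMap ℝ A d - 2) * g.grad Υ Υ) * g.form Y Z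
  rw [H.formTrace, H.curvatureForm, map_smul, smul_smul, H.inv_sq_mul_sq, one_smul]
  simp only [map_smul, map_add, formTrace_sub, smul_eq_mul, formTrace_smulRight,
    formTrace_smulRight_form, formTrace_hess, LinearMap.flip_apply, LinearMap.smul_apply,
    HasDimension.formTrace_form (d := d) g, differential_apply,
    g.symm Z Y]
  ring

theorem scalarCurvature (H : IsConformalChange g g' Υ Ω Ω') :
    g'.scalarCurvature = Ω' * Ω' * (g.scalarCurvature
    - 2 * (algebraMap ℝ A d - 1) * g.laplacian trivialConnection Υ
    - (algebraMap ℝ A d - 1) * (algebraMap ℝ A d - 2) * g.grad Υ Υ) := by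
  change Tractor.formTrace g'.form g'.ricci = Ω' * Ω' * (Tractor.formTrace g.form g.ricci - _ - _)
  rw [H.formTrace, H.ricci (d := d)]
  simp only [formTrace_sub, map_smul, smul_eq_mul, formTrace_hess, formTrace_differential,
    HasDimension.formTrace_form (d := d) g]
  ring

theorem schouten (H : IsConformalChange g g' Υ Ω Ω') (hd : 3 ≤ d) :
    g'.schouten d = g.schouten d - g.hess Υ + (differential Υ).smulRight (differential Υ)
      - (algebraMap ℝ A (1 / 2) * g.grad Υ Υ) • g.form := by
  have hd_sub_two := algebraMap_one_div_mul_sub_two (A := A) hd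
  have hd_sub_one := algebraMap_one_div_two_mul_sub_one (A := A) hd
  refine LinearMap.ext₂ fun Y Z => ?_
  simp only [PseudoRiemMetric.schouten, LinearMap.smul_apply, LinearMap.sub_apply,
    LinearMap.add_apply, LinearMap.smulRight_apply, smul_eq_mul, H.ricci (d := d),
    H.scalarCurvature (d := d), H.form]
  set k := algebraMap ℝ A (1 / ((d : ℝ) - 2))
  set l := algebraMap ℝ A (1 / (2 * ((d : ℝ) - 1)))
  set m := algebraMap ℝ A (1 / 2)
  set D := algebraMap ℝ A d
  set L := g.laplacian trivialConnection Υ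
  have hhalf : (2 : A) * m = 1 := two_mul_half
  have hscalar : l * (Ω' * Ω' * (g.scalarCurvature - 2 * (D - 1) * L
      - (D - 1) * (D - 2) * g.grad Υ Υ)) * (Ω * Ω)
      = l * g.scalarCurvature - L - m * (D - 2) * g.grad Υ Υ := by
    linear_combination
      (l * (g.scalarCurvature - 2 * (D - 1) * L - (D - 1) * (D - 2) * g.grad Υ Υ)) * H.inv_sq_mul_sq
      - L * hd_sub_one - (D - 2) * g.grad Υ Υ * (m * hd_sub_one - l * (D - 1) * hhalf)
  linear_combination (differential Υ Y * differential Υ Z - g.hess Υ Y Z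
      + (m - 1) * g.grad Υ Υ * g.form Y Z) * hd_sub_two
    - k * g.form Y Z * hscalar + g.grad Υ Υ * g.form Y Z * hhalf

theorem schoutenTrace (H : IsConformalChange g g' Υ Ω Ω')
    (hd : 3 ≤ d) : g'.schoutenTrace d = Ω' * Ω' * (g.schoutenTrace d
    - g.laplacian trivialConnection Υ + g.grad Υ Υ
    - algebraMap ℝ A (1 / 2) * algebraMap ℝ A d * g.grad Υ Υ) := by
  change Tractor.formTrace g'.form (g'.schouten d) =
    Ω' * Ω' * (Tractor.formTrace g.form (g.schouten d) - _ + _ - _)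
  rw [H.formTrace, H.schouten hd]
  simp only [formTrace_sub, map_add, map_smul, smul_eq_mul, formTrace_hess, formTrace_differential,
    HasDimension.formTrace_form (d := d) g]
  ring

end IsConformalChange

end Schouten

section TractorBundle

variable {A : Type*} [CommRing A] [Algebra ℝ A]

namespace PseudoRiemMetric

variable (g : PseudoRiemMetric A)

theorem sharp_covOneForm (X : VectorField A) (μ : OneForm A) :
    g.sharp (g.covOneForm X μ) = g.leviCivita.cov X (g.sharp μ) := by
  refine g.ext_form fun Z => ?_
  have hmetric := g.leviCivita_metric X (g.sharp μ) Z
  rw [form_sharp, form_sharp] at hmetric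
  rw [form_sharp]
  change X (μ Z) - μ (g.leviCivita.cov X Z) = _
  rw [hmetric]
  ring

theorem derivation_inv (X : VectorField A) (μ ν : OneForm A) :
    X (g.inv μ ν) = g.inv (g.covOneForm X μ) ν + g.inv μ (g.covOneForm X ν) := by
  have hmetric := g.leviCivita_metric X (g.sharp μ) (g.sharp ν)
  rwa [← sharp_covOneForm, ← sharp_covOneForm] at hmetric

theorem inv_differential (f : A) (μ : OneForm A) : g.inv (differential f) μ = μ (g.grad f) := by
  rw [inv_comm, inv_apply]
  rfl

theorem sharp_derivation (μ : OneForm A) (f : A) : g.sharp μ f = μ (g.grad f) := by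
  rw [← form_grad, form_sharp_right]

theorem sharp_differential (f : A) : g.sharp (differential f) = g.grad f := rfl

theorem hess_sharp (f : A) (X : VectorField A) (μ : OneForm A) :
    g.hess f X (g.sharp μ) = μ (g.leviCivita.cov X (g.grad f)) := by
  rw [hess_eq_form, form_sharp_right]

theorem derivation_grad_self (f : A) (X : VectorField A) :
    X (g.grad f f) = 2 * g.hess f X (g.grad f) := by
  rw [← g.form_grad f (g.grad f), leviCivita_metric, g.symm (g.grad f), hess_eq_form]
  ring

theorem tractorMetric_apply (T T' : TractorField A) : g.tractorMetric T T' =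
    g.inv T.2.1 T'.2.1 + T.1 * T'.2.2 + T.2.2 * T'.1 := rfl

theorem tractorMetric_comm (T T' : TractorField A) :
    g.tractorMetric T T' = g.tractorMetric T' T := by
  rw [tractorMetric_apply, tractorMetric_apply, inv_comm]
  ring

theorem tractorMetric_surjective : Function.Surjective g.tractorMetric := by
  intro l
  let ν : OneForm A := l ∘ₗ LinearMap.inr A A (OneForm A × A) ∘ₗ LinearMap.inl A (OneForm A) A ∘ₗ
    g.flat.toLinearMap
  refine ⟨(l (0, 0, 1), ν, l (1, 0, 0)), LinearMap.ext fun T => ?_⟩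
  have hν : ν (g.sharp T.2.1) = l (0, T.2.1, 0) := by
    change l (0, g.flat (g.flat.symm T.2.1), 0) = _
    rw [LinearEquiv.apply_symm_apply]
  have hT : T = T.1 • ((1, 0, 0) : TractorField A) + ((0, T.2.1, 0) : TractorField A)
      + T.2.2 • ((0, 0, 1) : TractorField A) := by
    refine Prod.ext ?_ (Prod.ext ?_ ?_) <;> simp
  rw [tractorMetric_apply, inv_apply, hν]
  conv_rhs => rw [hT]
  rw [map_add, map_add, map_smul, map_smul, smul_eq_mul, smul_eq_mul]
  ring

theorem inv_tractorConnection (d : ℕ) (X : VectorField A) (T : TractorField A) (ν : OneForm A) :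
    g.inv ((g.tractorConnection d).cov X T).2.1 ν =
      g.inv (g.covOneForm X T.2.1) ν + T.2.2 * ν X + T.1 * g.schouten d X (g.sharp ν) := by
  rw [inv_apply, inv_apply, ← g.form_sharp_right ν X]
  rfl

theorem tractorConnection_metric (d : ℕ) (X : VectorField A) (T T' : TractorField A) :
    X (g.tractorMetric T T') = g.tractorMetric ((g.tractorConnection d).cov X T) T'
      + g.tractorMetric T ((g.tractorConnection d).cov X T') := by
  simp only [tractorMetric_apply, inv_tractorConnection,
    g.inv_comm T.2.1 ((g.tractorConnection d).cov X T').2.1, map_add, Derivation.leibniz,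
    derivation_inv, smul_eq_mul]
  rw [g.inv_comm T.2.1 (g.covOneForm X T'.2.1)]
  simp only [tractorConnection]
  ring

/-- The change of splitting from `g` to `Ω² g`, where `Ω = exp Υ` and `Ω' = exp (-Υ)`: the algebraic
form of `changeSplitting`. -/
def splitting (Υ Ω Ω' : A) : TractorField A →ₗ[A] TractorField A where
  toFun T := (Ω * T.1, Ω • (T.2.1 + T.1 • differential Υ),
    Ω' * (T.2.2 - g.inv (differential Υ) T.2.1
      - algebraMap ℝ A (1 / 2) * T.1 * g.inv (differential Υ) (differential Υ)))
  map_add' T T' := by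
    refine Prod.ext ?_ (Prod.ext ?_ ?_)
    · simp; ring
    · simp only [Prod.fst_add, Prod.snd_add, add_smul, smul_add]; abel
    · simp; ring
  map_smul' f T := by
    refine Prod.ext ?_ (Prod.ext ?_ ?_)
    · simp; ring
    · simp only [Prod.smul_fst, Prod.smul_snd, smul_eq_mul, RingHom.id_apply]
      module
    · simp; ring

theorem splitting_apply (Υ Ω Ω' : A) (T : TractorField A) : g.splitting Υ Ω Ω' T =
    (Ω * T.1, Ω • (T.2.1 + T.1 • differential Υ),
      Ω' * (T.2.2 - T.2.1 (g.grad Υ) - algebraMap ℝ A (1 / 2) * T.1 * g.grad Υ Υ)) := by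
  rw [← inv_differential, ← differential_apply, ← inv_differential]
  rfl

end PseudoRiemMetric

namespace IsConformalChange

open PseudoRiemMetric

variable {g g' : PseudoRiemMetric A} {Υ Ω Ω' : A}

theorem inv (H : IsConformalChange g g' Υ Ω Ω') (α β : OneForm A) :
    g'.inv α β = Ω' * Ω' * g.inv α β := by
  rw [inv_apply, inv_apply, H.sharp, map_smul, smul_eq_mul]

theorem tractorMetric (H : IsConformalChange g g' Υ Ω Ω') (T T' : TractorField A) :
    g'.tractorMetric (g.splitting Υ Ω Ω' T) (g.splitting Υ Ω Ω' T') = g.tractorMetric T T' := by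
  simp only [tractorMetric_apply, splitting_apply, H.inv, map_smul, map_add, LinearMap.smul_apply,
    LinearMap.add_apply, smul_eq_mul, inv_differential, g.inv_comm T.2.1 (differential Υ),
    differential_apply]
  linear_combination
    (g.inv T.2.1 T'.2.1 + T.1 * T'.2.1 (g.grad Υ) + T'.1 * T.2.1 (g.grad Υ)
      + T.1 * T'.1 * g.grad Υ Υ) * H.inv_sq_mul_sq
    + (T.1 * (T'.2.2 - T'.2.1 (g.grad Υ) - algebraMap ℝ A (1 / 2) * T'.1 * g.grad Υ Υ)
      + T'.1 * (T.2.2 - T.2.1 (g.grad Υ) - algebraMap ℝ A (1 / 2) * T.1 * g.grad Υ Υ)) * H.mul_inv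
    - T.1 * T'.1 * g.grad Υ Υ * two_mul_half (A := A)

theorem tractorConnection {d : ℕ} [HasDimension A d]
    [∀ g : PseudoRiemMetric A, IsTraceForm g.form A]
    (H : IsConformalChange g g' Υ Ω Ω') (hd : 3 ≤ d) (X : VectorField A) (T : TractorField A) :
    (g'.tractorConnection d).cov X (g.splitting Υ Ω Ω' T) =
      g.splitting Υ Ω Ω' ((g.tractorConnection d).cov X T) := by
  obtain ⟨s, μ, ρ⟩ := T
  simp only [splitting_apply, PseudoRiemMetric.tractorConnection, covOneForm, H.sharp,
    H.schouten hd]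
  refine Prod.ext ?_ (Prod.ext (LinearMap.ext fun Y => ?_) ?_)
  · simp only [LinearMap.smul_apply, LinearMap.add_apply, smul_eq_mul, differential_apply,
      Derivation.leibniz, H.deriv]
    ring
  · simp only [LinearMap.coe_mk, AddHom.coe_mk, LinearMap.smul_apply, LinearMap.add_apply,
      LinearMap.sub_apply, LinearMap.smulRight_apply, smul_eq_mul, differential_apply,
      Derivation.leibniz, H.deriv, map_add, H.form, H.leviCivita, map_sub, map_smul,
      hess_apply]
    linear_combination Ω * (ρ - μ (g.grad Υ) - algebraMap ℝ A (1 / 2) * s * g.grad Υ Υ) *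
      g.form X Y * H.mul_inv - Ω * s * g.grad Υ Υ * g.form X Y * two_mul_half (A := A)
  · simp only [LinearMap.coe_mk, AddHom.coe_mk, LinearMap.smul_apply, LinearMap.add_apply,
      LinearMap.sub_apply, LinearMap.smulRight_apply, smul_eq_mul, differential_apply,
      Derivation.leibniz, H.deriv_inv, map_add, map_sub, map_smul,
      Derivation.map_algebraMap, hess_sharp, sharp_derivation,
      derivation_grad_self, sharp_differential, form_sharp_right, form_grad_right]
    linear_combination (-Ω' * (g.schouten d X (g.sharp μ) + s * g.schouten d X (g.grad Υ)
      - μ (g.leviCivita.cov X (g.grad Υ)) - s * g.hess Υ X (g.grad Υ)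
      + X Υ * (μ (g.grad Υ) + s * g.grad Υ Υ)
      - algebraMap ℝ A (1 / 2) * g.grad Υ Υ * (μ X + s * X Υ))) * H.mul_inv
      + Ω' * s * (g.grad Υ Υ * X Υ - g.hess Υ X (g.grad Υ)) * two_mul_half (A := A)

end IsConformalChange

/-- The pull-back of tractor tensors by an endomorphism of the standard tractor bundle. -/
def pullback (L : TractorField A →ₗ[A] TractorField A) (r : ℕ) :
    TractorTensor A r →ₗ[A] TractorTensor A r :=
  MultilinearMap.compLinearMapₗ fun _ => L

theorem pullback_covTensor {g g' : PseudoRiemMetric A} {d r : ℕ}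
    {L : TractorField A →ₗ[A] TractorField A}
    (hL : ∀ X T, (g'.tractorConnection d).cov X (L T) = L ((g.tractorConnection d).cov X T))
    (X : VectorField A) (F : TractorTensor A r) :
    pullback L r (g'.covTensor d X F) = g.covTensor d X (pullback L r F) := by
  refine MultilinearMap.ext fun T => ?_
  change X (F fun i => L (T i)) - ∑ i, F (Function.update (fun i => L (T i)) i
      ((g'.tractorConnection d).cov X (L (T i)))) =
    X (F fun i => L (T i)) - ∑ i, F fun j =>
      L (Function.update T i ((g.tractorConnection d).cov X (T i)) j)
  congr 1
  refine Finset.sum_congr rfl fun i _ => congrArg F (funext fun j => ?_)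
  rw [hL, Function.apply_update (fun _ => L)]

end TractorBundle

section ThomasOperator

variable {A : Type*} [CommRing A] [Algebra ℝ A] {S : Type*} [AddCommGroup S] [Module A S]

namespace PseudoRiemMetric

variable (g : PseudoRiemMetric A)

theorem map_laplacian [IsTraceForm g.form S] {D D' : Connection (A := A) S} (L : S →ₗ[A] S)
    (hL : ∀ X s, L (D'.cov X s) = D.cov X (L s)) (s : S) :
    L (g.laplacian D' s) = g.laplacian D (L s) := by
  rw [laplacian, laplacian, map_formTrace]
  congr 1
  refine LinearMap.ext₂ fun X Y => ?_
  change L (D'.cov X (D'.cov Y s) - D'.cov (g.leviCivita.cov X Y) s) =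
    D.cov X (D.cov Y (L s)) - D.cov (g.leviCivita.cov X Y) (L s)
  rw [map_sub, hL, hL, hL]

theorem map_contract_thomasD [IsTraceForm g.form S] {D D' : Connection (A := A) S} (L : S →ₗ[A] S)
    (hL : ∀ X s, L (D'.cov X s) = D.cov X (L s)) (d : ℕ) (w : ℝ) (T : TractorField A) (s : S) :
    L (g.contract T (g.thomasD d D' w s)) = g.contract T (g.thomasD d D w (L s)) := by
  simp only [contract, thomasD, map_add, map_smul, map_neg, g.map_laplacian L hL,
    LinearMap.smul_apply, LinearMap.coe_mk, AddHom.coe_mk, hL]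

theorem laplacian_smul [IsTraceForm g.form S] (D : Connection (A := A) S)
    (f : A) (s : S) : g.laplacian D (f • s) = f • g.laplacian D s + (2 : A) • D.cov (g.grad f) s
      + g.laplacian trivialConnection f • s := by
  have hhessian : g.hessian D (f • s) = f • g.hessian D s
      + (g.form (g.grad f)).smulRight (D.derivative s)
      + (LinearMap.lsmul A S).flip.compl₁₂ (D.derivative s) (differential f)
      + (g.hess f).compr₂ (LinearMap.toSpanSingleton A S s) := by
    refine LinearMap.ext₂ fun X Y => ?_
    change D.cov X (D.cov Y (f • s)) - D.cov (g.leviCivita.cov X Y) (f • s) =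
      f • (D.cov X (D.cov Y s) - D.cov (g.leviCivita.cov X Y) s) + g.form (g.grad f) X • D.cov Y s
        + Y f • D.cov X s + (X (Y f) - g.leviCivita.cov X Y f) • s
    rw [form_grad, D.leibniz, D.leibniz, D.add_right, D.leibniz, D.leibniz]
    module
  change formTrace g.form (g.hessian D (f • s)) = _
  rw [hhessian, map_add, map_add, map_add, map_smul, formTrace_smulRight,
    formTrace_lsmul_differential, IsTraceForm.formTrace_compr]
  change f • g.laplacian D s + D.cov (g.grad f) s + D.cov (g.grad f) s
    + g.laplacian trivialConnection f • s = _
  module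

end PseudoRiemMetric

/-- `E = exp (w Υ)` up to a locally constant factor, the exponential being characterised by its
derivative. Such an `E` is the factor by which densities of weight `w` change. -/
def IsWeightFactor (Υ : A) (w : ℝ) (E : A) : Prop :=
  ∀ X : VectorField A, X E = algebraMap ℝ A w * E * X Υ

open PseudoRiemMetric

namespace IsWeightFactor

variable {g : PseudoRiemMetric A} {Υ E : A} {w : ℝ}

theorem grad (hE : IsWeightFactor Υ w E) : g.grad E = (algebraMap ℝ A w * E) • g.grad Υ := by
  refine g.ext_form fun Z => ?_
  rw [form_grad, map_smul, LinearMap.smul_apply, form_grad, hE, smul_eq_mul]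

theorem laplacian [IsTraceForm g.form A] (hE : IsWeightFactor Υ w E) :
    g.laplacian trivialConnection E = algebraMap ℝ A w * E * (g.laplacian trivialConnection Υ
      + algebraMap ℝ A w * g.grad Υ Υ) := by
  have hhess : g.hess E = (algebraMap ℝ A w * E) • (g.hess Υ
      + algebraMap ℝ A w • (differential Υ).smulRight (differential Υ)) := by
    refine LinearMap.ext₂ fun X Y => ?_
    change X (Y E) - g.leviCivita.cov X Y E = algebraMap ℝ A w * E * ((X (Y Υ)
      - g.leviCivita.cov X Y Υ) + algebraMap ℝ A w * (X Υ * Y Υ))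
    simp only [hE _, Derivation.leibniz, Derivation.map_algebraMap, smul_eq_mul]
    ring
  rw [← formTrace_hess, hhess, map_smul, map_add, map_smul, formTrace_differential,
    formTrace_hess, smul_eq_mul, smul_eq_mul]

end IsWeightFactor

namespace IsConformalChange

theorem isWeightFactor {g g' : PseudoRiemMetric A} {Υ Ω Ω' : A}
    (H : IsConformalChange g g' Υ Ω Ω') : IsWeightFactor Υ 1 Ω := fun X => by
  rw [H.deriv, map_one, one_mul]

variable {d : ℕ} [HasDimension A d] [∀ g : PseudoRiemMetric A, IsTraceForm g.form A]
  {g g' : PseudoRiemMetric A} {Υ Ω Ω' : A}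

theorem thomasD_bottom [∀ g : PseudoRiemMetric A, IsTraceForm g.form S]
    (H : IsConformalChange g g' Υ Ω Ω') (hd : 3 ≤ d) (D : Connection (A := A) S) {E : A} {w : ℝ}
    (hE : IsWeightFactor Υ w E) (V : S) :
    (g'.thomasD d D w (E • V)).2.2 = (E * (Ω' * Ω')) • ((g.thomasD d D w V).2.2
      - (g.thomasD d D w V).2.1 (g.grad Υ)
      - (algebraMap ℝ A (1 / 2) * g.grad Υ Υ) • (g.thomasD d D w V).1) := by
  simp only [thomasD, LinearMap.smul_apply, LinearMap.coe_mk, AddHom.coe_mk, map_sub, map_add,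
    map_mul, map_ofNat]
  rw [H.laplacian (d := d), H.schoutenTrace hd, laplacian_smul, hE.laplacian, hE.grad, D.leibniz,
    D.smul_left, hE]
  set δ := algebraMap ℝ A d
  match_scalars
  · ring
  · ring
  · linear_combination (E * Ω' ^ 2 * g.grad Υ Υ * algebraMap ℝ A w
      * (δ + algebraMap ℝ A w - 1)) * two_mul_half (A := A)

theorem contract_thomasD [∀ g : PseudoRiemMetric A, IsTraceForm g.form S]
    (H : IsConformalChange g g' Υ Ω Ω') (hd : 3 ≤ d) (D : Connection (A := A) S) {E : A} {w : ℝ}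
    (hE : IsWeightFactor Υ w E) (T : TractorField A) (V : S) :
    g'.contract (g.splitting Υ Ω Ω' T) (g'.thomasD d D w (E • V)) =
      (E * Ω') • g.contract T (g.thomasD d D w V) := by
  obtain ⟨s, μ, ρ⟩ := T
  simp only [contract]
  rw [H.thomasD_bottom hd D hE]
  simp only [thomasD, splitting_apply, LinearMap.smul_apply, LinearMap.coe_mk, AddHom.coe_mk,
    H.sharp, map_smul, map_add, D.leibniz, hE _, sharp_derivation, sharp_differential, map_mul,
    map_sub, map_ofNat]
  set p := algebraMap ℝ A w
  set δ := algebraMap ℝ A d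
  set m := algebraMap ℝ A (1 / 2)
  match_scalars
  · linear_combination ((δ + 2 * p - 2) * (p * μ (g.grad Υ) + s * p * g.grad Υ Υ)
      + s * (-(p * g.schoutenTrace d) - m * g.grad Υ Υ * (δ + 2 * p - 2) * p)) * Ω' * E * H.mul_inv
      - E * Ω' * (δ + 2 * p - 2) * s * p * g.grad Υ Υ * two_mul_half (A := A)
  · linear_combination E * Ω' * (δ + 2 * p - 2) * H.mul_inv
  · ring
  · linear_combination -(E * Ω' * s) * H.mul_inv

theorem scaleTractor (H : IsConformalChange g g' Υ Ω Ω') (hd : 3 ≤ d) (σ : A) :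
    g'.scaleTractor d (Ω * σ) = g.splitting Υ Ω Ω' (g.scaleTractor d σ) := by
  have hbottom := H.thomasD_bottom hd trivialConnection H.isWeightFactor σ
  simp only [smul_eq_mul] at hbottom
  rw [PseudoRiemMetric.scaleTractor, PseudoRiemMetric.scaleTractor, map_smul, splitting_apply]
  congr 1
  refine Prod.ext ?_ (Prod.ext (LinearMap.ext fun X => ?_) ?_)
  · simp only [thomasD, smul_eq_mul]
    ring
  · simp only [thomasD, LinearMap.coe_mk, AddHom.coe_mk, smul_eq_mul, LinearMap.smul_apply,
      LinearMap.add_apply, differential_apply, trivialConnection, Derivation.leibniz, H.deriv,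
      mul_one]
    ring
  · rw [hbottom]
    linear_combination (Ω' * ((g.thomasD d trivialConnection 1 σ).2.2
      - (g.thomasD d trivialConnection 1 σ).2.1 (g.grad Υ)
      - algebraMap ℝ A (1 / 2) * g.grad Υ Υ * (g.thomasD d trivialConnection 1 σ).1)) * H.mul_inv

theorem scaleSq (H : IsConformalChange g g' Υ Ω Ω') (hd : 3 ≤ d) (σ : A) :
    g'.scaleSq d (Ω * σ) = g.scaleSq d σ := by
  rw [PseudoRiemMetric.scaleSq, H.scaleTractor hd, H.tractorMetric]
  rfl

variable {r : ℕ} [∀ g : PseudoRiemMetric A, IsTraceForm g.form (TractorTensor A r)]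

theorem degenerateLaplacian (H : IsConformalChange g g' Υ Ω Ω') (hd : 3 ≤ d) {E : A} {w : ℝ}
    (hE : IsWeightFactor Υ w E) (σ : A) {F F' : TractorTensor A r}
    (hF : pullback (g.splitting Υ Ω Ω') r F' = E • F) :
    pullback (g.splitting Υ Ω Ω') r (g'.degenerateLaplacian d (Ω * σ) w F') =
      (E * Ω') • g.degenerateLaplacian d σ w F := by
  rw [PseudoRiemMetric.degenerateLaplacian, PseudoRiemMetric.degenerateLaplacian,
    H.scaleTractor hd, g'.map_contract_thomasD (D := g.tensorConnection d r) _
      (pullback_covTensor (H.tractorConnection hd)), hF, H.contract_thomasD hd _ hE]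

theorem yOp (H : IsConformalChange g g' Υ Ω Ω') (hd : 3 ≤ d) {E : A} {w : ℝ}
    (hE : IsWeightFactor Υ w E) (σ : A) {F F' : TractorTensor A r}
    (hF : pullback (g.splitting Υ Ω Ω') r F' = E • F) :
    pullback (g.splitting Υ Ω Ω') r (g'.yOp d (Ω * σ) w F') = (E * Ω') • g.yOp d σ w F := by
  rw [PseudoRiemMetric.yOp, PseudoRiemMetric.yOp, map_neg, map_smul,
    H.degenerateLaplacian hd hE σ hF, H.scaleSq hd, smul_neg, smul_comm]

theorem yPow (H : IsConformalChange g g' Υ Ω Ω') (hd : 3 ≤ d) {E : ℝ → A}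
    (hE : ∀ w, IsWeightFactor Υ w (E w)) (hE_mul : ∀ w, E w * Ω' = E (w - 1)) (σ : A) (k : ℕ)
    (w : ℝ) {F F' : TractorTensor A r} (hF : pullback (g.splitting Υ Ω Ω') r F' = E w • F) :
    pullback (g.splitting Υ Ω Ω') r (g'.yPow d (Ω * σ) k w F') =
      E (w - k) • g.yPow d σ k w F := by
  induction k generalizing w F F' with
  | zero => simpa [PseudoRiemMetric.yPow] using hF
  | succ k ih =>
    have hstep := ih (w - 1) ((H.yOp hd (hE w) σ hF).trans (by rw [hE_mul]))
    rwa [show w - 1 - (k : ℝ) = w - ((k + 1 : ℕ) : ℝ) by push_cast; ring] at hstep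

end IsConformalChange

end ThomasOperator

section NaturalEndomorphisms

variable {A : Type*} [CommRing A] [Algebra ℝ A]

namespace Connection

variable {V : Type*} [AddCommGroup V] [Module A V]

/-- The covariant derivative `∇_X B` of a bilinear form. -/
def covForm (D : Connection (A := A) V) (X : VectorField A) (B : V →ₗ[A] V →ₗ[A] A) :
    V →ₗ[A] V →ₗ[A] A :=
  LinearMap.mk₂ A (fun v v' => X (B v v') - B (D.cov X v) v' - B v (D.cov X v'))
    (fun v v' u => by
      simp only [map_add, LinearMap.add_apply, D.add_right]; ring)
    (fun f v u => by
      simp only [map_smul, map_add, LinearMap.smul_apply, LinearMap.add_apply, D.leibniz,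
        smul_eq_mul, Derivation.leibniz]
      ring)
    (fun v u u' => by
      simp only [map_add, D.add_right]; ring)
    (fun f v u => by
      simp only [map_smul, map_add, D.leibniz, smul_eq_mul, Derivation.leibniz]
      ring)

variable (D : Connection (A := A) V) (X : VectorField A)

theorem covForm_apply (B : V →ₗ[A] V →ₗ[A] A) (v v' : V) :
    D.covForm X B v v' = X (B v v') - B (D.cov X v) v' - B v (D.cov X v') := rfl

theorem covForm_add (B C : V →ₗ[A] V →ₗ[A] A) :
    D.covForm X (B + C) = D.covForm X B + D.covForm X C :=
  LinearMap.ext₂ fun v v' => by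
    simp only [covForm_apply, LinearMap.add_apply, map_add]; ring

theorem covForm_smul (f : A) (B : V →ₗ[A] V →ₗ[A] A) :
    D.covForm X (f • B) = f • D.covForm X B + X f • B :=
  LinearMap.ext₂ fun v v' => by
    simp only [covForm_apply, LinearMap.add_apply, LinearMap.smul_apply, smul_eq_mul,
      Derivation.leibniz]
    ring

theorem covForm_rankOne {b : V →ₗ[A] V →ₗ[A] A} {D : Connection (A := A) V} {X : VectorField A}
    (hb : D.covForm X b = 0) (v v' : V) (f : A) : D.covForm X (rankOne b v v' f) =
      rankOne b (D.cov X v) v' f + rankOne b v (D.cov X v') f + rankOne b v v' (X f) := by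
  have hparallel (u u' : V) : X (b u u') = b (D.cov X u) u' + b u (D.cov X u') := by
    have h := congrArg (fun B => B u u') hb
    rw [← sub_eq_zero, ← sub_sub]
    exact h
  refine LinearMap.ext₂ fun u u' => ?_
  simp only [covForm_apply, LinearMap.add_apply, rankOne_apply, smul_eq_mul, Derivation.leibniz,
    hparallel]
  ring

theorem derivation_formTrace {b : V →ₗ[A] V →ₗ[A] A} [IsTraceForm b A]
    {D : Connection (A := A) V} {X : VectorField A} (hb : D.covForm X b = 0)
    (B : V →ₗ[A] V →ₗ[A] A) : X (formTrace b B) = formTrace b (D.covForm X B) := by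
  -- The difference of the two sides is linear in `B`, so it is enough to take `B` of rank one.
  let defect : (V →ₗ[A] V →ₗ[A] A) →ₗ[A] A :=
    { toFun := fun B => X (formTrace b B) - formTrace b (D.covForm X B)
      map_add' := fun B C => by simp only [covForm_add, map_add]; ring
      map_smul' := fun f B => by
        simp only [covForm_smul, map_add, map_smul, smul_eq_mul, RingHom.id_apply,
          Derivation.leibniz]
        ring }
  have hdefect : defect = 0 := by
    refine IsTraceForm.ext_rankOne (b := b) _ _ fun v v' f => ?_
    have hparallel : X (b v v') - b (D.cov X v) v' - b v (D.cov X v') = 0 :=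
      congrArg (fun B => B v v') hb
    change X (formTrace b (rankOne b v v' f)) - formTrace b (D.covForm X (rankOne b v v' f)) = 0
    rw [covForm_rankOne hb, map_add, map_add]
    simp only [IsTraceForm.formTrace_rankOne, smul_eq_mul, Derivation.leibniz]
    linear_combination f * hparallel
  exact sub_eq_zero.1 (congrArg (fun u => u B) hdefect)

end Connection

namespace PseudoRiemMetric

variable (g : PseudoRiemMetric A) (d : ℕ) {r : ℕ}

theorem covTensor_apply (X : VectorField A) (F : TractorTensor A r)
    (T : Fin r → TractorField A) : g.covTensor d X F T =
      X (F T) - ∑ i, F (Function.update T i ((g.tractorConnection d).cov X (T i))) := rfl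

theorem covTensor_perm (e : Equiv.Perm (Fin r)) (K : Module.End A (TractorTensor A r))
    (hK : ∀ F T, K F T = F (T ∘ e)) (X : VectorField A) (F : TractorTensor A r) :
    K (g.covTensor d X F) = g.covTensor d X (K F) := by
  refine MultilinearMap.ext fun T => ?_
  rw [hK, covTensor_apply, covTensor_apply, hK]
  congr 1
  refine Eq.trans ?_ (Equiv.sum_comp e _)
  refine Finset.sum_congr rfl fun i _ => ?_
  rw [hK]
  congr 1
  exact (Function.update_comp_eq_of_injective T e.injective i _).symm

theorem covForm_tractorMetric (X : VectorField A) :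
    (g.tractorConnection d).covForm X g.tractorMetric = 0 :=
  LinearMap.ext₂ fun T T' => by
    rw [Connection.covForm_apply, tractorConnection_metric, sub_sub, sub_self]
    rfl

theorem slotForm_apply (F : TractorTensor A r) (T : Fin r → TractorField A) {i j : Fin r}
    (hij : i ≠ j) (a b : TractorField A) :
    slotForm F T i j hij a b = F (Function.update (Function.update T i a) j b) := rfl

theorem slotForm_update_left (F : TractorTensor A r) (T : Fin r → TractorField A) {i j : Fin r}
    (hij : i ≠ j) (u : TractorField A) :
    slotForm F (Function.update T i u) i j hij = slotForm F T i j hij :=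
  LinearMap.ext₂ fun a b => by rw [slotForm_apply, slotForm_apply, Function.update_idem]

theorem slotForm_update_right (F : TractorTensor A r) (T : Fin r → TractorField A) {i j : Fin r}
    (hij : i ≠ j) (u : TractorField A) :
    slotForm F (Function.update T j u) i j hij = slotForm F T i j hij :=
  LinearMap.ext₂ fun a b => by
    rw [slotForm_apply, slotForm_apply, Function.update_comm hij.symm, Function.update_idem]

end PseudoRiemMetric

theorem sum_eq_sum_add_add_of_ne {ι N : Type*} [Fintype ι] [AddCommGroup N] {u v : ι → N}
    {i j : ι} (hij : i ≠ j) (h : ∀ l, l ≠ i → l ≠ j → u l = v l) :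
    ∑ l, u l = ∑ l, v l + (u i - v i) + (u j - v j) := by
  classical
  have hdiff := Finset.sum_eq_add_of_mem (s := Finset.univ) (f := fun l => u l - v l) i j
    (Finset.mem_univ i) (Finset.mem_univ j) hij fun l _ hl => sub_eq_zero.2 (h l hl.1 hl.2)
  rw [Finset.sum_sub_distrib] at hdiff
  rw [add_assoc, ← hdiff, add_sub_cancel]

namespace PseudoRiemMetric

variable (g : PseudoRiemMetric A) (d : ℕ) {r : ℕ} {i j : Fin r} (hij : i ≠ j)

theorem covForm_slotForm (X : VectorField A) (F : TractorTensor A r)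
    (T : Fin r → TractorField A) :
    (g.tractorConnection d).covForm X (slotForm F T i j hij) =
      slotForm (g.covTensor d X F) T i j hij
      + ∑ l, slotForm F (Function.update T l ((g.tractorConnection d).cov X (T l))) i j hij
      - (2 : A) • slotForm F T i j hij := by
  refine LinearMap.ext₂ fun a b => ?_
  set D := g.tractorConnection d
  set U := Function.update (Function.update T i a) j b with hU
  have hUi : U i = a := by rw [hU, Function.update_of_ne hij, Function.update_self]
  have hUj : U j = b := by rw [hU, Function.update_self]
  have hother (l : Fin r) (hli : l ≠ i) (hlj : l ≠ j) :
      F (Function.update U l (D.cov X (U l))) =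
        slotForm F (Function.update T l (D.cov X (T l))) i j hij a b := by
    rw [slotForm_apply, hU, Function.update_of_ne hlj, Function.update_of_ne hli,
      Function.update_comm hlj.symm, Function.update_comm hli.symm]
  have hi : F (Function.update U i (D.cov X a)) = slotForm F T i j hij (D.cov X a) b := by
    rw [slotForm_apply, hU, Function.update_comm hij.symm, Function.update_idem]
  have hj : F (Function.update U j (D.cov X b)) = slotForm F T i j hij a (D.cov X b) := by
    rw [slotForm_apply, hU, Function.update_idem]
  have hsum := sum_eq_sum_add_add_of_ne hij hother
  rw [slotForm_update_left, slotForm_update_right, hUi, hUj, hi, hj] at hsum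
  simp only [LinearMap.sub_apply, LinearMap.add_apply, LinearMap.smul_apply, smul_eq_mul,
    LinearMap.sum_apply, Connection.covForm_apply]
  rw [slotForm_apply (g.covTensor d X F), covTensor_apply, hsum, slotForm_apply F T hij a b]
  ring

theorem covTensor_contraction [IsTraceForm g.tractorMetric A]
    (K : Module.End A (TractorTensor A r))
    (hK : ∀ F T, K F T = g.tractorMetric (T i) (T j) *
      formTrace g.tractorMetric (slotForm F T i j hij))
    (X : VectorField A) (F : TractorTensor A r) :
    K (g.covTensor d X F) = g.covTensor d X (K F) := by
  refine MultilinearMap.ext fun T => ?_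
  set D := g.tractorConnection d
  have hother (l : Fin r) (hli : l ≠ i) (hlj : l ≠ j) :
      K F (Function.update T l (D.cov X (T l))) = g.tractorMetric (T i) (T j) *
        formTrace g.tractorMetric
          (slotForm F (Function.update T l (D.cov X (T l))) i j hij) := by
    rw [hK, Function.update_of_ne hli.symm, Function.update_of_ne hlj.symm]
  have hsum := sum_eq_sum_add_add_of_ne hij hother
  rw [hK, hK, slotForm_update_left, slotForm_update_right, Function.update_self,
    Function.update_self, Function.update_of_ne hij, Function.update_of_ne hij.symm] at hsum
  have htrace := Connection.derivation_formTrace (g.covForm_tractorMetric d X)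
    (slotForm F T i j hij)
  rw [covForm_slotForm, formTrace_sub, map_add, map_sum, map_smul, smul_eq_mul] at htrace
  rw [hK, covTensor_apply, hsum, hK, Derivation.leibniz, htrace,
    g.tractorConnection_metric d X (T i) (T j), ← Finset.mul_sum]
  simp only [smul_eq_mul]
  ring

end PseudoRiemMetric

end NaturalEndomorphisms

section DifferentialOperators

variable {R : Type*} [CommRing R] (A : Type*) [CommRing A] [Algebra R A]
  {V : Type*} [AddCommGroup V] [Module R V] [Module A V] [IsScalarTower R A V]

/-- `R`-linear differential operators of order at most `m` on a module over an `R`-algebra `A`,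
in the sense of Grothendieck: the iterated commutators with `m + 1` multiplications by elements of
`A` vanish. -/
def HasOrderLE : ℕ → Module.End R V → Prop
  | 0, O => ∀ f : A, ⁅O, Algebra.lsmul R R V f⁆ = 0
  | m + 1, O => ∀ f : A, HasOrderLE m ⁅O, Algebra.lsmul R R V f⁆

variable {A} {O O' : Module.End R V} {m m' : ℕ}

theorem lie_lsmul_apply (O : Module.End R V) (f : A) (v : V) :
    ⁅O, Algebra.lsmul R R V f⁆ v = O (f • v) - f • O v := rfl

theorem hasOrderLE_zero_iff : HasOrderLE A 0 O ↔ ∀ (f : A) v, O (f • v) = f • O v :=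
  forall_congr' fun f => by
    simp only [LinearMap.ext_iff, lie_lsmul_apply, LinearMap.zero_apply, sub_eq_zero]

theorem lie_add_left (O O' P : Module.End R V) : ⁅O + O', P⁆ = ⁅O, P⁆ + ⁅O', P⁆ := by
  simp only [Ring.lie_def]
  noncomm_ring

theorem lie_mul_left (O O' P : Module.End R V) : ⁅O * O', P⁆ = O * ⁅O', P⁆ + ⁅O, P⁆ * O' := by
  simp only [Ring.lie_def]
  noncomm_ring

namespace HasOrderLE

theorem add (h : HasOrderLE A m O) (h' : HasOrderLE A m O') : HasOrderLE A m (O + O') := by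
  induction m generalizing O O' with
  | zero => intro f; rw [lie_add_left, h f, h' f, add_zero]
  | succ m ih => intro f; rw [lie_add_left]; exact ih (h f) (h' f)

theorem mul_of_left_zero (h : HasOrderLE A 0 O) (h' : HasOrderLE A m O') :
    HasOrderLE A m (O * O') := by
  induction m generalizing O' with
  | zero => intro f; rw [lie_mul_left, h f, h' f, mul_zero, zero_mul, add_zero]
  | succ m ih => intro f; rw [lie_mul_left, h f, zero_mul, add_zero]; exact ih (h' f)

theorem mul (h : HasOrderLE A m O) (h' : HasOrderLE A m' O') :
    HasOrderLE A (m + m') (O * O') := by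
  induction m generalizing O O' m' with
  | zero => rw [zero_add]; exact mul_of_left_zero h h'
  | succ m ih =>
    induction m' generalizing O O' with
    | zero => intro f; rw [lie_mul_left, h' f, mul_zero, zero_add]; exact ih (h f) h'
    | succ m' ih' =>
      intro f
      rw [lie_mul_left]
      refine add (ih' h (h' f)) ?_
      rw [Nat.add_eq, Nat.succ_add_eq_add_succ]
      exact ih (h f) h'

end HasOrderLE

end DifferentialOperators

section RealLinear

variable {A : Type*} [CommRing A] [Algebra ℝ A] {S : Type*} [AddCommGroup S] [Module A S]

namespace PseudoRiemMetric

variable (g : PseudoRiemMetric A) (d : ℕ) (D : Connection (A := A) S) (w : ℝ)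

theorem laplacian_add (s t : S) :
    g.laplacian D (s + t) = g.laplacian D s + g.laplacian D t := by
  rw [laplacian, laplacian, laplacian, ← map_add]
  congr 1
  refine LinearMap.ext₂ fun X Y => ?_
  change D.cov X (D.cov Y (s + t)) - D.cov (g.leviCivita.cov X Y) (s + t) =
    D.cov X (D.cov Y s) - D.cov (g.leviCivita.cov X Y) s
      + (D.cov X (D.cov Y t) - D.cov (g.leviCivita.cov X Y) t)
  rw [D.add_right, D.add_right, D.add_right]
  abel

theorem contract_thomasD_add (T : TractorField A) (s t : S) :
    g.contract T (g.thomasD d D w (s + t)) =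
      g.contract T (g.thomasD d D w s) + g.contract T (g.thomasD d D w t) := by
  simp only [contract, thomasD, laplacian_add, LinearMap.smul_apply, LinearMap.coe_mk,
    AddHom.coe_mk, Connection.add_right]
  module

end PseudoRiemMetric

variable [Module ℝ S] [IsScalarTower ℝ A S]

theorem Connection.real_smul_right (D : Connection (A := A) S) (X : VectorField A) (t : ℝ)
    (s : S) : D.cov X (t • s) = t • D.cov X s := by
  rw [← algebraMap_smul A t s, D.leibniz, Derivation.map_algebraMap, zero_smul, zero_add,
    algebraMap_smul]

namespace PseudoRiemMetric

variable (g : PseudoRiemMetric A) (d : ℕ) (D : Connection (A := A) S) (w : ℝ)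

theorem laplacian_real_smul (t : ℝ) (s : S) : g.laplacian D (t • s) = t • g.laplacian D s := by
  rw [laplacian, laplacian, ← algebraMap_smul A t (formTrace _ _), ← map_smul]
  congr 1
  refine LinearMap.ext₂ fun X Y => ?_
  change D.cov X (D.cov Y (t • s)) - D.cov (g.leviCivita.cov X Y) (t • s) =
    algebraMap ℝ A t • (D.cov X (D.cov Y s) - D.cov (g.leviCivita.cov X Y) s)
  simp only [D.real_smul_right, algebraMap_smul, smul_sub]

theorem contract_thomasD_real_smul (T : TractorField A) (t : ℝ) (s : S) :
    g.contract T (g.thomasD d D w (t • s)) = t • g.contract T (g.thomasD d D w s) := by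
  simp only [contract, thomasD, laplacian_real_smul, LinearMap.smul_apply, LinearMap.coe_mk,
    AddHom.coe_mk, Connection.real_smul_right, smul_comm _ t, ← smul_add, ← smul_neg]

end PseudoRiemMetric

end RealLinear

section Scale

instance {A : Type*} [CommRing A] [Algebra ℝ A] {r : ℕ} :
    IsScalarTower ℝ A (TractorTensor A r) :=
  ⟨fun t f F => MultilinearMap.ext fun T => smul_assoc t f (F T)⟩

namespace PseudoRiemMetric

variable {A : Type*} [CommRing A] [Algebra ℝ A] (g : PseudoRiemMetric A) (d : ℕ) (σ : A) {r : ℕ}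

/-- The operator `-(1/I²) I·D` on tractor tensors of weight `w` as an `ℝ`-linear map. -/
def yEnd (w : ℝ) : Module.End ℝ (TractorTensor A r) where
  toFun := g.yOp d σ w
  map_add' F G := by
    rw [yOp, degenerateLaplacian, contract_thomasD_add, smul_add, neg_add]
    rfl
  map_smul' t F := by
    rw [yOp, degenerateLaplacian, contract_thomasD_real_smul, smul_comm, ← smul_neg]
    rfl

/-- The power `(-(1/I²) I·D)^k` on tractor tensors, beginning at weight `w`, as an `ℝ`-linear
map. -/
def yPowEnd : ℕ → ℝ → Module.End ℝ (TractorTensor A r)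
  | 0, _ => 1
  | k + 1, w => yPowEnd k (w - 1) * g.yEnd d σ w

theorem yPowEnd_apply (k : ℕ) (w : ℝ) (F : TractorTensor A r) :
    g.yPowEnd d σ k w F = g.yPow d σ k w F := by
  induction k generalizing w F with
  | zero => rfl
  | succ _ ih => exact ih (w - 1) _

theorem map_yPow [IsTraceForm g.form (TractorTensor A r)] (K : Module.End A (TractorTensor A r))
    (hK : ∀ X F, K (g.covTensor d X F) = g.covTensor d X (K F)) (k : ℕ) (w : ℝ)
    (F : TractorTensor A r) : K (g.yPow d σ k w F) = g.yPow d σ k w (K F) := by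
  induction k generalizing w F with
  | zero => rfl
  | succ k ih =>
    change K (g.yPow d σ k (w - 1) (g.yOp d σ w F)) = g.yPow d σ k (w - 1) (g.yOp d σ w (K F))
    rw [ih, yOp, yOp, map_neg, map_smul, degenerateLaplacian, degenerateLaplacian,
      g.map_contract_thomasD (D := g.tensorConnection d r) K hK]

variable {d} (hd : d ≠ 0)
include hd

theorem scaleTractor_fst : (g.scaleTractor d σ).1 = σ := by
  have hd' : (d : ℝ) ≠ 0 := Nat.cast_ne_zero.2 hd
  have hcoeff : 1 / (d : ℝ) * ((d + 2 * 1 - 2) * 1) = 1 := by field_simp; ring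
  change algebraMap ℝ A (1 / d) * (algebraMap ℝ A ((d + 2 * 1 - 2) * 1) * σ) = σ
  rw [← mul_assoc, ← map_mul, hcoeff, map_one, one_mul]

theorem scaleTractor_snd : (g.scaleTractor d σ).2.1 = differential σ := by
  have hd' : (d : ℝ) ≠ 0 := Nat.cast_ne_zero.2 hd
  have hcoeff : 1 / (d : ℝ) * (d + 2 * 1 - 2) = 1 := by field_simp; ring
  refine LinearMap.ext fun X => ?_
  change algebraMap ℝ A (1 / d) * (algebraMap ℝ A (d + 2 * 1 - 2) * X σ) = X σ
  rw [← mul_assoc, ← map_mul, hcoeff, map_one, one_mul]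

theorem algebraMap_mul_scaleTractor :
    algebraMap ℝ A d * (g.scaleTractor d σ).2.2 =
      -(g.laplacian trivialConnection σ + g.schoutenTrace d * σ) := by
  have hd' : (d : ℝ) ≠ 0 := Nat.cast_ne_zero.2 hd
  change algebraMap ℝ A d * (algebraMap ℝ A (1 / d) * -(g.laplacian trivialConnection σ
    + algebraMap ℝ A 1 * g.schoutenTrace d * σ)) = _
  rw [← mul_assoc, ← map_mul, mul_one_div_cancel hd', map_one, one_mul, one_mul]

theorem scaleSq_eq :
    g.scaleSq d σ = g.grad σ σ + 2 * (σ * (g.scaleTractor d σ).2.2) := by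
  rw [scaleSq, tractorMetric_apply, g.scaleTractor_fst σ hd, g.scaleTractor_snd σ hd,
    inv_differential, differential_apply]
  ring

theorem degenerateLaplacian_eq (w : ℝ) (F : TractorTensor A r) :
    g.degenerateLaplacian d σ w F =
      algebraMap ℝ A (d + 2 * w - 2) • (g.tensorConnection d r).cov (g.grad σ) F
      + σ • -(g.laplacian (g.tensorConnection d r) F + (algebraMap ℝ A w * g.schoutenTrace d) • F)
      + (g.scaleTractor d σ).2.2 • (algebraMap ℝ A ((d + 2 * w - 2) * w) • F) := by
  rw [degenerateLaplacian, contract, g.scaleTractor_fst σ hd, g.scaleTractor_snd σ hd]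
  rfl

variable [IsTraceForm g.form (TractorTensor A r)]

theorem degenerateLaplacian_smul (w : ℝ) (f : A) (F : TractorTensor A r) :
    g.degenerateLaplacian d σ w (f • F) = f • g.degenerateLaplacian d σ w F
      + (algebraMap ℝ A (d + 2 * w - 2) * g.grad σ f - σ * g.laplacian trivialConnection f) • F
      - (2 * σ) • (g.tensorConnection d r).cov (g.grad f) F := by
  rw [g.degenerateLaplacian_eq σ hd, g.degenerateLaplacian_eq σ hd, laplacian_smul,
    Connection.leibniz]
  module

theorem hasOrderLE_yEnd (w : ℝ) : HasOrderLE A 2 (g.yEnd d σ w (r := r)) := by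
  refine fun f f' => hasOrderLE_zero_iff.2 fun f'' F => ?_
  have hyEnd (G : TractorTensor A r) : g.yEnd d σ w G = g.yOp d σ w G := rfl
  simp only [lie_lsmul_apply, hyEnd, yOp, g.degenerateLaplacian_smul σ hd, Connection.leibniz]
  module

theorem hasOrderLE_yPowEnd (k : ℕ) (w : ℝ) :
    HasOrderLE A (2 * k) (g.yPowEnd d σ k w (r := r)) := by
  induction k generalizing w with
  | zero => exact hasOrderLE_zero_iff.2 fun _ _ => rfl
  | succ k ih => exact (ih (w - 1)).mul (g.hasOrderLE_yEnd σ hd w)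

theorem degenerateLaplacian_mul_scale (w : ℝ) (F : TractorTensor A r) :
    g.degenerateLaplacian d σ (w + 1) (σ • F) = σ • g.degenerateLaplacian d σ w F
      + (algebraMap ℝ A (d + 2 * w) * g.scaleSq d σ) • F := by
  have hbottom := g.algebraMap_mul_scaleTractor σ hd
  rw [g.degenerateLaplacian_eq σ hd, g.degenerateLaplacian_eq σ hd, laplacian_smul,
    Connection.leibniz, g.scaleSq_eq σ hd]
  simp only [map_mul, map_add, map_sub, map_ofNat, map_one]
  set δ := algebraMap ℝ A d
  match_scalars
  · linear_combination -σ * hbottom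
  · ring
  · ring

theorem yOp_mul_scale (hI : IsUnit (g.scaleSq d σ)) (w : ℝ) (F : TractorTensor A r) :
    g.yOp d σ (w + 1) (σ • F) = σ • g.yOp d σ w F - algebraMap ℝ A (d + 2 * w) • F := by
  rw [yOp, yOp, g.degenerateLaplacian_mul_scale σ hd, smul_add, smul_smul (Ring.inverse _) (_ * _),
    mul_left_comm, Ring.inverse_mul_cancel _ hI, mul_one]
  module

theorem yPow_succ_mul_scale (hI : IsUnit (g.scaleSq d σ)) (k : ℕ) (w : ℝ)
    (F : TractorTensor A r) : g.yPow d σ (k + 1) (w + 1) (σ • F) = σ • g.yPow d σ (k + 1) w F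
      - algebraMap ℝ A ((k + 1) * (d + 2 * w - k)) • g.yPow d σ k w F := by
  induction k generalizing w F with
  | zero =>
    change g.yOp d σ (w + 1) (σ • F) = σ • g.yOp d σ w F - _ • F
    rw [g.yOp_mul_scale σ hd hI, Nat.cast_zero, zero_add, one_mul, sub_zero]
  | succ k ih =>
    have hfirst : g.yPow d σ (k + 1 + 1) (w + 1) (σ • F) =
        g.yPow d σ (k + 1) (w - 1 + 1) (σ • g.yOp d σ w F)
          - algebraMap ℝ A (d + 2 * w) • g.yPow d σ (k + 1) w F := by
      change g.yPow d σ (k + 1) (w + 1 - 1) (g.yOp d σ (w + 1) (σ • F)) = _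
      simp only [g.yOp_mul_scale σ hd hI, ← yPowEnd_apply, algebraMap_smul, map_sub, map_smul,
        sub_add_cancel, add_sub_cancel_right]
    rw [hfirst, ih]
    change σ • g.yPow d σ (k + 1 + 1) w F - _ • g.yPow d σ (k + 1) w F - _ = _
    rw [sub_sub, ← add_smul, ← map_add]
    congr 3
    push_cast
    ring

/-- The commutator of the `k`-th power with `σ` vanishes at this weight because its coefficient
`k (d + 2 w - k - 1)` does. -/
theorem yPow_mul_scale (hI : IsUnit (g.scaleSq d σ)) {k : ℕ} {w : ℝ} (hw : 2 * w = k + 1 - d)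
    (F : TractorTensor A r) : g.yPow d σ k w (σ • F) = σ • g.yPow d σ k (w - 1) F := by
  cases k with
  | zero => rfl
  | succ k =>
    have hcoeff : (d : ℝ) + 2 * (w - 1) - k = 0 := by push_cast at hw; linarith
    have h := g.yPow_succ_mul_scale σ hd hI k (w - 1) F
    rwa [sub_add_cancel, hcoeff, mul_zero, map_zero, zero_smul, sub_zero] at h

end PseudoRiemMetric

end Scale

section Sections

variable {d : ℕ} {M : Type*} [TopologicalSpace M] [ChartedSpace (EuclideanSpace ℝ (Fin d)) M]

theorem expFn_mul (a b : ℝ) (Υ : Fn d M) : expFn a Υ * expFn b Υ = expFn (a + b) Υ := by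
  ext x
  change Real.exp (a * Υ x) * Real.exp (b * Υ x) = Real.exp ((a + b) * Υ x)
  rw [← Real.exp_add, add_mul]

theorem expFn_zero (Υ : Fn d M) : expFn 0 Υ = 1 := by
  ext x
  change Real.exp (0 * Υ x) = 1
  rw [zero_mul, Real.exp_zero]

theorem ctensor_ext {r : ℕ} {F G : CTractorTensor d M r} (hre : reT F = reT G)
    (him : imT F = imT G) : F = G := by
  ext T x
  exact Complex.ext (congrArg (fun f : Fn d M => f x) (DFunLike.congr_fun hre T))
    (congrArg (fun f : Fn d M => f x) (DFunLike.congr_fun him T))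

/-- The complex tensor with real part `R` and imaginary part `S`. -/
def ofParts {r : ℕ} (R S : TractorTensor (Fn d M) r) : CTractorTensor d M r :=
  ofRealFn.compMultilinearMap R + Complex.I • ofRealFn.compMultilinearMap S

theorem reT_ofParts {r : ℕ} (R S : TractorTensor (Fn d M) r) : reT (ofParts R S) = R := by
  ext T x
  change ((R T x : ℂ) + Complex.I * (S T x : ℂ)).re = R T x
  simp

theorem imT_ofParts {r : ℕ} (R S : TractorTensor (Fn d M) r) : imT (ofParts R S) = S := by
  ext T x
  change ((R T x : ℂ) + Complex.I * (S T x : ℂ)).im = S T x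
  simp

theorem reT_complexify {r : ℕ} (O : TractorTensor (Fn d M) r → TractorTensor (Fn d M) r)
    (F : CTractorTensor d M r) : reT (complexify O F) = O (reT F) :=
  reT_ofParts _ _

theorem imT_complexify {r : ℕ} (O : TractorTensor (Fn d M) r → TractorTensor (Fn d M) r)
    (F : CTractorTensor d M r) : imT (complexify O F) = O (imT F) :=
  imT_ofParts _ _

theorem complexify_lie {r : ℕ} (O : Module.End ℝ (TractorTensor (Fn d M) r)) (f : Fn d M)
    (F : CTractorTensor d M r) :
    complexify ⇑⁅O, Algebra.lsmul ℝ ℝ (TractorTensor (Fn d M) r) f⁆ F =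
      complexify O (f • F) - f • complexify O F := by
  refine ctensor_ext ?_ ?_
  · change _ = reT (complexify O (f • F)) - reT (f • complexify O F)
    simp only [reT_complexify, reT_fnSMul, lie_lsmul_apply]
  · change _ = imT (complexify O (f • F)) - imT (f • complexify O F)
    simp only [imT_complexify, imT_fnSMul, lie_lsmul_apply]

variable {c : ConformalStructure d M} (Φ : TractorBundle c)

/-- Real sections of `E^Φ[w]`: the family `N` of real tensors has the transformation law of weight
`w` and takes its values in `E^Φ`. -/
structure IsRealSection (w : ℝ) (N : c.metrics → TractorTensor (Fn d M) Φ.rank) : Prop where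
  equivariant : ∀ (g g' : c.metrics) (Υ : Fn d M), IsRescaling g.1 Υ g'.1 →
    pullback (g.1.splitting Υ (expFn 1 Υ) (expFn (-1) Υ)) Φ.rank (N g') = expFn w Υ • N g
  proj : ∀ g, Φ.proj g (N g) = N g

variable {Φ}

theorem mem_sections_iff {w : ℝ} {F : c.metrics → CTractorTensor d M Φ.rank} :
    F ∈ sections Φ w ↔
      IsRealSection Φ w (fun g => reT (F g)) ∧ IsRealSection Φ w (fun g => imT (F g)) := by
  refine ⟨fun hF => ⟨⟨fun g g' Υ h => ?_, fun g => (hF.2 g).1⟩,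
    ⟨fun g g' Υ h => ?_, fun g => (hF.2 g).2⟩⟩,
    fun hF => ⟨fun g g' Υ h T => ?_, fun g => ⟨hF.1.proj g, hF.2.proj g⟩⟩⟩
  · exact MultilinearMap.ext fun T =>
      (congrArg reFn (hF.1 g g' Υ h T)).trans (reFn.map_smul (expFn w Υ) (F g T))
  · exact MultilinearMap.ext fun T =>
      (congrArg imFn (hF.1 g g' Υ h T)).trans (imFn.map_smul (expFn w Υ) (F g T))
  · ext x
    refine Complex.ext ?_ ?_
    · exact (congrArg (fun f : Fn d M => f x)
        (DFunLike.congr_fun (hF.1.equivariant g g' Υ h) T)).trans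
          (Complex.smul_re (expFn w Υ x) (F g T x)).symm
    · exact (congrArg (fun f : Fn d M => f x)
        (DFunLike.congr_fun (hF.2.equivariant g g' Υ h) T)).trans
          (Complex.smul_im (expFn w Υ x) (F g T x)).symm

variable (Φ) {w w' : ℝ}

/-- The operator on sections that is given in each scale by the complex extension of the operator
`O g` on real tensors. -/
def liftOp (O : c.metrics → Module.End ℝ (TractorTensor (Fn d M) Φ.rank))
    (hO : ∀ N, IsRealSection Φ w N → IsRealSection Φ w' fun g => O g (N g)) :
    sections Φ w →ₗ[ℂ] sections Φ w' where
  toFun F := ⟨fun g => complexify (O g) (F.1 g), by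
    simp only [mem_sections_iff, reT_complexify, imT_complexify]
    exact (mem_sections_iff.1 F.2).imp (hO _) (hO _)⟩
  map_add' F G := Subtype.ext <| funext fun g => by
    change complexify (O g) (F.1 g + G.1 g) = complexify (O g) (F.1 g) + complexify (O g) (G.1 g)
    refine ctensor_ext ?_ ?_
    · simp only [reT_add, reT_complexify, map_add]
    · simp only [imT_add, imT_complexify, map_add]
  map_smul' z F := Subtype.ext <| funext fun g => by
    change complexify (O g) (z • F.1 g) = z • complexify (O g) (F.1 g)
    refine ctensor_ext ?_ ?_
    · simp only [reT_smul, reT_complexify, imT_complexify, algebraMap_smul, map_sub, map_smul]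
    · simp only [imT_smul, reT_complexify, imT_complexify, algebraMap_smul, map_add, map_smul]

variable {Φ}

section Order

variable {P : sections Φ w →ₗ[ℂ] sections Φ w'}
  {O : c.metrics → Module.End ℝ (TractorTensor (Fn d M) Φ.rank)}

theorem apply_mulFn_sub_smul_apply (hP : ∀ F g, (P F).1 g = complexify (O g) (F.1 g))
    (f : Fn d M) (F : sections Φ w) (g : c.metrics) :
    (P (mulFn Φ w f F)).1 g - f • (P F).1 g =
      complexify ⇑⁅O g, Algebra.lsmul ℝ ℝ (TractorTensor (Fn d M) Φ.rank) f⁆ (F.1 g) := by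
  rw [complexify_lie, ← hP F g]
  exact congrArg (· - f • (P F).1 g) (hP (mulFn Φ w f F) g)

theorem isDiffOp_of_hasOrderLE {m : ℕ} (hP : ∀ F g, (P F).1 g = complexify (O g) (F.1 g))
    (hO : ∀ g, HasOrderLE (Fn d M) m (O g)) :
    IsDiffOp (V := sections Φ w) (W := sections Φ w') (mulFn Φ w) (mulFn Φ w') m P := by
  induction m generalizing P O with
  | zero =>
    refine fun f => LinearMap.ext fun F => Subtype.ext <| funext fun g => sub_eq_zero.1 ?_
    refine (apply_mulFn_sub_smul_apply hP f F g).trans ?_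
    rw [hO g f]
    exact ctensor_ext (reT_complexify _ _) (imT_complexify _ _)
  | succ m ih => exact fun f => ih (apply_mulFn_sub_smul_apply hP f) fun g => hO g f

end Order

variable [T2Space M] [IsManifold (𝓡 d) ∞ M]

theorem IsRescaling.isConformalChange {g g' : PseudoRiemMetric (Fn d M)} {Υ : Fn d M}
    (h : IsRescaling g Υ g') : IsConformalChange g g' Υ (expFn 1 Υ) (expFn (-1) Υ) where
  form X Y := by rw [h X Y, expFn_mul, one_add_one_eq_two]
  mul_inv := by rw [expFn_mul, add_neg_cancel, expFn_zero]
  deriv X := by rw [derivation_expFn, map_one, one_mul]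
  deriv_inv X := by rw [derivation_expFn, map_neg, map_one]; ring

instance (g : PseudoRiemMetric (Fn d M)) : IsTraceForm g.tractorMetric (Fn d M) :=
  isTraceForm g.tractorMetric_comm g.tractorMetric_surjective

theorem IsNaturalEnd.map_covTensor {r : ℕ}
    {K : c.metrics → Module.End (Fn d M) (TractorTensor (Fn d M) r)} (hK : IsNaturalEnd c r K)
    (g : c.metrics) (X : VectorField (Fn d M)) (F : TractorTensor (Fn d M) r) :
    K g (g.1.covTensor d X F) = g.1.covTensor d X (K g F) := by
  induction hK generalizing F with
  | perm e K h => exact g.1.covTensor_perm d e (K g) (h g) X F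
  | contraction i j hij K h => exact g.1.covTensor_contraction d hij (K g) (h g) X F
  | add K L _ _ hK hL =>
    change K g (g.1.covTensor d X F) + L g (g.1.covTensor d X F) =
      g.1.covTensor d X (K g F + L g F)
    rw [hK, hL]
    exact ((g.1.tensorConnection d r).add_right X _ _).symm
  | comp K L _ _ hK hL =>
    change K g (L g (g.1.covTensor d X F)) = g.1.covTensor d X (K g (L g F))
    rw [hL, hK]
  | smul t K _ hK =>
    change algebraMap ℝ (Fn d M) t • K g (g.1.covTensor d X F) =
      g.1.covTensor d X (algebraMap ℝ (Fn d M) t • K g F)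
    rw [hK]
    exact ((g.1.tensorConnection d r).real_smul_right X t (K g F)).symm

variable (Φ)

/-- The operator `(-(1/I²) I·D)^k` on sections of `E^Φ[w]`, where `I` is the scale tractor
of `σ`. -/
def sectionPow (hd : 3 ≤ d) (σ : RealDensity c 1) (k : ℕ) (hw : w - k = w') :
    sections Φ w →ₗ[ℂ] sections Φ w' :=
  liftOp Φ (fun g => g.1.yPowEnd d (σ.val g) k w) fun N hN =>
    { equivariant := fun g g' Υ h => by
        simp only [PseudoRiemMetric.yPowEnd_apply, σ.equivariant g g' Υ h, ← hw]
        exact h.isConformalChange.yPow hd (fun w X => derivation_expFn X w Υ)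
          (fun w => by rw [expFn_mul, sub_eq_add_neg]) (σ.val g) k w (hN.equivariant g g' Υ h)
      proj := fun g => by
        rw [PseudoRiemMetric.yPowEnd_apply,
          g.1.map_yPow d (σ.val g) (Φ.proj g) (Φ.natural.map_covTensor g), hN.proj] }

theorem sectionPow_apply (hd : 3 ≤ d) (σ : RealDensity c 1) (k : ℕ) (hw : w - k = w')
    (F : sections Φ w) (g : c.metrics) :
    (sectionPow Φ hd σ k hw F).1 g = complexify (g.1.yPow d (σ.val g) k w) (F.1 g) :=
  congrArg (complexify · (F.1 g)) (funext (g.1.yPowEnd_apply d (σ.val g) k w))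

theorem isDifferentialOperator_sectionPow (hd : 3 ≤ d) (σ : RealDensity c 1) (k : ℕ)
    (hw : w - k = w') : IsDifferentialOperator Φ (sectionPow Φ hd σ k hw) :=
  ⟨2 * k, isDiffOp_of_hasOrderLE (fun _ _ => rfl) fun g =>
    g.1.hasOrderLE_yPowEnd (σ.val g) (by omega) k w⟩

theorem sectionPow_comp_mulDensity (hd : 3 ≤ d) (σ : RealDensity c 1)
    (hI : ∀ (g : c.metrics) (x : M), g.1.scaleSq d (σ.val g) x ≠ 0) {k : ℕ}
    (hw : w - k = w') (hwk : 2 * w = k + 1 - d) :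
    sectionPow Φ hd σ k hw ∘ₗ mulDensity Φ σ w =
      mulDensity Φ σ w' ∘ₗ sectionPow Φ hd σ k (by rw [← hw]; ring) := by
  refine LinearMap.ext fun F => Subtype.ext <| funext fun g => ?_
  have hmul (N : TractorTensor (Fn d M) Φ.rank) :
      g.1.yPow d (σ.val g) k w (σ.val g • N) = σ.val g • g.1.yPow d (σ.val g) k (w - 1) N :=
    g.1.yPow_mul_scale (σ.val g) (by omega) (isUnit_of_forall_ne_zero (hI g)) hwk N
  calc (sectionPow Φ hd σ k hw (mulDensity Φ σ w F)).1 g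
      = complexify (g.1.yPow d (σ.val g) k w) (σ.val g • F.1 g) :=
        sectionPow_apply Φ hd σ k hw (mulDensity Φ σ w F) g
    _ = σ.val g • complexify (g.1.yPow d (σ.val g) k (w - 1)) (F.1 g) := by
        refine ctensor_ext ?_ ?_
        · simp only [reT_complexify, reT_fnSMul, hmul]
        · simp only [imT_complexify, imT_fnSMul, hmul]
    _ = σ.val g • (sectionPow Φ hd σ k _ F).1 g :=
        congrArg (σ.val g • ·) (sectionPow_apply Φ hd σ k _ F g).symm

end Sections

section Descent

theorem exists_linearMap_apply_eq {R V V' W : Type*} [Ring R] [AddCommGroup V] [Module R V]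
    [AddCommGroup V'] [Module R V'] [AddCommGroup W] [Module R W] {ρ : V →ₗ[R] V'}
    (hρ : Function.Surjective ρ) {S : V →ₗ[R] W} (hS : ∀ v, ρ v = 0 → S v = 0) :
    ∃ Q : V' →ₗ[R] W, ∀ v, Q (ρ v) = S v := by
  have hker : LinearMap.ker ρ ≤ LinearMap.ker S := fun v hv =>
    LinearMap.mem_ker.2 (hS v (LinearMap.mem_ker.1 hv))
  refine ⟨(LinearMap.ker ρ).liftQ S hker ∘ₗ (ρ.quotKerEquivOfSurjective hρ).symm, fun v => ?_⟩
  have hv : (ρ.quotKerEquivOfSurjective hρ).symm (ρ v) = Submodule.Quotient.mk v :=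
    (LinearEquiv.symm_apply_eq _).2 rfl
  rw [LinearMap.comp_apply, LinearEquiv.coe_coe, hv, Submodule.liftQ_apply]

theorem isDiffOp_of_descent {R R' V W V' W' : Type*} [AddCommGroup V] [Module ℂ V]
    [AddCommGroup W] [Module ℂ W] [AddCommGroup V'] [Module ℂ V'] [AddCommGroup W'] [Module ℂ W']
    {μ : R → V →ₗ[ℂ] V} {ν : R → W →ₗ[ℂ] W} {μ' : R' → V' →ₗ[ℂ] V'} {ν' : R' → W' →ₗ[ℂ] W'}
    {ρ : V →ₗ[ℂ] V'} {τ : W →ₗ[ℂ] W'} (hρ : Function.Surjective ρ)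
    (hext : ∀ f' : R', ∃ f : R, (∀ v, ρ (μ f v) = μ' f' (ρ v)) ∧ ∀ v, τ (ν f v) = ν' f' (τ v))
    {m : ℕ} {P : V →ₗ[ℂ] W} {Q : V' →ₗ[ℂ] W'} (hQ : ∀ v, Q (ρ v) = τ (P v))
    (hP : IsDiffOp μ ν m P) : IsDiffOp μ' ν' m Q := by
  induction m generalizing P Q with
  | zero =>
    intro f'
    obtain ⟨f, hμ, hν⟩ := hext f'
    refine LinearMap.ext fun v' => ?_
    obtain ⟨v, rfl⟩ := hρ v'
    rw [LinearMap.comp_apply, LinearMap.comp_apply, ← hμ, hQ, hQ, ← hν]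
    exact congrArg τ (LinearMap.congr_fun (hP f) v)
  | succ m ih =>
    intro f'
    obtain ⟨f, hμ, hν⟩ := hext f'
    refine ih (fun v => ?_) (hP f)
    simp only [LinearMap.sub_apply, LinearMap.comp_apply, map_sub, ← hμ, hQ, ← hν]

end Descent

section Restriction

variable {d : ℕ} {M : Type*} [TopologicalSpace M] [ChartedSpace (EuclideanSpace ℝ (Fin d)) M]
  {c : ConformalStructure d M} {Φ : TractorBundle c} {w w' : ℝ}

theorem RealDensity.mem_zeroLocus_iff (σ : RealDensity c w) (g : c.metrics) {x : M} :
    x ∈ σ.zeroLocus ↔ σ.val g x = 0 := by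
  refine ⟨fun h => h g, fun h g' => ?_⟩
  obtain ⟨Υ, hΥ⟩ := (c.mem_iff g.1 g.2 g'.1).1 g'.2
  rw [σ.equivariant g g' Υ hΥ, ContMDiffMap.coe_mul, Pi.mul_apply, h, mul_zero]

theorem RealDensity.isClosed_zeroLocus (σ : RealDensity c w) : IsClosed σ.zeroLocus := by
  simp only [zeroLocus, Set.ofPred_forall]
  exact isClosed_iInter fun g => isClosed_eq (σ.val g).contMDiff.continuous continuous_const

theorem restrict_mulDensity (σ : RealDensity c 1) (G : sections Φ (w - 1)) :
    restrict Φ w σ.zeroLocus (mulDensity Φ σ w G) = 0 :=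
  Subtype.ext <| funext fun g => funext fun T => funext fun x => by
    change σ.val g x • G.1 g T x = 0
    rw [x.2 g, zero_smul]

theorem restrict_mulFn {Z : Set M} {f : FnOn d Z} {f' : Fn d M} (h : ∀ x : Z, f' x = f.val x)
    (F : sections Φ w) : restrict Φ w Z (mulFn Φ w f' F) = mulFnOn Φ w Z f (restrict Φ w Z F) :=
  Subtype.ext <| funext fun g => funext fun T => funext fun x => congrArg (· • F.1 g T x) (h x)

theorem isDefining_of_scaleSq_ne_zero (hd : d ≠ 0)
    {g : PseudoRiemMetric (Fn d M)} {s : Fn d M} (hI : ∀ x, g.scaleSq d s x ≠ 0) :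
    IsDefining s := by
  intro x hx
  have h := hI x
  rw [g.scaleSq_eq s hd, ContMDiffMap.coe_add, Pi.add_apply, ContMDiffMap.coe_mul, Pi.mul_apply,
    ContMDiffMap.coe_mul, Pi.mul_apply, hx, zero_mul, mul_zero, add_zero] at h
  exact ⟨g.grad s, h⟩

variable [T2Space M] [IsManifold (𝓡 d) ∞ M]

theorem IsDefining.mul_left_cancel {s f h : Fn d M} (hs : IsDefining s) (heq : s * f = s * h) :
    f = h :=
  sub_eq_zero.1 (hs.eq_zero_of_mul_eq_zero (by rw [mul_sub, heq, sub_self]))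

theorem IsDefining.smul_left_cancel {s : Fn d M} (hs : IsDefining s) {r : ℕ}
    {R S : TractorTensor (Fn d M) r} (h : s • R = s • S) : R = S :=
  MultilinearMap.ext fun T => hs.mul_left_cancel (DFunLike.congr_fun h T)

theorem IsDefining.exists_tensor_quotient {s : Fn d M} (hs : IsDefining s) {r : ℕ}
    {R : TractorTensor (Fn d M) r} (hR : ∀ T x, s x = 0 → R T x = 0) :
    ∃ S : TractorTensor (Fn d M) r, R = s • S := by
  choose q hq using fun T => hs.exists_quotient (hR T)
  refine ⟨MultilinearMap.mk' q (fun T i a b => hs.mul_left_cancel ?_)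
    (fun T i f a => hs.mul_left_cancel ?_), MultilinearMap.ext hq⟩
  · rw [mul_add, ← hq, ← hq, ← hq, R.map_update_add]
  · rw [← hq, R.map_update_smul, hq, smul_eq_mul, smul_eq_mul, mul_left_comm]

theorem IsRealSection.of_smul {σ : RealDensity c 1} (hσ : ∀ g, IsDefining (σ.val g))
    {N : c.metrics → TractorTensor (Fn d M) Φ.rank}
    (hN : IsRealSection Φ w fun g => σ.val g • N g) : IsRealSection Φ (w - 1) N where
  equivariant g g' Υ h := by
    refine (hσ g').smul_left_cancel ?_
    rw [← map_smul, hN.equivariant g g' Υ h, σ.equivariant g g' Υ h, smul_smul, smul_smul,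
      mul_right_comm, expFn_mul, add_sub_cancel]
  proj g := (hσ g).smul_left_cancel ((map_smul _ _ _).symm.trans (hN.proj g))

theorem exists_mulDensity_eq {σ : RealDensity c 1} (hσ : ∀ g, IsDefining (σ.val g))
    {F : sections Φ w} (hF : restrict Φ w σ.zeroLocus F = 0) : ∃ G, mulDensity Φ σ w G = F := by
  have hzero (g : c.metrics) (T) (x : M) (hx : σ.val g x = 0) : F.1 g T x = 0 :=
    congrFun (congrFun (congrFun (Subtype.ext_iff.1 hF) g) T) ⟨x, (σ.mem_zeroLocus_iff g).2 hx⟩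
  choose R hR using fun g => (hσ g).exists_tensor_quotient (R := reT (F.1 g))
    fun T x hx => congrArg Complex.re (hzero g T x hx)
  choose S hS using fun g => (hσ g).exists_tensor_quotient (R := imT (F.1 g))
    fun T x hx => congrArg Complex.im (hzero g T x hx)
  have hFparts := mem_sections_iff.1 F.2
  simp only [hR, hS] at hFparts
  refine ⟨⟨fun g => ofParts (R g) (S g), mem_sections_iff.2 ?_⟩,
    Subtype.ext <| funext fun g => ctensor_ext ?_ ?_⟩
  · simp only [reT_ofParts, imT_ofParts]
    exact hFparts.imp (.of_smul hσ) (.of_smul hσ)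
  · exact (reT_fnSMul _ _).trans (by rw [reT_ofParts, ← hR])
  · exact (imT_fnSMul _ _).trans (by rw [imT_ofParts, ← hS])

theorem ActsTangentially.restrict_eq_zero {σ : RealDensity c 1} (hσ : ∀ g, IsDefining (σ.val g))
    {P : sections Φ w →ₗ[ℂ] sections Φ w'} (hP : ActsTangentially Φ σ P) {F : sections Φ w}
    (hF : restrict Φ w σ.zeroLocus F = 0) : restrict Φ w' σ.zeroLocus (P F) = 0 := by
  obtain ⟨P', hP'⟩ := hP
  obtain ⟨G, rfl⟩ := exists_mulDensity_eq hσ hF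
  exact (congrArg _ (LinearMap.congr_fun hP' G)).trans (restrict_mulDensity σ (P' G))

theorem IsRealSection.of_eqNear {N : c.metrics → TractorTensor (Fn d M) Φ.rank}
    (h : ∀ x : M, ∃ N', IsRealSection Φ w N' ∧ ∀ g, EqNear d x (N g) (N' g)) :
    IsRealSection Φ w N where
  equivariant g g' Υ hΥ := IsLocalModule.eq_of_eqNear (d := d) (M := M) fun x => by
    obtain ⟨N', hN', hnear⟩ := h x
    exact ((hnear g').map _).trans (hN'.equivariant g g' Υ hΥ ▸ ((hnear g).smul _).symm)
  proj g := IsLocalModule.eq_of_eqNear (d := d) (M := M) fun x => by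
    obtain ⟨N', hN', hnear⟩ := h x
    exact ((hnear g).map _).trans ((hN'.proj g).symm ▸ (hnear g).symm)

theorem exists_section_of_local (h : M → sections Φ w)
    (hh : ∀ x, ∀ᶠ y in 𝓝 x, ∀ g T, (h x).1 g T y = (h y).1 g T y) :
    ∃ H : sections Φ w, ∀ g T x, H.1 g T x = (h x).1 g T x := by
  let G : c.metrics → CTractorTensor d M Φ.rank := fun g => MultilinearMap.mk'
    (fun T => ⟨fun x => (h x).1 g T x, fun x =>
      ((h x).1 g T).contMDiff.contMDiffAt.congr_of_eventuallyEq
        ((hh x).mono fun y hy => (hy g T).symm)⟩)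
    (fun T i a b => ContMDiffMap.ext fun x =>
      DFunLike.congr_fun (((h x).1 g).map_update_add T i a b) x)
    (fun T i f a => ContMDiffMap.ext fun x =>
      DFunLike.congr_fun (((h x).1 g).map_update_smul T i f a) x)
  have hG (x : M) : ∃ χ : Fn d M, χ x = 1 ∧ ∀ g, χ • G g = χ • (h x).1 g := by
    obtain ⟨χ, hone, hχ⟩ := exists_fn_eq_zero_or d (hh x)
    refine ⟨χ, hone, fun g => MultilinearMap.ext fun T => ContMDiffMap.ext fun y => ?_⟩
    change χ y • (h y).1 g T y = χ y • (h x).1 g T y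
    rcases hχ y with hy | hy
    · rw [hy, zero_smul, zero_smul]
    · rw [hy g T]
  refine ⟨⟨G, mem_sections_iff.2 ⟨.of_eqNear fun x => ?_, .of_eqNear fun x => ?_⟩⟩,
    fun _ _ _ => rfl⟩
  · obtain ⟨χ, hone, hχ⟩ := hG x
    exact ⟨_, (mem_sections_iff.1 (h x).2).1, fun g => ⟨χ, hone, by
      rw [← reT_fnSMul, hχ, reT_fnSMul]⟩⟩
  · obtain ⟨χ, hone, hχ⟩ := hG x
    exact ⟨_, (mem_sections_iff.1 (h x).2).2, fun g => ⟨χ, hone, by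
      rw [← imT_fnSMul, hχ, imT_fnSMul]⟩⟩

variable [SecondCountableTopology M]

/-- The value of a section of `E^Φ[w]` at a point, evaluated on tractor fields; additive, so that it
can be applied to finite sums of sections. -/
def evalSection (g : c.metrics) (T : Fin Φ.rank → TractorField (Fn d M)) (x : M) :
    sections Φ w →+ ℂ where
  toFun F := F.1 g T x
  map_zero' := rfl
  map_add' _ _ := rfl

theorem restrict_surjective {Z : Set M} (hZ : IsClosed Z) :
    Function.Surjective (restrict Φ w Z) := by
  intro s
  have : LocallyCompactSpace M := ChartedSpace.locallyCompactSpace (EuclideanSpace ℝ (Fin d)) M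
  choose U hU F hF using s.2
  obtain ⟨ρ, hρ⟩ := SmoothPartitionOfUnity.exists_isSubordinate (𝓡 d) hZ
    (fun p => interior (U p)) (fun _ => isOpen_interior)
    (fun x hx => Set.mem_iUnion.2 ⟨⟨x, hx⟩, mem_interior_iff_mem_nhds.2 (hU ⟨x, hx⟩)⟩)
  let h (x : M) : sections Φ w := ∑ p ∈ ρ.fintsupport x, mulFn Φ w (ρ p) (F p)
  have h_apply (x g T y) : (h x).1 g T y = ∑ p ∈ ρ.fintsupport x, ρ p y • (F p).1 g T y :=
    map_sum (evalSection g T y) _ _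
  obtain ⟨H, hH⟩ := exists_section_of_local h fun x => by
    filter_upwards [ρ.eventually_fintsupport_subset x] with y hy g T
    rw [h_apply, h_apply]
    refine (Finset.sum_subset hy fun p _ hp => ?_).symm
    rw [ρ.mem_fintsupport_iff] at hp
    rw [image_eq_zero_of_notMem_tsupport hp, zero_smul]
  refine ⟨H, Subtype.ext <| funext fun g => funext fun T => funext fun x => ?_⟩
  have hterm (p : Z) : ρ p x • (F p).1 g T x = ρ p x • s.1 g T x := by
    by_cases hp : ρ p x = 0
    · rw [hp, zero_smul, zero_smul]
    · rw [hF p g T x (interior_subset (hρ p (subset_tsupport _ hp)))]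
  calc H.1 g T x = ∑ p ∈ ρ.fintsupport x, ρ p x • (F p).1 g T x := (hH g T x).trans (h_apply ..)
    _ = (∑ p ∈ ρ.fintsupport x, ρ p x) • s.1 g T x := by simp only [hterm, Finset.sum_smul]
    _ = s.1 g T x := by
      rw [ρ.sum_finsupport' x.1 x.2 (ρ.finsupport_subset_fintsupport x), one_smul]

theorem FnOn.exists_extension {Z : Set M} (hZ : IsClosed Z) (f : FnOn d Z) :
    ∃ F : Fn d M, ∀ x : Z, F x = f.val x := by
  have : LocallyCompactSpace M := ChartedSpace.locallyCompactSpace (EuclideanSpace ℝ (Fin d)) M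
  obtain ⟨F, hF⟩ := exists_contMDiffMap_forall_mem_convex_of_local (𝓡 d) (n := ⊤)
    (t := fun x => {y : ℝ | ∀ hx : x ∈ Z, y = f.val ⟨x, hx⟩})
    (fun x => by
      simp only [Set.ofPred_forall]
      exact convex_iInter fun hx => convex_singleton (f.val ⟨x, hx⟩))
    (fun x => by
      by_cases hx : x ∈ Z
      · obtain ⟨U, hU, G, hG⟩ := f.smooth ⟨x, hx⟩
        exact ⟨U, hU, G, G.contMDiff.contMDiffOn, fun y hy hyZ => (hG ⟨y, hyZ⟩ hy).symm⟩
      · exact ⟨Zᶜ, hZ.isOpen_compl.mem_nhds hx, 0, contMDiffOn_const,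
          fun y hy hyZ => absurd hyZ hy⟩)
  exact ⟨F, fun x => hF x x.2⟩

theorem IsDifferentialOperator.of_restrict {Z : Set M} (hZ : IsClosed Z)
    {P : sections Φ w →ₗ[ℂ] sections Φ w'} (hP : IsDifferentialOperator Φ P)
    {Q : sectionsOn Φ w Z →ₗ[ℂ] sectionsOn Φ w' Z}
    (hQ : ∀ F, Q (restrict Φ w Z F) = restrict Φ w' Z (P F)) :
    IsDifferentialOperatorOn Φ Z Q := by
  obtain ⟨m, hm⟩ := hP
  exact ⟨m, isDiffOp_of_descent (V := sections Φ w) (W := sections Φ w')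
    (restrict_surjective hZ) (fun f => (f.exists_extension hZ).imp fun _ h =>
      ⟨restrict_mulFn h, restrict_mulFn h⟩) hQ hm⟩

theorem exists_unique_restriction {σ : RealDensity c 1}
    (hσ : ∀ g, IsDefining (σ.val g)) {P : sections Φ w →ₗ[ℂ] sections Φ w'}
    (hP : IsDifferentialOperator Φ P) (hPσ : ActsTangentially Φ σ P) :
    ∃ Q : sectionsOn Φ w σ.zeroLocus →ₗ[ℂ] sectionsOn Φ w' σ.zeroLocus,
      IsDifferentialOperatorOn Φ σ.zeroLocus Q ∧
      (∀ F, Q (restrict Φ w σ.zeroLocus F) = restrict Φ w' σ.zeroLocus (P F)) ∧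
      ∀ Q' : sectionsOn Φ w σ.zeroLocus →ₗ[ℂ] sectionsOn Φ w' σ.zeroLocus,
        (∀ F, Q' (restrict Φ w σ.zeroLocus F) = restrict Φ w' σ.zeroLocus (P F)) → Q' = Q := by
  have hsurj : Function.Surjective (restrict Φ w σ.zeroLocus) :=
    restrict_surjective σ.isClosed_zeroLocus
  obtain ⟨Q, hQ⟩ := exists_linearMap_apply_eq (V := sections Φ w) hsurj
    (S := restrict Φ w' σ.zeroLocus ∘ₗ P) fun F hF => hPσ.restrict_eq_zero hσ hF
  exact ⟨Q, hP.of_restrict σ.isClosed_zeroLocus hQ, hQ,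
    fun Q' hQ' => LinearMap.ext <| hsurj.forall.2 fun F => (hQ' F).trans (hQ F).symm⟩

end Restriction

end Tractor

end

theorem theorem4p1 (n : ℕ) (hn : 2 ≤ n) {M : Type*} [TopologicalSpace M] [T2Space M]
    [SecondCountableTopology M] [ChartedSpace (EuclideanSpace ℝ (Fin (n + 1))) M]
    [IsManifold (𝓡 (n + 1)) ∞ M] (c : ConformalStructure (n + 1) M) (σ : RealDensity c 1)
    (hI : ∀ (g : c.metrics) (x : M), g.1.scaleSq (n + 1) (σ.val g) x ≠ 0)
    (Φ : TractorBundle c) (k : ℕ) (hk : 1 ≤ k) :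
    ∃ P : sections Φ (((k : ℝ) - n) / 2) →ₗ[ℂ] sections Φ ((-(k : ℝ) - n) / 2),
      (∀ F g, (P F).1 g =
        complexify (g.1.yPow (n + 1) (σ.val g) k (((k : ℝ) - n) / 2)) (F.1 g)) ∧
      IsDifferentialOperator Φ P ∧
      ActsTangentially Φ σ P ∧
      ∃ Q : sectionsOn Φ (((k : ℝ) - n) / 2) σ.zeroLocus →ₗ[ℂ]
          sectionsOn Φ ((-(k : ℝ) - n) / 2) σ.zeroLocus,
        IsDifferentialOperatorOn Φ σ.zeroLocus Q ∧
        (∀ F, Q (restrict Φ _ σ.zeroLocus F) = restrict Φ _ σ.zeroLocus (P F)) ∧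
        ∀ Q' : sectionsOn Φ (((k : ℝ) - n) / 2) σ.zeroLocus →ₗ[ℂ]
            sectionsOn Φ ((-(k : ℝ) - n) / 2) σ.zeroLocus,
          (∀ F, Q' (restrict Φ _ σ.zeroLocus F) = restrict Φ _ σ.zeroLocus (P F)) → Q' = Q := by
  have hd : 3 ≤ n + 1 := by omega
  have hw : ((k : ℝ) - n) / 2 - k = (-(k : ℝ) - n) / 2 := by ring
  have ht : ActsTangentially Φ σ (sectionPow Φ hd σ k hw) :=
    ⟨_, sectionPow_comp_mulDensity Φ hd σ hI hw (by push_cast; ring)⟩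
  have hD := isDifferentialOperator_sectionPow Φ hd σ k hw
  exact ⟨_, sectionPow_apply Φ hd σ k hw, hD, ht, exists_unique_restriction
    (fun g => isDefining_of_scaleSq_ne_zero n.succ_ne_zero (hI g)) hD ht⟩
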